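/- Setting. Let $H$ be a separable infinite-dimensional real Hilbert space with norm $|\cdot|$, with a complete orthonormal system $(e_j)_{j\ge1}$, and let $\Lambda$ be the unbounded self-adjoint operator with $\Lambda e_j=\lambda_j e_j$, where $(\lambda_j)_{j\ge 1}$ is a non-decreasing sequence of positive numbers with $\lambda_j\sim c_\Lambda j^2$ for some $c_\Lambda\in(0,\infty)$. For $\alpha\in[0,1]$ put $|x|_\alpha=|\Lambda^\alpha x|=\bigl(\sum_j\lambda_j^{2\alpha}\langle x,e_j\rangle^2\bigr)^{1/2}$ and $H^\alpha=\{x\in H:\ |x|_\alpha<\infty\}$. Let $F:H\times H\to H$ be of class $\mathcal C^3$ with bounded derivatives of orders $1,2,3$. A cylindrical Gaussian random variable is a formal series $\Gamma=\sum_j\gamma_je_j$ with $(\gamma_j)_j$ independent standard real Gaussian variables; for a Hilbert--Schmidt operator $B$, the $H$-valued random variable $B\Gamma=\sum_j\gamma_jBe_j$ is defined by convergence in mean square. Let $\epsilon_0,\Delta t_0\in(0,\infty)$ and $\kappa_0\in(0,1)$. The initial data $x_0\in H$ and $x_0^\epsilon,y_0^\epsilon\in H$, $\epsilon\in(0,\epsilon_0)$,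 satisfy, for given constants $R$ and $(K_\kappa)_{\kappa\in[0,\kappa_0]}$, $$|x_0^\epsilon-x_0|\le R\,\epsilon\,(1+|x_0|)\qquad\text{for all }\epsilon\in(0,\epsilon_0),$$ and, for all $\kappa\in[0,\kappa_0]$ and all $\epsilon\in(0,\epsilon_0)$: $x_0,x_0^\epsilon,y_0^\epsilon\in H^{\kappa/2}$ and $|x_0^\epsilon|_{\kappa/2}+|y_0^\epsilon|_{\kappa/2}\le K_\kappa(1+|x_0|_{\kappa/2})$. For $\tau>0$ let $\mathcal A_\tau=(I+\tau\Lambda)^{-1}$, $\mathcal B_{\tau,1}=\frac1{\sqrt2}(I+\tau\Lambda)^{-1}$, and let $\mathcal B_{\tau,2}$ be a bounded linear operator on $H$ with $\mathcal B_{\tau,2}\mathcal B_{\tau,2}^\star=\frac12(I+\tau\Lambda)^{-1}$. Let $(\Gamma_{n,1})_{n\ge0}$ and $(\Gamma_{n,2})_{n\ge0}$ be two independent sequences of independent cylindrical Gaussian random variables, and let $(\Gamma_n)_{n\ge0}$ be a sequence of independent cylindrical Gaussian random variables. For $T\in(0,\infty)$, $N\in\{1,2,\dots\}$, $\Delta t=T/N$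 and $\epsilon\in(0,\epsilon_0)$, the scheme is defined by $X_0^{\epsilon,\Delta t}=x_0^\epsilon$, $Y_0^{\epsilon,\Delta t}=y_0^\epsilon$ and, for $n\ge0$, $$X_{n+1}^{\epsilon,\Delta t}=\mathcal A_{\Delta t}\bigl(X_n^{\epsilon,\Delta t}+\Delta t\,F(X_n^{\epsilon,\Delta t},Y_{n+1}^{\epsilon,\Delta t})\bigr),$$ $$Y_{n+1}^{\epsilon,\Delta t}=\mathcal A_{\frac{\Delta t}{\epsilon}}Y_n^{\epsilon,\Delta t}+\sqrt{\tfrac{2\Delta t}{\epsilon}}\,\mathcal B_{\frac{\Delta t}{\epsilon},1}\Gamma_{n,1}+\sqrt{\tfrac{2\Delta t}{\epsilon}}\,\mathcal B_{\frac{\Delta t}{\epsilon},2}\Gamma_{n,2},$$ and the limiting scheme by $X_0^{\Delta t}=x_0$ and $X_{n+1}^{\Delta t}=\mathcal A_{\Delta t}X_n^{\Delta t}+\Delta t\,\mathcal A_{\Delta t}F(X_n^{\Delta t},\Lambda^{-1/2}\Gamma_n)$. For $\varphi:H\to\mathbb R$ of class $\mathcal C^2$ with bounded derivatives of orders $1,2$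 put $$|||\varphi|||_2=\sup_{x,\,h\neq0}\frac{|D\varphi(x).h|}{|h|}+\sup_{x,\,h_1,h_2\ne0}\frac{|D^2\varphi(x).(h_1,h_2)|}{|h_1||h_2|}.$$ Proposition. For all $\kappa\in(0,\kappa_0)$ and $T\in(0,\infty)$ there exists $C_\kappa(T)\in(0,\infty)$, independent of $\epsilon$, $\Delta t$ and $\varphi$, and depending on the initial data only through $R$ and $(K_\kappa)_\kappa$, such that for all initial data as above, all $\varphi:H\to\mathbb R$ of class $\mathcal C^2$ with bounded first and second order derivatives, all $\Delta t=T/N\in(0,\Delta t_0)$ and all $\epsilon\in(0,\epsilon_0)$, the random variables $\varphi(X_N^{\epsilon,\Delta t})$ and $\varphi(X_N^{\Delta t})$ are integrable and $$\bigl|\mathbb E[\varphi(X_N^{\epsilon,\Delta t})]-\mathbb E[\varphi(X_N^{\Delta t})]\bigr|\le C_\kappa(T)\Bigl(\frac{\epsilon}{\Delta t^{\kappa}}+\Delta t^{1-\kappa}\Bigr)|||\varphi|||_2\,(1+|x_0|^2).$$ -/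

import Mathlib

open MeasureTheory ProbabilityTheory Filter Topology
open scoped InnerProductSpace

namespace SlowFast

noncomputable section

section Operators

variable {H : Type*} [NormedAddCommGroup H] [InnerProductSpace ℝ H]

/-- The eigenvalues `lam 0 ≤ lam 1 ≤ ⋯` of the operator `Λ` (the mathematical index `j ≥ 1` is
`j + 1` here): a non-decreasing sequence of positive reals equivalent to `c * j ^ 2`. -/
structure IsSpectrum (lam : ℕ → ℝ) : Prop where
  pos : ∀ j, 0 < lam j
  mono : Monotone lam
  growth : ∃ c : ℝ, 0 < c ∧
    Asymptotics.IsEquivalent atTop lam (fun j : ℕ => c * ((j : ℝ) + 1) ^ 2)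

theorem memLp_diag (e : HilbertBasis ℕ ℝ H) {c : ℕ → ℝ} {M : ℝ} (hM : ∀ j, |c j| ≤ M) (x : H) :
    Memℓp (fun j => c j * e.repr x j) 2 := by
  have hx : Summable fun j => ‖e.repr x j‖ ^ (2 : ENNReal).toReal :=
    (memℓp_gen_iff (by norm_num)).1 (lp.memℓp (e.repr x))
  refine memℓp_gen ((hx.mul_left (M ^ 2)).of_nonneg_of_le (fun j => by positivity) fun j => ?_)
  have h2 : (2 : ENNReal).toReal = ((2 : ℕ) : ℝ) := by norm_num
  rw [h2, Real.rpow_natCast, Real.rpow_natCast, norm_mul, mul_pow, Real.norm_eq_abs (c j)]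
  gcongr
  exact hM j

open scoped Classical in
/-- The bounded operator `x ↦ ∑ⱼ c j ⟨x, e j⟩ e j`, for a bounded sequence `c`
(and `0` if `c` is unbounded). -/
def diagonalOp (e : HilbertBasis ℕ ℝ H) (c : ℕ → ℝ) : H →L[ℝ] H :=
  if hc : ∃ M : ℝ, ∀ j, |c j| ≤ M then
    LinearMap.mkContinuousOfExistsBound
      { toFun := fun x => e.repr.symm ⟨fun j => c j * e.repr x j, memLp_diag e hc.choose_spec x⟩
        map_add' := fun x y => by
          rw [← map_add]
          congr 1
          ext j
          exact (congrArg (c j * ·) (by simp)).trans (mul_add _ _ _)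
        map_smul' := fun r x => by
          rw [← map_smul]
          congr 1
          ext j
          simp [mul_left_comm] }
      (by
        refine ⟨max hc.choose 0, fun x => ?_⟩
        have hb := hc.choose_spec
        simp only [LinearMap.coe_mk, AddHom.coe_mk, LinearIsometryEquiv.norm_map]
        refine (sq_le_sq₀ (norm_nonneg _) (by positivity)).1 ?_
        have key : ∀ f : lp (fun _ : ℕ => ℝ) 2, HasSum (fun j => (f j) ^ 2) (‖f‖ ^ 2) := by
          intro f
          have h := lp.hasSum_inner (𝕜 := ℝ) f f
          rw [real_inner_self_eq_norm_sq] at h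
          simpa [pow_two] using h
        have h1 := key ⟨fun j => c j * e.repr x j, memLp_diag e hc.choose_spec x⟩
        have h2 := (key (e.repr x)).mul_left ((max hc.choose 0) ^ 2)
        rw [LinearIsometryEquiv.norm_map] at h2
        rw [mul_pow]
        refine hasSum_le (fun j => ?_) h1 h2
        simp only [mul_pow]
        refine mul_le_mul_of_nonneg_right ?_ (sq_nonneg _)
        rw [← sq_abs (c j)]
        exact pow_le_pow_left₀ (abs_nonneg _) ((hb j).trans (le_max_left _ _)) 2)
  else 0

theorem inner_diagonalOp (e : HilbertBasis ℕ ℝ H) {c : ℕ → ℝ} {M : ℝ} (hM : ∀ j, |c j| ≤ M)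
    (x : H) (j : ℕ) : ⟪e j, diagonalOp e c x⟫_ℝ = c j * ⟪e j, x⟫_ℝ := by
  have hc : ∃ M : ℝ, ∀ j, |c j| ≤ M := ⟨M, hM⟩
  rw [← e.repr_apply_apply, ← e.repr_apply_apply, diagonalOp, dif_pos hc]
  simp [LinearMap.mkContinuousOfExistsBound]

theorem hasSum_diagonalOp (e : HilbertBasis ℕ ℝ H) {c : ℕ → ℝ} {M : ℝ} (hM : ∀ j, |c j| ≤ M)
    (x : H) : HasSum (fun j => (c j * ⟪e j, x⟫_ℝ) • e j) (diagonalOp e c x) := by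
  have h := e.hasSum_repr (diagonalOp e c x)
  simpa only [e.repr_apply_apply, inner_diagonalOp e hM] using h

/-- `x` belongs to the domain `H^α` of `Λ^α`, that is, `∑ⱼ λⱼ^(2α) ⟨x, eⱼ⟩² < ∞`. -/
def MemPow (e : HilbertBasis ℕ ℝ H) (lam : ℕ → ℝ) (α : ℝ) (x : H) : Prop :=
  Summable fun j => lam j ^ (2 * α) * ⟪e j, x⟫_ℝ ^ 2

/-- The norm `|x|_α = |Λ^α x|`, for `x ∈ H^α`. -/
def powNorm (e : HilbertBasis ℕ ℝ H) (lam : ℕ → ℝ) (α : ℝ) (x : H) : ℝ :=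
  √(∑' j, lam j ^ (2 * α) * ⟪e j, x⟫_ℝ ^ 2)

theorem memLp_domain (e : HilbertBasis ℕ ℝ H) {lam : ℕ → ℝ} {x : H}
    (hx : Summable fun j => (lam j * e.repr x j) ^ 2) :
    Memℓp (fun j => lam j * e.repr x j) 2 := by
  refine memℓp_gen ?_
  have h2 : (2 : ENNReal).toReal = ((2 : ℕ) : ℝ) := by norm_num
  simpa only [h2, Real.rpow_natCast, Real.norm_eq_abs, sq_abs] using hx

/-- The domain `H^1` of `Λ`. -/
def domainOp (e : HilbertBasis ℕ ℝ H) (lam : ℕ → ℝ) : Submodule ℝ H where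
  carrier := {x | Summable fun j => (lam j * e.repr x j) ^ 2}
  zero_mem' := by simp [summable_zero]
  add_mem' := fun {x y} hx hy => by
    have h := (Memℓp.add (memLp_domain e hx) (memLp_domain e hy))
    have h' := (memℓp_gen_iff (by norm_num)).1 h
    have h2 : (2 : ENNReal).toReal = ((2 : ℕ) : ℝ) := by norm_num
    simp only [h2, Real.rpow_natCast, Real.norm_eq_abs, sq_abs, Pi.add_apply, ← mul_add] at h'
    change Summable fun j => (lam j * e.repr (x + y) j) ^ 2
    rw [map_add]
    exact h'
  smul_mem' := fun r x hx => by
    have h : Summable fun j => (lam j * e.repr x j) ^ 2 := hx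
    change Summable fun j => (lam j * e.repr (r • x) j) ^ 2
    refine (h.mul_left (r ^ 2)).congr fun j => ?_
    rw [map_smul]
    change r ^ 2 * (lam j * e.repr x j) ^ 2 = (lam j * (r * e.repr x j)) ^ 2
    ring

/-- The unbounded self-adjoint operator `Λ`, with `Λ e j = lam j • e j`, on its domain `H^1`. -/
def unboundedOp (e : HilbertBasis ℕ ℝ H) (lam : ℕ → ℝ) : H →ₗ.[ℝ] H where
  domain := domainOp e lam
  toFun :=
    { toFun := fun x => e.repr.symm ⟨fun j => lam j * e.repr (x : H) j, memLp_domain e x.2⟩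
      map_add' := fun x y => by
        rw [← map_add]
        congr 1
        ext j
        exact (congrArg (lam j * ·) (by simp)).trans (mul_add _ _ _)
      map_smul' := fun r x => by
        rw [RingHom.id_apply, ← map_smul]
        congr 1
        ext j
        exact (congrArg (lam j * ·) (by simp)).trans (mul_left_comm _ r _) }

/-- The operator `𝒜_τ = (I + τ Λ)⁻¹`, with eigenvalues `1 / (1 + τ lam j)`. -/
def resolvent (e : HilbertBasis ℕ ℝ H) (lam : ℕ → ℝ) (τ : ℝ) : H →L[ℝ] H :=
  diagonalOp e fun j => (1 + τ * lam j)⁻¹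

/-- The bounded operator `Λ^{-1/2}`. -/
def invSqrtOp (e : HilbertBasis ℕ ℝ H) (lam : ℕ → ℝ) : H →L[ℝ] H :=
  diagonalOp e fun j => lam j ^ (-(1 / 2) : ℝ)

theorem abs_resolvent_le {lam : ℕ → ℝ} (hlam : IsSpectrum lam) {τ : ℝ} (hτ : 0 < τ) (j : ℕ) :
    |(1 + τ * lam j)⁻¹| ≤ 1 := by
  have h : 0 < τ * lam j := mul_pos hτ (hlam.pos j)
  rw [abs_of_pos (by positivity)]
  exact inv_le_one_of_one_le₀ (by linarith)

theorem inner_resolvent (e : HilbertBasis ℕ ℝ H) {lam : ℕ → ℝ} (hlam : IsSpectrum lam)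
    {τ : ℝ} (hτ : 0 < τ) (x : H) (j : ℕ) :
    ⟪e j, resolvent e lam τ x⟫_ℝ = (1 + τ * lam j)⁻¹ * ⟪e j, x⟫_ℝ :=
  inner_diagonalOp e (abs_resolvent_le hlam hτ) x j

theorem inner_unboundedOp (e : HilbertBasis ℕ ℝ H) (lam : ℕ → ℝ) (x : (unboundedOp e lam).domain)
    (j : ℕ) : ⟪e j, unboundedOp e lam x⟫_ℝ = lam j * ⟪e j, (x : H)⟫_ℝ := by
  rw [← e.repr_apply_apply, ← e.repr_apply_apply]
  change e.repr (e.repr.symm _) j = _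
  simp

theorem ext_inner (e : HilbertBasis ℕ ℝ H) {x y : H} (h : ∀ j, ⟪e j, x⟫_ℝ = ⟪e j, y⟫_ℝ) :
    x = y := by
  apply e.repr.injective
  ext j
  simpa only [e.repr_apply_apply] using h j

/-- `resolvent` maps into the domain of `Λ` and is a right inverse of `I + τ Λ`. -/
theorem resolvent_right_inverse (e : HilbertBasis ℕ ℝ H) {lam : ℕ → ℝ} (hlam : IsSpectrum lam)
    {τ : ℝ} (hτ : 0 < τ) (x : H) :
    ∃ h : resolvent e lam τ x ∈ (unboundedOp e lam).domain,
      resolvent e lam τ x + τ • unboundedOp e lam ⟨resolvent e lam τ x, h⟩ = x := by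
  have h : resolvent e lam τ x ∈ (unboundedOp e lam).domain := by
    change Summable fun j => (lam j * e.repr (resolvent e lam τ x) j) ^ 2
    have hx : Summable fun j => (e.repr x j) ^ 2 := by
      simpa [pow_two] using lp.summable_inner (𝕜 := ℝ) (e.repr x) (e.repr x)
    refine (hx.mul_left ((1 / τ) ^ 2)).of_nonneg_of_le (fun j => sq_nonneg _) fun j => ?_
    have h1 : e.repr (resolvent e lam τ x) j = (1 + τ * lam j)⁻¹ * e.repr x j := by
      rw [e.repr_apply_apply, e.repr_apply_apply, inner_resolvent e hlam hτ]
    rw [h1, ← mul_assoc, mul_pow]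
    refine mul_le_mul_of_nonneg_right ?_ (sq_nonneg _)
    have hp := mul_pos hτ (hlam.pos j)
    have hl := (hlam.pos j).le
    refine pow_le_pow_left₀ (by positivity) ?_ 2
    rw [← div_eq_mul_inv, div_le_div_iff₀ (by linarith) hτ]
    nlinarith
  refine ⟨h, ext_inner e fun j => ?_⟩
  have hp := mul_pos hτ (hlam.pos j)
  have hne : 1 + τ * lam j ≠ 0 := by linarith
  rw [inner_add_right, inner_smul_right, inner_unboundedOp, inner_resolvent e hlam hτ]
  field_simp

/-- `resolvent` is a left inverse of `I + τ Λ` on the domain of `Λ`. -/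
theorem resolvent_left_inverse (e : HilbertBasis ℕ ℝ H) {lam : ℕ → ℝ} (hlam : IsSpectrum lam)
    {τ : ℝ} (hτ : 0 < τ) (x : (unboundedOp e lam).domain) :
    resolvent e lam τ ((x : H) + τ • unboundedOp e lam x) = x := by
  refine ext_inner e fun j => ?_
  have hp := mul_pos hτ (hlam.pos j)
  have hne : 1 + τ * lam j ≠ 0 := by linarith
  rw [inner_resolvent e hlam hτ, inner_add_right, inner_smul_right,
    inner_unboundedOp]
  field_simp

end Operators

section Functions

/-- `f` is of class `C^k`, with bounded derivatives of order `1, …, k`. -/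
def IsCkBounded {E G : Type*} [NormedAddCommGroup E] [NormedSpace ℝ E]
    [NormedAddCommGroup G] [NormedSpace ℝ G] (k : ℕ) (f : E → G) : Prop :=
  ContDiff ℝ k f ∧
    ∀ i : ℕ, 1 ≤ i → i ≤ k → ∃ C : ℝ, ∀ x, ‖iteratedFDeriv ℝ i f x‖ ≤ C

variable {H : Type*} [NormedAddCommGroup H] [InnerProductSpace ℝ H]

/-- `sup_{x, h} |Dφ(x).h| / |h|`; the terms with `h = 0` contribute `0`. -/
def tripleNorm₁ (φ : H → ℝ) : ℝ :=
  ⨆ p : H × H, |fderiv ℝ φ p.1 p.2| / ‖p.2‖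

/-- `|||φ|||_1 + sup_{x, h₁, h₂} |D²φ(x).(h₁, h₂)| / (|h₁| |h₂|)`; the terms with `h₁ = 0` or
`h₂ = 0` contribute `0`. -/
def tripleNorm₂ (φ : H → ℝ) : ℝ :=
  tripleNorm₁ φ +
    ⨆ p : H × H × H, |iteratedFDeriv ℝ 2 φ p.1 ![p.2.1, p.2.2]| / (‖p.2.1‖ * ‖p.2.2‖)

end Functions

section Noise

variable {H : Type*} [NormedAddCommGroup H] [InnerProductSpace ℝ H]
  {Ω : Type*} [MeasurableSpace Ω]

/-- A family, indexed by `ι`, of independent cylindrical Gaussian random variables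
`Γ i = ∑ⱼ γ i j • e j`, given by their coordinates: the `γ i j` are jointly independent
standard Gaussian random variables. -/
structure IsCylindricalGaussianFamily {ι : Type*} (P : Measure Ω) (γ : ι → ℕ → Ω → ℝ) : Prop where
  measurable : ∀ i j, Measurable (γ i j)
  law : ∀ i j, P.map (γ i j) = gaussianReal 0 1
  indep : iIndepFun (fun p : ι × ℕ => γ p.1 p.2) P

/-- `Z` is the sum in `L²(Ω; H)` of the series `∑ⱼ γ j • B (e j)`, that is, `Z = B Γ` for the
cylindrical Gaussian random variable `Γ = ∑ⱼ γ j • e j`. -/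
def IsMeanSquareSum (P : Measure Ω) (e : HilbertBasis ℕ ℝ H) (B : H →L[ℝ] H) (γ : ℕ → Ω → ℝ)
    (Z : Ω → H) : Prop :=
  MemLp Z 2 P ∧
    Tendsto (fun n : ℕ => eLpNorm (fun ω => Z ω - ∑ j ∈ Finset.range n, γ j ω • B (e j)) 2 P)
      atTop (𝓝 0)

/-- The series defining `B Γ` converges in mean square if `B` is a Hilbert–Schmidt operator. -/
theorem exists_isMeanSquareSum [CompleteSpace H] (P : Measure Ω) [IsProbabilityMeasure P]
    (e : HilbertBasis ℕ ℝ H) (B : H →L[ℝ] H) {ι : Type*} {γ : ι → ℕ → Ω → ℝ}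
    (hγ : IsCylindricalGaussianFamily P γ) (i : ι)
    (hB : Summable fun j => ‖B (e j)‖ ^ 2) : ∃ Z : Ω → H, IsMeanSquareSum P e B (γ i) Z := by
  have hlaw : ∀ j, HasLaw (γ i j) (gaussianReal 0 1) P :=
    fun j => ⟨(hγ.measurable i j).aemeasurable, hγ.law i j⟩
  have hmem : ∀ j, MemLp (γ i j) 2 P := fun j => by
    have h := memLp_id_gaussianReal (μ := 0) (v := 1) 2
    rw [← hγ.law i j] at h
    exact (memLp_map_measure_iff (by fun_prop) (hγ.measurable i j).aemeasurable).1 h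
  have hmemv : ∀ j, MemLp (fun ω => γ i j ω • B (e j)) 2 P := fun j =>
    ((ContinuousLinearMap.id ℝ ℝ).smulRight (B (e j))).comp_memLp' (hmem j)
  have hmean : ∀ j, ∫ ω, γ i j ω ∂P = 0 := fun j => by
    rw [(hlaw j).integral_eq]; simp
  have hsq : ∀ j, ∫ ω, γ i j ω * γ i j ω ∂P = 1 := fun j => by
    have h := variance_eq_sub (hmem j)
    rw [hmean, (hlaw j).variance_eq] at h
    simpa [pow_two] using h.symm
  have hinner : ∀ j k, ⟪(hmemv j).toLp, (hmemv k).toLp⟫_ℝ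
      = (∫ ω, γ i j ω * γ i k ω ∂P) * ⟪B (e j), B (e k)⟫_ℝ := fun j k => by
    rw [L2.inner_def, ← integral_mul_const]
    refine integral_congr_ae ?_
    filter_upwards [(hmemv j).coeFn_toLp, (hmemv k).coeFn_toLp] with ω h1 h2
    rw [h1, h2, inner_smul_left, inner_smul_right]
    simp [mul_assoc]
  have horth : OrthogonalFamily ℝ (fun j => (ℝ ∙ (hmemv j).toLp : Submodule ℝ (Lp H 2 P)))
      (fun j => (ℝ ∙ (hmemv j).toLp : Submodule ℝ (Lp H 2 P)).subtypeₗᵢ) := by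
    refine OrthogonalFamily.of_pairwise fun j k hjk => ?_
    change (ℝ ∙ (hmemv j).toLp) ⟂ (ℝ ∙ (hmemv k).toLp)
    rw [Submodule.isOrtho_span]
    rintro u rfl v rfl
    rw [hinner]
    have hind : IndepFun (γ i j) (γ i k) P :=
      hγ.indep.indepFun (i := (i, j)) (j := (i, k)) (by simpa using hjk)
    rw [hind.integral_fun_mul_eq_mul_integral (hmem j).1 (hmem k).1, hmean]
    simp
  have hsum : Summable fun j => (hmemv j).toLp := by
    refine (horth.summable_iff_norm_sq_summable
      (fun j => ⟨(hmemv j).toLp, Submodule.mem_span_singleton_self _⟩)).2 ?_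
    refine hB.congr fun j => ?_
    have := hinner j j
    rw [hsq, one_mul, real_inner_self_eq_norm_sq, real_inner_self_eq_norm_sq] at this
    exact this.symm
  refine ⟨(∑' j, (hmemv j).toLp : Lp H 2 P), Lp.memLp _, ?_⟩
  have h := (Lp.tendsto_Lp_iff_tendsto_eLpNorm' _ _).1 hsum.hasSum.tendsto_sum_nat
  refine h.congr fun n => ?_
  rw [eLpNorm_sub_comm]
  refine eLpNorm_congr_ae ?_
  have h1 : ∀ n : ℕ, ⇑(∑ j ∈ Finset.range n, (hmemv j).toLp) =ᵐ[P]
      fun ω => ∑ j ∈ Finset.range n, γ i j ω • B (e j) := by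
    intro n
    induction n with
    | zero =>
      simp only [Finset.range_zero, Finset.sum_empty]
      exact Lp.coeFn_zero H 2 P
    | succ n ih =>
      rw [Finset.sum_range_succ]
      filter_upwards [Lp.coeFn_add (∑ j ∈ Finset.range n, (hmemv j).toLp) (hmemv n).toLp, ih,
        (hmemv n).coeFn_toLp] with ω h1 h2 h3
      rw [h1, Pi.add_apply, h2, h3, Finset.sum_range_succ]
  filter_upwards [h1 n] with ω h2
  rw [Pi.sub_apply, h2]

open scoped Classical in
/-- The `H`-valued random variable `B Γ` (unique up to almost sure equality), for
`Γ = ∑ⱼ γ j • e j`. The series converges in `L²(Ω; H)` when `B` is a Hilbert–Schmidt operator,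
as is the case of all the operators used below. -/
def cylApply (P : Measure Ω) (e : HilbertBasis ℕ ℝ H) (B : H →L[ℝ] H) (γ : ℕ → Ω → ℝ) : Ω → H :=
  if h : ∃ Z : Ω → H, IsMeanSquareSum P e B γ Z then h.choose else 0

end Noise

section Schemes

variable {H : Type*} [NormedAddCommGroup H] [InnerProductSpace ℝ H]
  {Ω : Type*} [MeasurableSpace Ω]

/-- The fast component `Y_n`, with `τ = Δt / ε`; here `B₂ τ` is the operator `ℬ_{τ,2}`, the
operator `ℬ_{τ,1}` is `𝒜_τ / √2`, and `Γ_{n,1}`, `Γ_{n,2}` have the coordinates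
`γ (n, 0)`, `γ (n, 1)`. -/
def fastScheme (P : Measure Ω) (e : HilbertBasis ℕ ℝ H) (lam : ℕ → ℝ) (B₂ : ℝ → H →L[ℝ] H)
    (γ : ℕ × Fin 2 → ℕ → Ω → ℝ) (τ : ℝ) (y₀ : H) : ℕ → Ω → H
  | 0 => fun _ => y₀
  | n + 1 => fun ω =>
      resolvent e lam τ (fastScheme P e lam B₂ γ τ y₀ n ω)
        + √(2 * τ) • cylApply P e ((1 / √2) • resolvent e lam τ) (γ (n, 0)) ω
        + √(2 * τ) • cylApply P e (B₂ τ) (γ (n, 1)) ω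

/-- The slow component `X_n^{ε,Δt}`. -/
def slowScheme (P : Measure Ω) (e : HilbertBasis ℕ ℝ H) (lam : ℕ → ℝ) (B₂ : ℝ → H →L[ℝ] H)
    (F : WithLp 2 (H × H) → H) (γ : ℕ × Fin 2 → ℕ → Ω → ℝ) (ε Δt : ℝ) (x₀ y₀ : H) :
    ℕ → Ω → H
  | 0 => fun _ => x₀
  | n + 1 => fun ω =>
      resolvent e lam Δt
        (slowScheme P e lam B₂ F γ ε Δt x₀ y₀ n ω
          + Δt • F (WithLp.toLp 2 (slowScheme P e lam B₂ F γ ε Δt x₀ y₀ n ω,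
              fastScheme P e lam B₂ γ (Δt / ε) y₀ (n + 1) ω)))

/-- The limiting scheme `X_n^{Δt}`, driven by `Γ_n` with coordinates `γ n`. -/
def limitingScheme (P : Measure Ω) (e : HilbertBasis ℕ ℝ H) (lam : ℕ → ℝ)
    (F : WithLp 2 (H × H) → H) (γ : ℕ → ℕ → Ω → ℝ) (Δt : ℝ) (x₀ : H) : ℕ → Ω → H
  | 0 => fun _ => x₀
  | n + 1 => fun ω =>
      resolvent e lam Δt (limitingScheme P e lam F γ Δt x₀ n ω)
        + Δt • resolvent e lam Δt
            (F (WithLp.toLp 2 (limitingScheme P e lam F γ Δt x₀ n ω,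
              cylApply P e (invSqrtOp e lam) (γ n) ω)))

/-- The conditions on the initial values `x₀ε ε`, `y₀ε ε` (for `0 < ε < ε₀`) and on the limit `x₀`:
`|x₀ε ε - x₀|` is at most of order `ε` (in particular `x₀ε ε` tends to `x₀`), and the norms of order `κ / 2` are bounded uniformly in `ε`,
for all `κ ∈ [0, κ₀]`. -/
structure IsInitialData (e : HilbertBasis ℕ ℝ H) (lam : ℕ → ℝ) (ε₀ κ₀ : ℝ) (R : ℝ) (K : ℝ → ℝ)
    (x₀ : H) (x₀ε y₀ε : ℝ → H) : Prop where
  rate : ∀ ε ∈ Set.Ioo 0 ε₀, ‖x₀ε ε - x₀‖ ≤ R * ε * (1 + ‖x₀‖)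
  mem_limit : ∀ κ ∈ Set.Icc 0 κ₀, MemPow e lam (κ / 2) x₀
  mem_slow : ∀ κ ∈ Set.Icc 0 κ₀, ∀ ε ∈ Set.Ioo 0 ε₀, MemPow e lam (κ / 2) (x₀ε ε)
  mem_fast : ∀ κ ∈ Set.Icc 0 κ₀, ∀ ε ∈ Set.Ioo 0 ε₀, MemPow e lam (κ / 2) (y₀ε ε)
  bound : ∀ κ ∈ Set.Icc 0 κ₀, ∀ ε ∈ Set.Ioo 0 ε₀,
    powNorm e lam (κ / 2) (x₀ε ε) + powNorm e lam (κ / 2) (y₀ε ε)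
      ≤ K κ * (1 + powNorm e lam (κ / 2) x₀)

end Schemes

end

end SlowFast

set_option linter.unusedSectionVars false

/-! Neither scheme is compared with the other directly: both are compared with the deterministic
averaged scheme `xb (n + 1) = A (xb n + Δ • average F ν (xb n))`, where `ν` is the Gaussian law of
`Λ^{-1/2} Γ`. The joint law of the two driving noises therefore plays no role.

Each scheme has the form `X (n + 1) = A (X n + Δ • F (X n) (V n))`. A Taylor expansion of `φ` at `xb
N` reduces the weak error to the mean and the second moment of `D = X - xb`
(`weak_error_of_averaging`). Write `G k` for the fluctuation of `F` at `(X k, V k)`. An energy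
estimate bounds the second moment by `Δ ∑ E⟨D k, G k⟩` plus a term of order `Δ`. Linearising the
averaged coefficient bounds the mean by the Duhamel sum of the `E[G k]` plus the second moment.
Everything rests on these two sums. In the limiting scheme `V n` has law `ν` and is independent of
the past, so both sums vanish and the error is of order `Δ`.

In the slow scheme `V n = Y (n + 1)`, and the choice of the two noise operators makes `ν` exactly
invariant for the fast chain, for every step `τ` (`invariance_norm_sq`). The chain contracts at rate
`b = (1 + τ * lam 0)⁻¹`, so the Poisson equation for the fluctuation is solved by a geometric series
of size `(1 - b)⁻¹`. Summation by parts then leaves boundary terms and the increments of `X` and of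
the weights (`abs_sum_integral_inner_fluctuation_le`). The prefactor is `Δ (1 - b)⁻¹ = Δ + ε / lam
0`. The smoothing bound `‖A ^ n (1 - A)‖ ≤ 1 / (n + 1)` makes the sum of the increments logarithmic
in `N`, and bounding the logarithm by a multiple of `N ^ κ` is what costs the factor `Δ ^ (-κ)`. -/

namespace SlowFast

/-! ### Calculus of `L^p` bounds with explicit constants. -/

section LpBounds

variable {Ω : Type*} {m0 : MeasurableSpace Ω} {P : Measure Ω}
  {E E' : Type*} [NormedAddCommGroup E] [NormedAddCommGroup E'] {p : ENNReal}

/-- `f` is almost everywhere strongly measurable, with `L^p` norm at most `c`. -/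
def LpBd {m0 : MeasurableSpace Ω} (P : Measure Ω) (p : ENNReal) (f : Ω → E) (c : ℝ) : Prop :=
  AEStronglyMeasurable f P ∧ eLpNorm f p P ≤ ENNReal.ofReal c

theorem LpBd.memLp {f : Ω → E} {c : ℝ} (h : LpBd P p f c) : MemLp f p P :=
  ⟨h.1, h.2.trans_lt ENNReal.ofReal_lt_top⟩

theorem MemLp.lpBd {f : Ω → E} (h : MemLp f p P) : LpBd P p f (eLpNorm f p P).toReal :=
  ⟨h.1, by rw [ENNReal.ofReal_toReal h.2.ne]⟩

theorem LpBd.mono {f : Ω → E} {c d : ℝ} (h : LpBd P p f c) (hcd : c ≤ d) : LpBd P p f d :=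
  ⟨h.1, h.2.trans (ENNReal.ofReal_le_ofReal hcd)⟩

theorem LpBd.mono_norm {f : Ω → E} {g : Ω → E'} {c : ℝ} (h : LpBd P p g c)
    (hf : AEStronglyMeasurable f P) (hfg : ∀ ω, ‖f ω‖ ≤ ‖g ω‖) : LpBd P p f c :=
  ⟨hf, (eLpNorm_mono hfg).trans h.2⟩

theorem LpBd.mono_real {f : Ω → E} {g : Ω → ℝ} {c : ℝ} (h : LpBd P p g c)
    (hf : AEStronglyMeasurable f P) (hfg : ∀ ω, ‖f ω‖ ≤ g ω) : LpBd P p f c :=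
  h.mono_norm hf fun ω => (hfg ω).trans (le_abs_self _)

theorem LpBd.norm {f : Ω → E} {c : ℝ} (h : LpBd P p f c) : LpBd P p (fun ω => ‖f ω‖) c :=
  h.mono_norm h.1.norm fun ω => by simp

theorem LpBd.add {f g : Ω → E} {c d : ℝ} (hf : LpBd P p f c) (hg : LpBd P p g d) (hp : 1 ≤ p)
    (hc : 0 ≤ c) (hd : 0 ≤ d) : LpBd P p (fun ω => f ω + g ω) (c + d) :=
  ⟨hf.1.add hg.1, (eLpNorm_add_le hf.1 hg.1 hp).trans (by
    rw [ENNReal.ofReal_add hc hd]; exact add_le_add hf.2 hg.2)⟩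

theorem LpBd.const [IsProbabilityMeasure P] (x : E) (hp : p ≠ 0) :
    LpBd P p (fun _ => x) ‖x‖ :=
  ⟨aestronglyMeasurable_const, by
    rw [eLpNorm_const _ hp (IsProbabilityMeasure.ne_zero P)]; simp [ofReal_norm]⟩

theorem LpBd.const_mul {f : Ω → ℝ} {c : ℝ} (h : LpBd P p f c) {a : ℝ} (ha : 0 ≤ a) :
    LpBd P p (fun ω => a * f ω) (a * c) :=
  ⟨h.1.const_mul a, by
    have : eLpNorm (fun ω => a * f ω) p P = eLpNorm (a • f) p P := rfl
    rw [this, eLpNorm_const_smul, ENNReal.ofReal_mul ha, Real.enorm_eq_ofReal ha]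
    exact mul_le_mul_right h.2 _⟩

theorem LpBd.of_le [IsProbabilityMeasure P] {f : Ω → E} {c : ℝ} {q : ENNReal} (h : LpBd P p f c)
    (hqp : q ≤ p) : LpBd P q f c :=
  ⟨h.1, (eLpNorm_le_eLpNorm_of_exponent_le hqp h.1).trans h.2⟩

theorem LpBd.mul {q r : ENNReal} [ENNReal.HolderTriple p q r] {f g : Ω → ℝ} {c d : ℝ}
    (hf : LpBd P p f c) (hg : LpBd P q g d) (hc : 0 ≤ c) :
    LpBd P r (fun ω => f ω * g ω) (c * d) :=
  ⟨hf.1.mul hg.1, (eLpNorm_smul_le_mul_eLpNorm (p := p) (q := q) hg.1 hf.1).trans (by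
    rw [ENNReal.ofReal_mul hc]; exact mul_le_mul' hf.2 hg.2)⟩

theorem LpBd.sum {ι : Type*} {s : Finset ι} {f : ι → Ω → E} {c : ι → ℝ} (hp : 1 ≤ p)
    (h : ∀ i ∈ s, LpBd P p (f i) (c i)) (hc : ∀ i ∈ s, 0 ≤ c i) :
    LpBd P p (fun ω => ∑ i ∈ s, f i ω) (∑ i ∈ s, c i) := by
  classical
  induction s using Finset.induction_on with
  | empty => exact ⟨by simpa using aestronglyMeasurable_const, by simp⟩
  | insert i s hi ih =>
    simp only [Finset.sum_insert hi]
    exact (h i (by simp)).add (ih (fun j hj => h j (by simp [hj])) fun j hj => hc j (by simp [hj]))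
      hp (hc i (by simp)) (Finset.sum_nonneg fun j hj => hc j (by simp [hj]))

theorem LpBd.integrable {f : Ω → E} {c : ℝ} (h : LpBd P 1 f c) : Integrable f P :=
  memLp_one_iff_integrable.1 h.memLp

theorem LpBd.integral_norm_le {f : Ω → E} {c : ℝ} (h : LpBd P 1 f c) (hc : 0 ≤ c) :
    ∫ ω, ‖f ω‖ ∂P ≤ c := by
  rw [integral_norm_eq_lintegral_enorm h.1, ← eLpNorm_one_eq_lintegral_enorm]
  exact ENNReal.toReal_le_of_le_ofReal hc h.2

theorem LpBd.norm_integral_le [NormedSpace ℝ E] {f : Ω → E} {c : ℝ} (h : LpBd P 1 f c)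
    (hc : 0 ≤ c) : ‖∫ ω, f ω ∂P‖ ≤ c :=
  (norm_integral_le_integral_norm f).trans (h.integral_norm_le hc)

instance holderTriple_four_four_two : ENNReal.HolderTriple 4 4 2 where
  inv_add_inv_eq_inv := by
    rw [← two_mul]
    have : (4 : ENNReal) = 2 * 2 := by norm_num
    rw [this, ENNReal.mul_inv (by simp) (by simp), ← mul_assoc,
      ENNReal.mul_inv_cancel (by simp) (by simp), one_mul]

theorem one_le_two_ennreal : (1 : ENNReal) ≤ 2 := by norm_num

theorem two_le_four_ennreal : (2 : ENNReal) ≤ 4 := by norm_num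

theorem one_le_four_ennreal : (1 : ENNReal) ≤ 4 := by norm_num

end LpBounds

/-! ### Discrete Gronwall inequalities. -/

section Gronwall

/-- The quantity that grows by at most `1 + c` per step is the right-hand side of the hypothesis,
not `u`; hence no sign condition on `u`. -/
theorem discrete_gronwall_sum {u : ℕ → ℝ} {b c : ℝ} (hc : 0 ≤ c) (hb : 0 ≤ b) {N : ℕ}
    (h : ∀ n ≤ N, u n ≤ b + c * ∑ k ∈ Finset.range n, u k) :
    ∀ n ≤ N, u n ≤ b * Real.exp (c * n) := by
  have key : ∀ n ≤ N, b + c * ∑ k ∈ Finset.range n, u k ≤ b * (1 + c) ^ n := by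
    intro n
    induction n with
    | zero => simp
    | succ n ih =>
      intro hn
      have h1 := ih (by omega)
      have h2 := h n (by omega)
      rw [Finset.sum_range_succ, pow_succ]
      nlinarith
  intro n hn
  refine (h n hn).trans ((key n hn).trans ?_)
  refine mul_le_mul_of_nonneg_left ?_ hb
  rw [mul_comm, Real.exp_nat_mul]
  exact pow_le_pow_left₀ (by linarith) (by linarith [Real.add_one_le_exp c]) n

variable {Ω : Type*} {m0 : MeasurableSpace Ω} {P : Measure Ω}
  {E : Type*} [NormedAddCommGroup E] {p : ENNReal}

/-- The recursion is pathwise, so Minkowski's inequality transfers it to `L^p` norms. The individual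
`c k` are kept because in one use they decay geometrically. -/
theorem LpBd.gronwall {S : ℕ → Ω → E} {g : ℕ → Ω → ℝ} {s a : ℝ} {c : ℕ → ℝ} (hp : 1 ≤ p)
    (ha : 0 ≤ a) (hs : 0 ≤ s) (hc : ∀ n, 0 ≤ c n) (hSm : ∀ n, AEStronglyMeasurable (S n) P)
    (h0 : LpBd P p (S 0) s) (hg : ∀ n, LpBd P p (g n) (c n))
    (hS : ∀ n ω, ‖S (n + 1) ω‖ ≤ (1 + a) * ‖S n ω‖ + g n ω) (n : ℕ) :
    LpBd P p (S n) (Real.exp (a * n) * (s + ∑ k ∈ Finset.range n, c k)) := by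
  induction n with
  | zero => simpa using h0
  | succ n ih =>
    have hsum : 0 ≤ ∑ k ∈ Finset.range n, c k := Finset.sum_nonneg fun k _ => hc k
    have h1 := (ih.norm.const_mul (a := 1 + a) (by linarith)).add (hg n) hp
      (by positivity) (hc n)
    refine (h1.mono_real (hSm (n + 1)) (hS n)).mono ?_
    rw [Finset.sum_range_succ]
    have e1 : Real.exp (a * (n + 1 : ℕ)) = Real.exp a * Real.exp (a * n) := by
      rw [← Real.exp_add]; congr 1; push_cast; ring
    have e2 : 1 + a ≤ Real.exp a := by linarith [Real.add_one_le_exp a]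
    have e3 : 1 ≤ Real.exp (a * (n + 1 : ℕ)) := Real.one_le_exp (by positivity)
    have e4 : (1 + a) * (Real.exp (a * n) * (s + ∑ k ∈ Finset.range n, c k))
        ≤ Real.exp (a * (n + 1 : ℕ)) * (s + ∑ k ∈ Finset.range n, c k) := by
      rw [e1, ← mul_assoc]
      exact mul_le_mul_of_nonneg_right (mul_le_mul_of_nonneg_right e2 (Real.exp_pos _).le)
        (by linarith)
    nlinarith [hc n]

end Gronwall

/-! ### Increments of the schemes through Duhamel's formula and smoothing. -/

section Increments

/-- The partial sums of the harmonic series. -/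
noncomputable def harm (n : ℕ) : ℝ := ∑ i ∈ Finset.range n, ((i : ℝ) + 1)⁻¹

theorem harm_nonneg (n : ℕ) : 0 ≤ harm n :=
  Finset.sum_nonneg fun i _ => by positivity

theorem harm_mono : Monotone harm := fun m n h =>
  Finset.sum_le_sum_of_subset_of_nonneg (by simpa using h) fun i _ _ => by positivity

theorem one_le_harm {n : ℕ} (hn : 1 ≤ n) : 1 ≤ harm n := by
  simpa [harm] using harm_mono hn

/-- From `harm n ≤ 1 + log n` and `log n ≤ n ^ κ / κ`. This is the sole origin of the loss `Δt ^
(-κ)`. -/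
theorem harm_le_rpow {κ : ℝ} (hκ : 0 < κ) {n : ℕ} (hn : 1 ≤ n) :
    harm n ≤ (1 + 1 / κ) * (n : ℝ) ^ κ := by
  have h1 := harmonic_le_one_add_log n
  have h2 := Real.log_le_rpow_div (x := n) (by positivity) hκ
  have h3 : (1 : ℝ) ≤ (n : ℝ) ^ κ := Real.one_le_rpow (by exact_mod_cast hn) hκ.le
  have h4 : ((harmonic n : ℚ) : ℝ) = harm n := by simp [harmonic, harm]
  rw [h4] at h1
  rw [add_mul, one_mul, one_div_mul_eq_div]
  linarith

theorem harm_eq_sum_reflect (n : ℕ) :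
    harm n = ∑ k ∈ Finset.range n, (((n - (k + 1) : ℕ) : ℝ) + 1)⁻¹ := by
  rw [harm, ← Finset.sum_range_reflect]
  refine Finset.sum_congr rfl fun k hk => ?_
  rw [show n - 1 - k = n - (k + 1) by omega]

variable {Ω : Type*} {m0 : MeasurableSpace Ω} {P : Measure Ω}
  {E : Type*} [NormedAddCommGroup E] [NormedSpace ℝ E] {p : ENNReal}

theorem duhamel {A : E →L[ℝ] E} {Δ : ℝ} {x f : ℕ → E}
    (hx : ∀ n, x (n + 1) = A (x n + Δ • f n)) (n : ℕ) :
    x n = (A ^ n) (x 0) + Δ • ∑ k ∈ Finset.range n, (A ^ (n - k)) (f k) := by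
  induction n with
  | zero => simp
  | succ n ih =>
    have h : ∀ k ∈ Finset.range n, (A ^ (n + 1 - k)) (f k) = A ((A ^ (n - k)) (f k)) := by
      intro k hk
      rw [Finset.mem_range] at hk
      rw [show n + 1 - k = n - k + 1 by omega, pow_succ']
      rfl
    rw [hx, Finset.sum_range_succ, Finset.sum_congr rfl h, ← map_sum, pow_succ']
    conv_lhs => rw [ih]
    simp [map_add, add_assoc]

/-- Subtracting two consecutive Duhamel formulas puts a factor `A ^ m (1 - A)` on the initial value
and on every past forcing; only the newest forcing `f n` comes without cancellation. Smoothing thus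
replaces regularity of the initial value. -/
theorem norm_increment_le {A : E →L[ℝ] E} {Δ : ℝ} (hΔ : 0 ≤ Δ) (hA : ‖A‖ ≤ 1)
    (hA' : ∀ n : ℕ, ‖A ^ n * (1 - A)‖ ≤ ((n : ℝ) + 1)⁻¹) {x f : ℕ → E}
    (hx : ∀ n, x (n + 1) = A (x n + Δ • f n)) (n : ℕ) :
    ‖x (n + 1) - x n‖ ≤ ((n : ℝ) + 1)⁻¹ * ‖x 0‖
      + ∑ k ∈ Finset.range (n + 1), Δ * (((n - k : ℕ) : ℝ) + 1)⁻¹ * ‖f k‖ := by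
  have hop : ∀ (m : ℕ) (v : E), ‖(A ^ (m + 1)) v - (A ^ m) v‖ ≤ ((m : ℝ) + 1)⁻¹ * ‖v‖ := by
    intro m v
    have : (A ^ (m + 1)) v - (A ^ m) v = -((A ^ m * (1 - A)) v) := by
      rw [mul_sub, mul_one, ← pow_succ]; simp
    rw [this, norm_neg]
    exact ((A ^ m * (1 - A)).le_opNorm v).trans
      (mul_le_mul_of_nonneg_right (hA' m) (norm_nonneg _))
  have h1 : x (n + 1) - x n = ((A ^ (n + 1)) (x 0) - (A ^ n) (x 0))
      + (∑ k ∈ Finset.range n, Δ • ((A ^ (n - k + 1)) (f k) - (A ^ (n - k)) (f k))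
        + Δ • A (f n)) := by
    rw [duhamel hx (n + 1), duhamel hx n, Finset.sum_range_succ]
    have h : ∀ k ∈ Finset.range n, (A ^ (n + 1 - k)) (f k) = (A ^ (n - k + 1)) (f k) := by
      intro k hk
      rw [Finset.mem_range] at hk
      rw [show n + 1 - k = n - k + 1 by omega]
    rw [Finset.sum_congr rfl h, ← Finset.smul_sum, Finset.sum_sub_distrib]
    simp only [add_tsub_cancel_left, pow_one, smul_add, smul_sub]
    abel
  rw [h1, Finset.sum_range_succ]
  refine (norm_add_le _ _).trans (add_le_add (hop n _) ((norm_add_le _ _).trans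
    (add_le_add ((norm_sum_le _ _).trans (Finset.sum_le_sum fun k _ => ?_)) ?_)))
  · rw [norm_smul, Real.norm_of_nonneg hΔ, mul_assoc]
    exact mul_le_mul_of_nonneg_left (hop _ _) hΔ
  · rw [norm_smul, Real.norm_of_nonneg hΔ]
    simp only [Nat.sub_self, Nat.cast_zero, zero_add, inv_one, mul_one]
    exact mul_le_mul_of_nonneg_left ((A.le_opNorm _).trans
      (by nlinarith [norm_nonneg (f n)])) hΔ

theorem LpBd.increment {A : E →L[ℝ] E} {Δ : ℝ} (hΔ : 0 ≤ Δ) (hA : ‖A‖ ≤ 1)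
    (hA' : ∀ n : ℕ, ‖A ^ n * (1 - A)‖ ≤ ((n : ℝ) + 1)⁻¹) [IsProbabilityMeasure P] (hp : 1 ≤ p)
    {X f : ℕ → Ω → E} {x₀ : E} (hX0 : ∀ ω, X 0 ω = x₀)
    (hX : ∀ n ω, X (n + 1) ω = A (X n ω + Δ • f n ω)) (hXm : ∀ n, AEStronglyMeasurable (X n) P)
    {c : ℝ} (hc : 0 ≤ c) (n : ℕ) (hf : ∀ k ≤ n, LpBd P p (f k) c) :
    LpBd P p (fun ω => X (n + 1) ω - X n ω) (((n : ℝ) + 1)⁻¹ * ‖x₀‖ + Δ * c * harm (n + 1)) := by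
  have h0 : LpBd P p (fun _ : Ω => ((n : ℝ) + 1)⁻¹ * ‖x₀‖) (((n : ℝ) + 1)⁻¹ * ‖x₀‖) := by
    have := LpBd.const (P := P) (p := p) (((n : ℝ) + 1)⁻¹ * ‖x₀‖) (by positivity)
    rwa [Real.norm_of_nonneg (by positivity)] at this
  have h1 := h0.add (LpBd.sum (s := Finset.range (n + 1))
    (f := fun k ω => Δ * (((n - k : ℕ) : ℝ) + 1)⁻¹ * ‖f k ω‖)
    (c := fun k => Δ * (((n - k : ℕ) : ℝ) + 1)⁻¹ * c) hp
    (fun k hk => ((hf k (by simpa [Nat.lt_succ_iff] using hk)).norm.const_mul (by positivity)))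
    (fun k _ => by positivity)) hp (by positivity)
    (Finset.sum_nonneg fun k _ => by positivity)
  refine (h1.mono_real ((hXm _).sub (hXm _)) fun ω => ?_).mono (le_of_eq ?_)
  · have := norm_increment_le hΔ hA hA' (x := fun n => X n ω) (f := fun n => f n ω)
      (fun n => hX n ω) n
    rwa [hX0] at this
  · rw [harm_eq_sum_reflect, Finset.mul_sum]
    congr 1
    refine Finset.sum_congr rfl fun k _ => ?_
    rw [show n + 1 - (k + 1) = n - k by omega]
    ring

end Increments

/-! ### Averaged coefficient, centred Lipschitz functions and the Poisson series. -/

section Averaging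

variable {H : Type*} [NormedAddCommGroup H] [InnerProductSpace ℝ H] [CompleteSpace H]
  [MeasurableSpace H] [BorelSpace H] [SecondCountableTopology H]

/-- Quantitative regularity of the nonlinearity: Lipschitz continuity, a bound on mixed
second-order differences, and a first-order Taylor expansion in the first variable. -/
structure IsCoefficient (F : H → H → H) (L : ℝ) : Prop where
  nonneg : 0 ≤ L
  lip : ∀ x x' y y', ‖F x y - F x' y'‖ ≤ L * (‖x - x'‖ + ‖y - y'‖)
  mixed : ∀ x x' y y', ‖(F x y - F x' y) - (F x y' - F x' y')‖ ≤ L * ‖x - x'‖ * ‖y - y'‖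
  taylor : ∃ DF : H → H → (H →L[ℝ] H), (∀ x, Continuous (DF x)) ∧ (∀ x y, ‖DF x y‖ ≤ L) ∧
    ∀ x d y, ‖F (x + d) y - F x y - DF x y d‖ ≤ L * ‖d‖ ^ 2

/-- The averaged coefficient. -/
noncomputable def average (F : H → H → H) (ν : Measure H) (x : H) : H := ∫ y, F x y ∂ν

/-- The deviation of the coefficient from its average. -/
noncomputable def fluctuation (F : H → H → H) (ν : Measure H) (x y : H) : H :=
  F x y - average F ν x

theorem continuous_of_lip {f : H → H} {L : ℝ} (hf : ∀ y y', ‖f y - f y'‖ ≤ L * ‖y - y'‖) :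
    Continuous f :=
  (LipschitzWith.of_dist_le' (K := L) fun y y' => by
    simpa only [dist_eq_norm] using hf y y').continuous

theorem integrable_of_lip {μ : Measure H} [IsProbabilityMeasure μ] (hμ : Integrable (fun y => y) μ)
    {f : H → H} {L : ℝ} (hf : ∀ y y', ‖f y - f y'‖ ≤ L * ‖y - y'‖) : Integrable f μ := by
  refine Integrable.mono' (g := fun y => L * ‖y‖ + ‖f 0‖)
    ((hμ.norm.const_mul L).add (integrable_const _))
    (continuous_of_lip hf).aestronglyMeasurable (ae_of_all _ fun y => ?_)
  have h1 := hf y 0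
  have h2 := norm_le_norm_add_norm_sub' (f y) (f 0)
  rw [sub_zero] at h1
  linarith

variable {F : H → H → H} {L : ℝ} {ν : Measure H} [IsProbabilityMeasure ν]

namespace IsCoefficient

theorem lip_right (hF : IsCoefficient F L) (x y y' : H) :
    ‖F x y - F x y'‖ ≤ L * ‖y - y'‖ := by
  simpa using hF.lip x x y y'

theorem lip_left (hF : IsCoefficient F L) (x x' y : H) :
    ‖F x y - F x' y‖ ≤ L * ‖x - x'‖ := by
  simpa using hF.lip x x' y y

theorem integrable (hF : IsCoefficient F L) (hν : Integrable (fun y => y) ν) (x : H) :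
    Integrable (F x) ν :=
  integrable_of_lip hν (hF.lip_right x)

theorem continuous_uncurry (hF : IsCoefficient F L) : Continuous fun p : H × H => F p.1 p.2 := by
  refine (LipschitzWith.of_dist_le' (K := 2 * L) fun p p' => ?_).continuous
  rw [dist_eq_norm, dist_eq_norm]
  have h1 := norm_fst_le (p - p')
  have h2 := norm_snd_le (p - p')
  have := hF.lip p.1 p'.1 p.2 p'.2
  simp only [Prod.fst_sub, Prod.snd_sub] at h1 h2
  nlinarith [hF.nonneg]

theorem norm_le (hF : IsCoefficient F L) (x y : H) :
    ‖F x y‖ ≤ L * ‖x‖ + L * ‖y‖ + ‖F 0 0‖ := by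
  have h1 := hF.lip x 0 y 0
  have h2 := norm_le_norm_add_norm_sub' (F x y) (F 0 0)
  rw [sub_zero, sub_zero] at h1
  linarith

theorem average_lip (hF : IsCoefficient F L) (hν : Integrable (fun y => y) ν) (x x' : H) :
    ‖average F ν x - average F ν x'‖ ≤ L * ‖x - x'‖ := by
  rw [average, average, ← integral_sub (hF.integrable hν x) (hF.integrable hν x')]
  simpa using norm_integral_le_of_norm_le_const (μ := ν) (f := fun y => F x y - F x' y)
    (ae_of_all _ fun y => hF.lip_left x x' y)

/-- The linear part is the average of the linear parts; continuity of `DF x` serves only to make it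
integrable. -/
theorem average_taylor (hF : IsCoefficient F L) (hν : Integrable (fun y => y) ν) :
    ∃ D : H → (H →L[ℝ] H), (∀ x, ‖D x‖ ≤ L) ∧
      ∀ x d, ‖average F ν (x + d) - average F ν x - D x d‖ ≤ L * ‖d‖ ^ 2 := by
  obtain ⟨DF, hc, hb, ht⟩ := hF.taylor
  have hi : ∀ x, Integrable (DF x) ν := fun x =>
    Integrable.mono' (integrable_const L) (hc x).aestronglyMeasurable (ae_of_all _ (hb x))
  refine ⟨fun x => ∫ y, DF x y ∂ν, fun x => ?_, fun x d => ?_⟩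
  · simpa using norm_integral_le_of_norm_le_const (μ := ν) (ae_of_all _ (hb x))
  · have h1 : Integrable (fun y => F (x + d) y - F x y) ν :=
      (hF.integrable hν _).sub (hF.integrable hν x)
    rw [average, average, ContinuousLinearMap.integral_apply (hi x),
      ← integral_sub (hF.integrable hν _) (hF.integrable hν x),
      ← integral_sub h1 ((hi x).apply_continuousLinearMap d)]
    simpa using norm_integral_le_of_norm_le_const (μ := ν)
      (f := fun y => F (x + d) y - F x y - DF x y d) (ae_of_all _ fun y => ht x d y)

theorem continuous_average (hF : IsCoefficient F L) (hν : Integrable (fun y => y) ν) :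
    Continuous (average F ν) :=
  continuous_of_lip (hF.average_lip hν)

theorem continuous_fluctuation (hF : IsCoefficient F L) (hν : Integrable (fun y => y) ν) :
    Continuous fun p : H × H => fluctuation F ν p.1 p.2 :=
  hF.continuous_uncurry.sub ((hF.continuous_average hν).comp continuous_fst)

end IsCoefficient

/-- `f` is Lipschitz continuous with constant `L`, and has mean zero with respect to `ν`. -/
structure IsCenteredLip (ν : Measure H) (f : H → H) (L : ℝ) : Prop where
  lip : ∀ y y', ‖f y - f y'‖ ≤ L * ‖y - y'‖
  centered : ∫ y, f y ∂ν = 0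

/-- Mean zero allows writing `f y = ∫ (f y - f z) dν(z)`, so the size of `f` is governed by its
Lipschitz constant alone. Decay of Lipschitz constants under iteration then gives decay of the
functions themselves. -/
theorem IsCenteredLip.norm_le {f : H → H} (hf : IsCenteredLip ν f L)
    (hν : Integrable (fun y => y) ν) (hL : 0 ≤ L) (y : H) :
    ‖f y‖ ≤ L * (‖y‖ + ∫ z, ‖z‖ ∂ν) := by
  have h1 : f y = ∫ z, (f y - f z) ∂ν := by
    rw [integral_sub (integrable_const _) (integrable_of_lip hν hf.lip), hf.centered]
    simp
  rw [h1]
  refine (norm_integral_le_of_norm_le (g := fun z => L * (‖y‖ + ‖z‖))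
    (((integrable_const _).add hν.norm).const_mul L) (ae_of_all _ fun z => ?_)).trans ?_
  · exact (hf.lip y z).trans (mul_le_mul_of_nonneg_left (norm_sub_le _ _) hL)
  · rw [integral_const_mul, integral_add (integrable_const _) hν.norm]
    simp

theorem IsCoefficient.isCenteredLip (hF : IsCoefficient F L) (hν : Integrable (fun y => y) ν)
    (x : H) : IsCenteredLip ν (fluctuation F ν x) L where
  lip y y' := by simpa [fluctuation] using hF.lip_right x y y'
  centered := by
    simp only [fluctuation]
    rw [integral_sub (hF.integrable hν x) (integrable_const _)]
    simp [average]

/-- The bound on mixed differences makes the Lipschitz constant in `y` proportional to `‖x - x'‖`;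
this is what yields Lipschitz dependence of the corrector on `x`. -/
theorem IsCoefficient.isCenteredLip_sub (hF : IsCoefficient F L)
    (hν : Integrable (fun y => y) ν) (x x' : H) :
    IsCenteredLip ν (fun y => fluctuation F ν x y - fluctuation F ν x' y) (L * ‖x - x'‖) where
  lip y y' := by
    refine le_of_eq_of_le (congrArg _ ?_) (hF.mixed x x' y y')
    simp only [fluctuation]
    abel
  centered := by
    rw [integral_sub (integrable_of_lip hν (hF.isCenteredLip hν x).lip)
      (integrable_of_lip hν (hF.isCenteredLip hν x').lip), (hF.isCenteredLip hν x).centered,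
      (hF.isCenteredLip hν x').centered, sub_zero]

theorem IsCoefficient.norm_fluctuation_le (hF : IsCoefficient F L)
    (hν : Integrable (fun y => y) ν) (x y : H) :
    ‖fluctuation F ν x y‖ ≤ L * (‖y‖ + ∫ z, ‖z‖ ∂ν) :=
  (hF.isCenteredLip hν x).norm_le hν hF.nonneg y

/-- The transition operator `f ↦ 𝔼[f (B y + W)]`, `W` of law `q`. -/
noncomputable def transition (B : H →L[ℝ] H) (q : Measure H) (f : H → H) (y : H) : H :=
  ∫ w, f (B y + w) ∂q

/-- The solution of the Poisson equation for the transition operator. -/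
noncomputable def poisson (B : H →L[ℝ] H) (q : Measure H) (f : H → H) (y : H) : H :=
  ∑' k : ℕ, ((transition B q)^[k] f) y

variable {B : H →L[ℝ] H} {q : Measure H} [IsProbabilityMeasure q] {b : ℝ}

theorem integrable_transition (hq : Integrable (fun y => y) q) {f : H → H}
    (hf : ∀ y y', ‖f y - f y'‖ ≤ L * ‖y - y'‖) (y : H) : Integrable (fun w => f (B y + w)) q :=
  integrable_of_lip (L := L) hq fun w w' => by simpa using hf (B y + w) (B y + w')

/-- Synchronous coupling: driving two chains by the same noise `w` contracts their distance by `b`.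
Centring survives because `ν` is invariant. -/
theorem IsCenteredLip.transition (hν : Integrable (fun y => y) ν) (hq : Integrable (fun y => y) q)
    (hinv : ν.map B ∗ q = ν) (hB : ‖B‖ ≤ b) (hL : 0 ≤ L) {f : H → H} (hf : IsCenteredLip ν f L) :
    IsCenteredLip ν (transition B q f) (L * b) where
  lip y y' := by
    rw [SlowFast.transition, SlowFast.transition, ← integral_sub
      (integrable_transition hq hf.lip y) (integrable_transition hq hf.lip y')]
    have h : ∀ w, ‖f (B y + w) - f (B y' + w)‖ ≤ L * b * ‖y - y'‖ := fun w => by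
      refine (hf.lip _ _).trans ?_
      rw [add_sub_add_right_eq_sub, ← map_sub, mul_assoc]
      exact mul_le_mul_of_nonneg_left (B.le_of_opNorm_le hB _) hL
    simpa using norm_integral_le_of_norm_le_const (μ := q) (ae_of_all _ h)
  centered := by
    have hfi : Integrable f (ν.map B ∗ q) := by rw [hinv]; exact integrable_of_lip hν hf.lip
    have h := hf.centered
    rw [← hinv, integral_conv hfi, integral_map (by fun_prop)] at h
    · exact h
    · exact ((continuous_of_lip hf.lip).comp continuous_add).aestronglyMeasurable.integral_prod_right'
        (μ := ν.map B)

theorem IsCenteredLip.iterate (hν : Integrable (fun y => y) ν) (hq : Integrable (fun y => y) q)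
    (hinv : ν.map B ∗ q = ν) (hB : ‖B‖ ≤ b) (hL : 0 ≤ L) {f : H → H} (hf : IsCenteredLip ν f L)
    (k : ℕ) : IsCenteredLip ν ((SlowFast.transition B q)^[k] f) (L * b ^ k) := by
  have hb : 0 ≤ b := (norm_nonneg _).trans hB
  induction k with
  | zero => simpa using hf
  | succ k ih =>
    rw [Function.iterate_succ_apply', pow_succ, ← mul_assoc]
    exact ih.transition hν hq hinv hB (by positivity)

theorem IsCenteredLip.summable_iterate (hν : Integrable (fun y => y) ν)
    (hq : Integrable (fun y => y) q)
    (hinv : ν.map B ∗ q = ν) (hB : ‖B‖ ≤ b) (hb1 : b < 1) (hL : 0 ≤ L) {f : H → H}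
    (hf : IsCenteredLip ν f L) (y : H) :
    Summable fun k => ((SlowFast.transition B q)^[k] f) y := by
  have hb : 0 ≤ b := (norm_nonneg _).trans hB
  refine Summable.of_norm_bounded
    (g := fun k => L * b ^ k * (‖y‖ + ∫ z, ‖z‖ ∂ν))
    (((summable_geometric_of_lt_one hb hb1).mul_left L).mul_right _) fun k => ?_
  exact (hf.iterate hν hq hinv hB hL k).norm_le hν (by positivity) y

theorem IsCenteredLip.norm_poisson_le (hν : Integrable (fun y => y) ν)
    (hq : Integrable (fun y => y) q)
    (hinv : ν.map B ∗ q = ν) (hB : ‖B‖ ≤ b) (hb1 : b < 1) (hL : 0 ≤ L) {f : H → H}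
    (hf : IsCenteredLip ν f L) (y : H) :
    ‖poisson B q f y‖ ≤ L * (1 - b)⁻¹ * (‖y‖ + ∫ z, ‖z‖ ∂ν) := by
  have hb : 0 ≤ b := (norm_nonneg _).trans hB
  exact tsum_of_norm_bounded (((hasSum_geometric_of_lt_one hb hb1).mul_left L).mul_right _)
    fun k => (hf.iterate hν hq hinv hB hL k).norm_le hν (by positivity) y

theorem IsCenteredLip.poisson_lip (hν : Integrable (fun y => y) ν) (hq : Integrable (fun y => y) q)
    (hinv : ν.map B ∗ q = ν) (hB : ‖B‖ ≤ b) (hb1 : b < 1) (hL : 0 ≤ L) {f : H → H}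
    (hf : IsCenteredLip ν f L) (y y' : H) :
    ‖poisson B q f y - poisson B q f y'‖ ≤ L * (1 - b)⁻¹ * ‖y - y'‖ := by
  have hb : 0 ≤ b := (norm_nonneg _).trans hB
  rw [poisson, poisson, ← (hf.summable_iterate hν hq hinv hB hb1 hL y).tsum_sub
    (hf.summable_iterate hν hq hinv hB hb1 hL y')]
  exact tsum_of_norm_bounded (((hasSum_geometric_of_lt_one hb hb1).mul_left L).mul_right _)
    fun k => (hf.iterate hν hq hinv hB hL k).lip y y'

theorem IsCenteredLip.transition_sub (hq : Integrable (fun y => y) q) {f g : H → H} {L' : ℝ}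
    (hf : IsCenteredLip ν f L) (hg : IsCenteredLip ν g L') :
    SlowFast.transition B q (fun y => f y - g y)
      = fun y => SlowFast.transition B q f y - SlowFast.transition B q g y := by
  ext y
  exact integral_sub (integrable_transition hq hf.lip y) (integrable_transition hq hg.lip y)

/-- Linearity of the Poisson solution turns a difference of two correctors into the corrector of a
difference, to which the mixed bound applies. -/
theorem IsCenteredLip.poisson_sub (hν : Integrable (fun y => y) ν) (hq : Integrable (fun y => y) q)
    (hinv : ν.map B ∗ q = ν) (hB : ‖B‖ ≤ b) (hb1 : b < 1) (hL : 0 ≤ L) {f g : H → H}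
    (hf : IsCenteredLip ν f L) (hg : IsCenteredLip ν g L) (y : H) :
    poisson B q (fun y => f y - g y) y = poisson B q f y - poisson B q g y := by
  have h : ∀ k, (SlowFast.transition B q)^[k] (fun y => f y - g y)
      = fun y => ((SlowFast.transition B q)^[k] f) y - ((SlowFast.transition B q)^[k] g) y := by
    intro k
    induction k with
    | zero => rfl
    | succ k ih =>
      rw [Function.iterate_succ_apply', ih, Function.iterate_succ_apply',
        Function.iterate_succ_apply']
      exact (hf.iterate hν hq hinv hB hL k).transition_sub hq (hg.iterate hν hq hinv hB hL k)
  rw [poisson, poisson, poisson, ← (hf.summable_iterate hν hq hinv hB hb1 hL y).tsum_sub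
    (hg.summable_iterate hν hq hinv hB hb1 hL y)]
  simp_rw [h]

/-- Removing the term `k = 0` from the series leaves the transition operator applied to the series.
The exchange of sum and integral is justified by geometric decay of the integrated norms. -/
theorem IsCenteredLip.poisson_eq (hν : Integrable (fun y => y) ν) (hq : Integrable (fun y => y) q)
    (hinv : ν.map B ∗ q = ν) (hB : ‖B‖ ≤ b) (hb1 : b < 1) (hL : 0 ≤ L) {f : H → H}
    (hf : IsCenteredLip ν f L) (y : H) :
    poisson B q f y = f y + ∫ w, poisson B q f (B y + w) ∂q := by
  have hb : 0 ≤ b := (norm_nonneg _).trans hB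
  have hint : ∀ k, Integrable (fun w => ((SlowFast.transition B q)^[k] f) (B y + w)) q :=
    fun k => integrable_transition hq (hf.iterate hν hq hinv hB hL k).lip y
  have hsum := hasSum_integral_of_summable_integral_norm hint (by
    refine Summable.of_nonneg_of_le (fun k => integral_nonneg fun w => norm_nonneg _)
      (fun k => ?_) (((summable_geometric_of_lt_one hb hb1).mul_left L).mul_right
        (‖B y‖ + ∫ w, ‖w‖ ∂q + ∫ z, ‖z‖ ∂ν))
    have hbd : ∀ w, ‖((SlowFast.transition B q)^[k] f) (B y + w)‖
        ≤ L * b ^ k * (‖B y‖ + ‖w‖ + ∫ z, ‖z‖ ∂ν) := fun w => by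
      refine ((hf.iterate hν hq hinv hB hL k).norm_le hν (by positivity) _).trans ?_
      gcongr
      exact norm_add_le _ _
    have h1 : Integrable (fun w : H => ‖B y‖ + ‖w‖) q := (integrable_const _).add hq.norm
    have h2 : Integrable (fun w : H => ‖B y‖ + ‖w‖ + ∫ z, ‖z‖ ∂ν) q := h1.add (integrable_const _)
    refine (integral_mono (hint k).norm (h2.const_mul _) hbd).trans (le_of_eq ?_)
    rw [integral_const_mul]
    congr 1
    rw [integral_add h1 (integrable_const _), integral_add (integrable_const _) hq.norm]
    simp)
  rw [poisson, (hf.summable_iterate hν hq hinv hB hb1 hL y).tsum_eq_zero_add]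
  simp only [poisson, Function.iterate_zero, id_eq]
  rw [← hsum.tsum_eq]
  congr 1
  refine tsum_congr fun k => ?_
  rw [Function.iterate_succ_apply']
  rfl

/-- If `μ` is a convolution factor of `ν`, then `μ` inherits its moments from `ν`. -/
theorem lpBd_of_conv_eq {B : H →L[ℝ] H} (hB : ‖B‖ ≤ 1) {μ : Measure H} [IsProbabilityMeasure μ]
    (h : ν.map B ∗ μ = ν) {p : ENNReal} (hp : 1 ≤ p) {M : ℝ} (hM : 0 ≤ M)
    (hν : LpBd ν p (fun y => y) M) : LpBd μ p (fun y => y) (2 * M) := by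
  have hmeas : Measurable fun z : H × H => B z.1 + z.2 := by fun_prop
  have hmap : (ν.prod μ).map (fun z => B z.1 + z.2) = ν := by
    conv_rhs => rw [← h]
    have h1 := Measure.map_prod_map ν μ (f := B) (g := id) (by fun_prop) measurable_id
    rw [Measure.map_id] at h1
    rw [Measure.conv, h1, Measure.map_map (by fun_prop) (by fun_prop)]
    rfl
  -- Under `ν.prod μ` the coordinate `z.2` is `(B z.1 + z.2) - B z.1`: the first term has law `ν`
  -- and the second is bounded by `‖z.1‖`. Hence the factor 2.
  have h1 : LpBd (ν.prod μ) p (fun z : H × H => B z.1 + z.2) M := by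
    refine ⟨hmeas.aestronglyMeasurable, ?_⟩
    have h2 := eLpNorm_map_measure (p := p) (g := fun y : H => y) (f := fun z : H × H => B z.1 + z.2)
      (μ := ν.prod μ) (by fun_prop) hmeas.aemeasurable
    rw [hmap] at h2
    exact h2.symm.trans_le hν.2
  have h2 : LpBd (ν.prod μ) p (fun z : H × H => -B z.1) M := by
    have h3 : LpBd (ν.prod μ) p (fun z : H × H => z.1) M := by
      refine ⟨by fun_prop, ?_⟩
      have h2 := eLpNorm_map_measure (p := p) (g := fun y : H => y) (f := Prod.fst)
        (μ := ν.prod μ) (by fun_prop) measurable_fst.aemeasurable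
      rw [Measure.map_fst_prod] at h2
      simp only [measure_univ, one_smul] at h2
      exact h2.symm.trans_le hν.2
    refine h3.mono_norm (by fun_prop) fun z => ?_
    rw [norm_neg]
    simpa using B.le_of_opNorm_le hB z.1
  have h3 := h1.add h2 hp hM hM
  simp only [add_neg_cancel_comm] at h3
  refine ⟨by fun_prop, ?_⟩
  have h4 := eLpNorm_map_measure (p := p) (g := fun y : H => y) (f := Prod.snd)
    (μ := ν.prod μ) (by fun_prop) measurable_snd.aemeasurable
  rw [Measure.map_snd_prod] at h4
  simp only [measure_univ, one_smul] at h4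
  rw [h4, two_mul]
  exact h3.2

end Averaging

/-! ### Noise independent of the past, and freezing. -/

section Noise

variable {Ω : Type*} {m0 : MeasurableSpace Ω} {P : Measure Ω} [IsProbabilityMeasure P]
  {H : Type*} [NormedAddCommGroup H] [InnerProductSpace ℝ H] [CompleteSpace H]
  [MeasurableSpace H] [BorelSpace H] [SecondCountableTopology H]

/-- Mean-square sums are measurable for the σ-algebra of their coordinates only up to null sets, so
independence is read off strongly measurable versions and then transferred. -/
theorem indepFun_of_indep {E E' : Type*} [TopologicalSpace E] [TopologicalSpace.PseudoMetrizableSpace E]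
    [MeasurableSpace E] [BorelSpace E] [TopologicalSpace E']
    [TopologicalSpace.PseudoMetrizableSpace E'] [MeasurableSpace E'] [BorelSpace E']
    {m m' : MeasurableSpace Ω} (h : Indep m m' P) {f : Ω → E} {g : Ω → E'}
    (hf : AEStronglyMeasurable[m] f P) (hg : AEStronglyMeasurable[m'] g P) : IndepFun f g P := by
  have h1 : IndepFun (hf.mk f) (hg.mk g) P := by
    rw [IndepFun_iff_Indep]
    exact indep_of_indep_of_le_left (indep_of_indep_of_le_right h
      hg.stronglyMeasurable_mk.measurable.comap_le) hf.stronglyMeasurable_mk.measurable.comap_le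
  exact h1.congr hf.ae_eq_mk.symm hg.ae_eq_mk.symm

/-- Freezing lemma: Fubini on the product law. It stands in for conditional expectations throughout.
-/
theorem integral_comp_of_indepFun {E : Type*} [TopologicalSpace E]
    [SecondCountableTopology E] [MeasurableSpace E] [BorelSpace E] {U : Ω → E} {W : Ω → H}
    (hU : AEMeasurable U P) (hW : AEMeasurable W P) (h : IndepFun U W P) {g : E × H → ℝ}
    (hg : Continuous g) (hint : Integrable (fun ω => g (U ω, W ω)) P) :
    ∫ ω, g (U ω, W ω) ∂P = ∫ ω, ∫ w, g (U ω, w) ∂(P.map W) ∂P := by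
  have := Measure.isProbabilityMeasure_map hU (μ := P)
  have := Measure.isProbabilityMeasure_map hW (μ := P)
  have hprod := (indepFun_iff_map_prod_eq_prod_map_map hU hW).1 h
  have hUW : AEMeasurable (fun ω => (U ω, W ω)) P := hU.prodMk hW
  have hgm : StronglyMeasurable g := hg.measurable.stronglyMeasurable
  have hint' : Integrable g ((P.map U).prod (P.map W)) := by
    rw [← hprod]
    exact (integrable_map_measure hgm.aestronglyMeasurable hUW).2 hint
  have h1 := integral_map hUW (f := g) hgm.aestronglyMeasurable
  rw [hprod, integral_prod _ hint', integral_map hU] at h1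
  · exact h1.symm
  · exact hgm.integral_prod_right'.aestronglyMeasurable

/-- A sequence of random variables of law `q` adapted to the filtration `ℱ` with a shift, each of
them independent of the past. -/
structure IsNoise (P : Measure Ω) (ℱ : ℕ → MeasurableSpace Ω) (N : ℕ → Ω → H)
    (q : Measure H) : Prop where
  le : ∀ n, ℱ n ≤ m0
  mono : Monotone ℱ
  adapted : ∀ n, AEStronglyMeasurable[ℱ (n + 1)] (N n) P
  law : ∀ n, P.map (N n) = q
  indep : ∀ n, ∃ 𝒢 : MeasurableSpace Ω, AEStronglyMeasurable[𝒢] (N n) P ∧ Indep (ℱ n) 𝒢 P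

variable {ℱ : ℕ → MeasurableSpace Ω} {N : ℕ → Ω → H} {q : Measure H}

theorem IsNoise.aestronglyMeasurable (hN : IsNoise P ℱ N q) (n : ℕ) :
    AEStronglyMeasurable (N n) P :=
  (hN.adapted n).mono (hN.le _)

theorem IsNoise.indepFun (hN : IsNoise P ℱ N q) {n : ℕ} {E : Type*} [TopologicalSpace E]
    [TopologicalSpace.PseudoMetrizableSpace E] [MeasurableSpace E] [BorelSpace E] {U : Ω → E}
    (hU : AEStronglyMeasurable[ℱ n] U P) : IndepFun U (N n) P := by
  obtain ⟨𝒢, h1, h2⟩ := hN.indep n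
  exact indepFun_of_indep h2 hU h1

theorem IsNoise.isProbabilityMeasure (hN : IsNoise P ℱ N q) : IsProbabilityMeasure q := by
  rw [← hN.law 0]
  exact Measure.isProbabilityMeasure_map (hN.aestronglyMeasurable 0).aemeasurable

theorem IsNoise.integral_comp (hN : IsNoise P ℱ N q) {n : ℕ} {E : Type*} [TopologicalSpace E]
    [TopologicalSpace.PseudoMetrizableSpace E] [SecondCountableTopology E] [MeasurableSpace E]
    [BorelSpace E] {U : Ω → E}
    (hU : AEStronglyMeasurable[ℱ n] U P) {g : E × H → ℝ} (hg : Continuous g)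
    (hint : Integrable (fun ω => g (U ω, N n ω)) P) :
    ∫ ω, g (U ω, N n ω) ∂P = ∫ ω, ∫ w, g (U ω, w) ∂q ∂P := by
  rw [integral_comp_of_indepFun (hU.mono (hN.le n)).aemeasurable
    (hN.aestronglyMeasurable n).aemeasurable (hN.indepFun hU) hg hint, hN.law]

end Noise

/-! ### The corrector and the main averaging estimate. -/

section Poisson

variable {H : Type*} [NormedAddCommGroup H] [InnerProductSpace ℝ H] [CompleteSpace H]
  [MeasurableSpace H] [BorelSpace H] [SecondCountableTopology H]
  {F : H → H → H} {L : ℝ} {ν : Measure H} [IsProbabilityMeasure ν]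
  {B : H →L[ℝ] H} {q : Measure H} [IsProbabilityMeasure q] {b : ℝ}

/-- The corrector: the solution of the Poisson equation for the fluctuation. -/
noncomputable def corrector (F : H → H → H) (ν : Measure H) (B : H →L[ℝ] H) (q : Measure H)
    (x y : H) : H :=
  poisson B q (fluctuation F ν x) y

theorem norm_corrector_le (hF : IsCoefficient F L) (hν : Integrable (fun y => y) ν)
    (hq : Integrable (fun y => y) q) (hinv : ν.map B ∗ q = ν) (hB : ‖B‖ ≤ b) (hb1 : b < 1)
    (x y : H) : ‖corrector F ν B q x y‖ ≤ L * (1 - b)⁻¹ * (‖y‖ + ∫ z, ‖z‖ ∂ν) :=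
  (hF.isCenteredLip hν x).norm_poisson_le hν hq hinv hB hb1 hF.nonneg y

theorem norm_corrector_sub_le (hF : IsCoefficient F L) (hν : Integrable (fun y => y) ν)
    (hq : Integrable (fun y => y) q) (hinv : ν.map B ∗ q = ν) (hB : ‖B‖ ≤ b) (hb1 : b < 1)
    (x x' y : H) : ‖corrector F ν B q x y - corrector F ν B q x' y‖
      ≤ L * (1 - b)⁻¹ * (‖x - x'‖ * (‖y‖ + ∫ z, ‖z‖ ∂ν)) := by
  rw [corrector, corrector, ← (hF.isCenteredLip hν x).poisson_sub hν hq hinv hB hb1 hF.nonneg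
    (hF.isCenteredLip hν x')]
  refine ((hF.isCenteredLip_sub hν x x').norm_poisson_le hν hq hinv hB hb1
    (mul_nonneg hF.nonneg (norm_nonneg _)) y).trans (le_of_eq (by ring))

/-- Joint continuity is what makes the corrector measurable along the schemes and admissible in the
freezing lemma. -/
theorem continuous_corrector (hF : IsCoefficient F L) (hν : Integrable (fun y => y) ν)
    (hq : Integrable (fun y => y) q) (hinv : ν.map B ∗ q = ν) (hB : ‖B‖ ≤ b) (hb1 : b < 1) :
    Continuous fun p : H × H => corrector F ν B q p.1 p.2 := by
  rw [continuous_iff_continuousAt]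
  rintro ⟨x, y⟩
  rw [ContinuousAt, tendsto_iff_norm_sub_tendsto_zero]
  have hb : Tendsto (fun p : H × H => L * (1 - b)⁻¹ * (‖p.1 - x‖ * (‖p.2‖ + ∫ z, ‖z‖ ∂ν))
      + L * (1 - b)⁻¹ * ‖p.2 - y‖) (𝓝 (x, y)) (𝓝 0) := by
    have : Continuous (fun p : H × H => L * (1 - b)⁻¹ * (‖p.1 - x‖ * (‖p.2‖ + ∫ z, ‖z‖ ∂ν))
      + L * (1 - b)⁻¹ * ‖p.2 - y‖) := by fun_prop
    simpa using this.tendsto (x, y)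
  refine squeeze_zero (fun _ => norm_nonneg _) (fun p => ?_) hb
  have h1 := norm_corrector_sub_le hF hν hq hinv hB hb1 p.1 x p.2
  have h2 := (hF.isCenteredLip hν x).poisson_lip hν hq hinv hB hb1 hF.nonneg p.2 y
  have h3 : corrector F ν B q p.1 p.2 - corrector F ν B q x y
    = (corrector F ν B q p.1 p.2 - corrector F ν B q x p.2)
      + (corrector F ν B q x p.2 - corrector F ν B q x y) := by abel
  rw [h3]
  exact (norm_add_le _ _).trans (add_le_add h1 h2)

theorem corrector_eq (hF : IsCoefficient F L) (hν : Integrable (fun y => y) ν)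
    (hq : Integrable (fun y => y) q) (hinv : ν.map B ∗ q = ν) (hB : ‖B‖ ≤ b) (hb1 : b < 1)
    (x y : H) :
    corrector F ν B q x y = fluctuation F ν x y + ∫ w, corrector F ν B q x (B y + w) ∂q :=
  (hF.isCenteredLip hν x).poisson_eq hν hq hinv hB hb1 hF.nonneg y

theorem integrable_corrector (hF : IsCoefficient F L) (hν : Integrable (fun y => y) ν)
    (hq : Integrable (fun y => y) q) (hinv : ν.map B ∗ q = ν) (hB : ‖B‖ ≤ b) (hb1 : b < 1)
    (x y : H) : Integrable (fun w => corrector F ν B q x (B y + w)) q :=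
  integrable_transition hq (fun y y' =>
    (hF.isCenteredLip hν x).poisson_lip hν hq hinv hB hb1 hF.nonneg y y') y

variable {Ω : Type*} {m0 : MeasurableSpace Ω} {P : Measure Ω} [IsProbabilityMeasure P]
  {ℱ : ℕ → MeasurableSpace Ω} {N : ℕ → Ω → H}

theorem integrable_inner_of_bound {Z V : Ω → H} {R : Ω → ℝ} {c ζ y : ℝ}
    (hZ : LpBd P 4 Z ζ) (hζ : 0 ≤ ζ) (hR : LpBd P 4 R y) (hc : 0 ≤ c)
    (hV : AEStronglyMeasurable V P) (hVR : ∀ ω, ‖V ω‖ ≤ c * R ω) :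
    LpBd P 1 (fun ω => ⟪Z ω, V ω⟫_ℝ) (ζ * (c * y)) := by
  have hR2 := (hR.of_le two_le_four_ennreal).const_mul hc
  have h := LpBd.mul (r := 1) (hZ.of_le two_le_four_ennreal).norm hR2 hζ
  refine h.mono_real (hZ.1.inner hV) fun ω => ?_
  exact (norm_inner_le_norm _ _).trans
    (mul_le_mul_of_nonneg_left (hVR ω) (norm_nonneg _))

/-- By the Poisson equation the fluctuation at `(X k, Y (k + 1))` equals `ψ (X k) (Y (k + 1))` minus
the conditional expectation of `ψ (X k) (Y (k + 2))` given `ℱ (k + 1)`. The sum therefore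
telescopes, up to two boundary terms and the effect of replacing `(Z k, X k)` by `(Z (k + 1), X (k +
1))`. The corrector costs `(1 - b)⁻¹` once, however many terms are summed. -/
theorem abs_sum_integral_inner_fluctuation_le (hF : IsCoefficient F L)
    (hν : Integrable (fun y => y) ν) (hq : Integrable (fun y => y) q) (hinv : ν.map B ∗ q = ν)
    (hB : ‖B‖ ≤ b) (hb1 : b < 1) (hN : IsNoise P ℱ N q) {X Y Z : ℕ → Ω → H}
    (hY : ∀ n ω, Y (n + 1) ω = B (Y n ω) + N n ω)
    (hXm : ∀ n, AEStronglyMeasurable[ℱ n] (X n) P) (hYm : ∀ n, AEStronglyMeasurable[ℱ n] (Y n) P)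
    (hZm : ∀ n, AEStronglyMeasurable[ℱ n] (Z n) P) {n : ℕ} {ζ y : ℝ} {η β : ℕ → ℝ}
    (hζ : 0 ≤ ζ) (hy : 0 ≤ y) (hη : ∀ k, 0 ≤ η k) (hβ : ∀ k, 0 ≤ β k)
    (hZ : ∀ k ≤ n, LpBd P 4 (Z k) ζ)
    (hZ' : ∀ k < n, LpBd P 2 (fun ω => Z (k + 1) ω - Z k ω) (η k))
    (hX' : ∀ k < n, LpBd P 2 (fun ω => X (k + 1) ω - X k ω) (β k))
    (hYb : ∀ k, LpBd P 4 (fun ω => ‖Y k ω‖ + ∫ z, ‖z‖ ∂ν) y) :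
    |∑ k ∈ Finset.range n, ∫ ω, ⟪Z k ω, fluctuation F ν (X k ω) (Y (k + 1) ω)⟫_ℝ ∂P|
      ≤ L * (1 - b)⁻¹ * (2 * ζ * y + ∑ k ∈ Finset.range n, (η k + ζ * β k) * y) := by
  set ψ := corrector F ν B q with hψ
  set c := L * (1 - b)⁻¹ with hc_def
  have hc : 0 ≤ c := mul_nonneg hF.nonneg (by rw [inv_nonneg]; linarith)
  have hψc : Continuous fun p : H × H => ψ p.1 p.2 := continuous_corrector hF hν hq hinv hB hb1
  have hX0 : ∀ n, AEStronglyMeasurable (X n) P := fun n => (hXm n).mono (hN.le n)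
  have hY0 : ∀ n, AEStronglyMeasurable (Y n) P := fun n => (hYm n).mono (hN.le n)
  have hψm : ∀ j i, AEStronglyMeasurable (fun ω => ψ (X j ω) (Y i ω)) P := fun j i =>
    hψc.comp_aestronglyMeasurable ((hX0 j).prodMk (hY0 i))
  have hψb : ∀ j i ω, ‖ψ (X j ω) (Y i ω)‖ ≤ c * (‖Y i ω‖ + ∫ z, ‖z‖ ∂ν) := fun j i ω =>
    norm_corrector_le hF hν hq hinv hB hb1 _ _
  have hbd : ∀ k ≤ n, ∀ j i, LpBd P 1 (fun ω => ⟪Z k ω, ψ (X j ω) (Y i ω)⟫_ℝ) (ζ * (c * y)) :=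
    fun k hk j i => integrable_inner_of_bound (hZ k hk) hζ (hYb i) hc (hψm j i) (hψb j i)
  set u : ℕ → ℝ := fun k => ∫ ω, ⟪Z k ω, ψ (X k ω) (Y (k + 1) ω)⟫_ℝ ∂P with hu
  set v : ℕ → ℝ := fun k => ∫ ω, ⟪Z k ω, ψ (X k ω) (Y (k + 2) ω)⟫_ℝ ∂P with hv
  have hub : ∀ k ≤ n, |u k| ≤ ζ * (c * y) := fun k hk => by
    have := (hbd k hk k (k + 1)).norm_integral_le (by positivity)
    rwa [Real.norm_eq_abs] at this
  -- the Markov property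
  have hmarkov : ∀ k < n, ∫ ω, ⟪Z k ω, fluctuation F ν (X k ω) (Y (k + 1) ω)⟫_ℝ ∂P
      = u k - v k := by
    intro k hk
    have hle : ℱ k ≤ ℱ (k + 1) := hN.mono (Nat.le_succ k)
    have hU : AEStronglyMeasurable[ℱ (k + 1)] (fun ω => (Z k ω, X k ω, Y (k + 1) ω)) P :=
      ((hZm k).mono hle).prodMk (((hXm k).mono hle).prodMk (hYm (k + 1)))
    have hg : Continuous fun p : (H × H × H) × H => ⟪p.1.1, ψ p.1.2.1 (B p.1.2.2 + p.2)⟫_ℝ :=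
      (by fun_prop : Continuous fun p : (H × H × H) × H => p.1.1).inner
        (hψc.comp (by fun_prop : Continuous fun p : (H × H × H) × H =>
          (p.1.2.1, B p.1.2.2 + p.2)))
    -- `Y (k + 2)` is `B (Y (k + 1))` plus the noise `N (k + 1)`, which is independent of `ℱ (k +
    -- 1)`. Freezing the triple in `hU` leaves an integral over the law `q` of that noise.
    have hint := (hbd k hk.le k (k + 2)).integrable
    simp only [hY (k + 1)] at hint
    have h1 := hN.integral_comp hU hg hint
    have h2 : v k = ∫ ω, (⟪Z k ω, ψ (X k ω) (Y (k + 1) ω)⟫_ℝ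
        - ⟪Z k ω, fluctuation F ν (X k ω) (Y (k + 1) ω)⟫_ℝ) ∂P := by
      simp only [hv, hY (k + 1)]
      refine h1.trans (integral_congr_ae (ae_of_all _ fun ω => ?_))
      change ∫ w, ⟪Z k ω, ψ (X k ω) (B (Y (k + 1) ω) + w)⟫_ℝ ∂q
        = ⟪Z k ω, ψ (X k ω) (Y (k + 1) ω)⟫_ℝ
          - ⟪Z k ω, fluctuation F ν (X k ω) (Y (k + 1) ω)⟫_ℝ
      rw [integral_inner (integrable_corrector hF hν hq hinv hB hb1 _ _), ← inner_sub_right]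
      congr 1
      rw [hψ, corrector_eq hF hν hq hinv hB hb1 (X k ω) (Y (k + 1) ω)]
      abel
    have hGm : AEStronglyMeasurable (fun ω => fluctuation F ν (X k ω) (Y (k + 1) ω)) P :=
      (hF.continuous_fluctuation hν).comp_aestronglyMeasurable ((hX0 k).prodMk (hY0 (k + 1)))
    have hGi := (integrable_inner_of_bound (hZ k hk.le) hζ (hYb (k + 1)) hF.nonneg hGm
      fun ω => hF.norm_fluctuation_le hν _ _).integrable
    rw [h2, integral_sub (hbd k hk.le k (k + 1)).integrable hGi]
    ring
  -- the increments
  have hinc : ∀ k < n, |u (k + 1) - v k| ≤ c * ((η k + ζ * β k) * y) := by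
    intro k hk
    have h1 : u (k + 1) - v k = ∫ ω, (⟪Z (k + 1) ω, ψ (X (k + 1) ω) (Y (k + 2) ω)⟫_ℝ
        - ⟪Z k ω, ψ (X k ω) (Y (k + 2) ω)⟫_ℝ) ∂P :=
      (integral_sub (hbd (k + 1) hk (k + 1) (k + 2)).integrable
        (hbd k hk.le k (k + 2)).integrable).symm
    have hY2 := hYb (k + 2)
    have h2 := (LpBd.mul (r := 1) (hZ' k hk).norm (hY2.of_le two_le_four_ennreal) (hη k)).const_mul hc
    -- Hölder with `1/4 + 1/4 + 1/2 = 1`: fourth moments of `Z` and `Y` against the second moment of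
    -- the increment of `X`.
    have h3 := (LpBd.mul (r := 1) (LpBd.mul (r := 2) (hZ k hk.le).norm hY2 hζ) (hX' k hk).norm
      (by positivity)).const_mul hc
    have h4 := h2.add h3 le_rfl (mul_nonneg hc (mul_nonneg (hη k) hy))
      (mul_nonneg hc (mul_nonneg (mul_nonneg hζ hy) (hβ k)))
    have hm := (hbd (k + 1) hk (k + 1) (k + 2)).1.sub (hbd k hk.le k (k + 2)).1
    have h5 := (h4.mono_real hm fun ω => ?_).norm_integral_le (add_nonneg
      (mul_nonneg hc (mul_nonneg (hη k) hy))
      (mul_nonneg hc (mul_nonneg (mul_nonneg hζ hy) (hβ k))))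
    · rw [h1, ← Real.norm_eq_abs]
      exact h5.trans (le_of_eq (by ring))
    · have e : ⟪Z (k + 1) ω, ψ (X (k + 1) ω) (Y (k + 2) ω)⟫_ℝ - ⟪Z k ω, ψ (X k ω) (Y (k + 2) ω)⟫_ℝ
          = ⟪Z (k + 1) ω - Z k ω, ψ (X (k + 1) ω) (Y (k + 2) ω)⟫_ℝ
            + ⟪Z k ω, ψ (X (k + 1) ω) (Y (k + 2) ω) - ψ (X k ω) (Y (k + 2) ω)⟫_ℝ := by
        rw [inner_sub_left, inner_sub_right]; ring
      rw [Pi.sub_apply, e]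
      refine (norm_add_le _ _).trans (add_le_add ?_ ?_)
      · refine (norm_inner_le_norm _ _).trans ((mul_le_mul_of_nonneg_left
          (hψb (k + 1) (k + 2) ω) (norm_nonneg _)).trans (le_of_eq (by ring)))
      · refine (norm_inner_le_norm _ _).trans ((mul_le_mul_of_nonneg_left
          (norm_corrector_sub_le hF hν hq hinv hB hb1 _ _ _) (norm_nonneg _)).trans
          (le_of_eq (by ring)))
  rw [Finset.sum_congr rfl fun k hk => hmarkov k (Finset.mem_range.1 hk)]
  have htel : ∑ k ∈ Finset.range n, (u k - v k)
      = u 0 - u n + ∑ k ∈ Finset.range n, (u (k + 1) - v k) := by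
    have := Finset.sum_range_sub u n
    rw [← neg_sub (u n) (u 0), ← this, ← Finset.sum_neg_distrib, ← Finset.sum_add_distrib]
    exact Finset.sum_congr rfl fun k _ => by ring
  rw [htel]
  have h0 := hub 0 (Nat.zero_le n)
  have hn := hub n le_rfl
  have hs : |∑ k ∈ Finset.range n, (u (k + 1) - v k)|
      ≤ c * ∑ k ∈ Finset.range n, (η k + ζ * β k) * y := by
    rw [Finset.mul_sum]
    exact (Finset.abs_sum_le_sum_abs _ _).trans
      (Finset.sum_le_sum fun k hk => hinc k (Finset.mem_range.1 hk))
  have h6 := abs_add_le (u 0 - u n) (∑ k ∈ Finset.range n, (u (k + 1) - v k))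
  have h7 := abs_sub (u 0) (u n)
  nlinarith

end Poisson

/-! ### From averaged sums of fluctuations to the weak error. -/

section WeakError

variable {H : Type*} [NormedAddCommGroup H] [InnerProductSpace ℝ H] [CompleteSpace H]
  [MeasurableSpace H] [BorelSpace H] [SecondCountableTopology H]
  {F : H → H → H} {L : ℝ} {ν : Measure H} [IsProbabilityMeasure ν]
  {Ω : Type*} {m0 : MeasurableSpace Ω} {P : Measure Ω} [IsProbabilityMeasure P]

/-- `φ` is Lipschitz continuous and has a first-order Taylor expansion, with constant `K`. -/
structure IsTestFunction (φ : H → ℝ) (K : ℝ) : Prop where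
  nonneg : 0 ≤ K
  lip : ∀ x x', |φ x - φ x'| ≤ K * ‖x - x'‖
  taylor : ∃ D : H → (H →L[ℝ] ℝ), (∀ x, ‖D x‖ ≤ K) ∧
    ∀ x d, |φ (x + d) - φ x - D x d| ≤ K * ‖d‖ ^ 2

theorem IsTestFunction.continuous {φ : H → ℝ} {K : ℝ} (hφ : IsTestFunction φ K) :
    Continuous φ :=
  (LipschitzWith.of_dist_le' (K := K) fun x x' => by
    simpa only [dist_eq_norm, Real.norm_eq_abs] using hφ.lip x x').continuous

theorem IsTestFunction.integrable {φ : H → ℝ} {K : ℝ} (hφ : IsTestFunction φ K) {X : Ω → H}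
    (hX : Integrable X P) : Integrable (fun ω => φ (X ω)) P := by
  refine Integrable.mono' (g := fun ω => K * ‖X ω‖ + |φ 0|)
    ((hX.norm.const_mul K).add (integrable_const _))
    (hφ.continuous.comp_aestronglyMeasurable hX.1) (ae_of_all _ fun ω => ?_)
  have h1 := hφ.lip (X ω) 0
  rw [sub_zero] at h1
  rw [Real.norm_eq_abs]
  have := abs_sub_abs_le_abs_sub (φ (X ω)) (φ 0)
  linarith

/-- A crude Lipschitz bound, sufficient when the initial value is large compared with `1 / ε`. -/
theorem IsTestFunction.abs_integral_sub_le_of_lpBd {φ : H → ℝ} {K : ℝ} (hφ : IsTestFunction φ K)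
    {X : Ω → H} {x : H} {c : ℝ} (hc : 0 ≤ c) (hX : LpBd P 1 (fun ω => X ω - x) c) :
    |(∫ ω, φ (X ω) ∂P) - φ x| ≤ K * c := by
  have hXi : Integrable X P := by
    refine (hX.integrable.add (integrable_const x)).congr (ae_of_all _ fun ω => ?_)
    simp
  have h1 : (∫ ω, φ (X ω) ∂P) - φ x = ∫ ω, (φ (X ω) - φ x) ∂P := by
    rw [integral_sub (hφ.integrable hXi) (integrable_const _)]; simp
  rw [h1, ← Real.norm_eq_abs]
  exact ((hX.norm.const_mul hφ.nonneg).mono_real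
    ((hφ.integrable hXi).1.sub aestronglyMeasurable_const)
    fun ω => hφ.lip _ _).norm_integral_le (mul_nonneg hφ.nonneg hc)

theorem LpBd.integral_sq_le {E : Type*} [NormedAddCommGroup E] {f : Ω → E} {c : ℝ}
    (h : LpBd P 2 f c) (hc : 0 ≤ c) :
    Integrable (fun ω => ‖f ω‖ ^ 2) P ∧ ∫ ω, ‖f ω‖ ^ 2 ∂P ≤ c ^ 2 := by
  have h1 := LpBd.mul (r := 1) h.norm h.norm hc
  simp only [← pow_two] at h1
  refine ⟨h1.integrable, ?_⟩
  have := h1.norm_integral_le (by positivity)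
  rwa [Real.norm_of_nonneg (integral_nonneg fun ω => by positivity)] at this

theorem integrable_inner {f g : Ω → H} (hf : MemLp f 2 P) (hg : MemLp g 2 P) :
    Integrable (fun ω => ⟪f ω, g ω⟫_ℝ) P := by
  have h := LpBd.mul (r := 1) (MemLp.lpBd hf).norm (MemLp.lpBd hg).norm ENNReal.toReal_nonneg
  exact (h.mono_real (hf.1.inner hg.1) fun ω => norm_inner_le_norm _ _).integrable

theorem norm_pow_apply_le {A : H →L[ℝ] H} (hA : ‖A‖ ≤ 1) (k : ℕ) (x : H) : ‖(A ^ k) x‖ ≤ ‖x‖ := by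
  induction k with
  | zero => simp
  | succ k ih =>
    rw [pow_succ']
    have h := A.le_of_opNorm_le hA ((A ^ k) x)
    rw [one_mul] at h
    exact h.trans ih

/-- The constant of the second moment estimate. -/
noncomputable def momentConst (L T : ℝ) : ℝ :=
  (2 + 2 * T * L ^ 2) * Real.exp ((2 * L + 2 * T * L ^ 2) * T)

/-- The constant of the weak error estimate. -/
noncomputable def weakConst (L T : ℝ) : ℝ :=
  (1 + T * L * momentConst L T) * Real.exp (L * T) + momentConst L T

theorem momentConst_nonneg {L T : ℝ} (hT : 0 ≤ T) : 0 ≤ momentConst L T := by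
  unfold momentConst; positivity

section

variable {A : H →L[ℝ] H} {Δ T : ℝ} {N : ℕ} {X V : ℕ → Ω → H} {xb : ℕ → H} {v δ : ℝ}

theorem lpBd_fluctuation (hF : IsCoefficient F L) (hν : Integrable (fun y => y) ν)
    {X V : Ω → H} {p : ENNReal} (hX : AEStronglyMeasurable X P) (hVm : AEStronglyMeasurable V P)
    (hV : LpBd P p (fun ω => ‖V ω‖ + ∫ z, ‖z‖ ∂ν) v) :
    LpBd P p (fun ω => fluctuation F ν (X ω) (V ω)) (L * v) :=
  (hV.const_mul hF.nonneg).mono_real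
    ((hF.continuous_fluctuation hν).comp_aestronglyMeasurable (hX.prodMk hVm))
    fun _ => hF.norm_fluctuation_le hν _ _

/-- Energy estimate. The cross term with the fluctuation is kept in signed form until after
summation, where `h1` applies; taking norms at each step would lose the cancellation. The squared
fluctuations carry `Δ ^ 2` and add up to order `Δ`. -/
theorem integral_sq_deviation_le (hF : IsCoefficient F L) (hν : Integrable (fun y => y) ν)
    (hA : ‖A‖ ≤ 1) (hΔ : 0 < Δ) (hN : 1 ≤ N) (hT : N * Δ = T) {d : ℝ}
    (hX0 : ∀ ω, ‖X 0 ω - xb 0‖ = d)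
    (hX : ∀ n ω, X (n + 1) ω = A (X n ω + Δ • F (X n ω) (V n ω)))
    (hxb : ∀ n, xb (n + 1) = A (xb n + Δ • average F ν (xb n)))
    (hX2 : ∀ n, MemLp (X n) 2 P) (hVm : ∀ n, AEStronglyMeasurable (V n) P) (hv : 0 ≤ v)
    (hV : ∀ n, LpBd P 2 (fun ω => ‖V n ω‖ + ∫ z, ‖z‖ ∂ν) v) (hδ : 0 ≤ δ)
    (h1 : ∀ n ≤ N, Δ * |∑ k ∈ Finset.range n,
      ∫ ω, ⟪X k ω - xb k, fluctuation F ν (X k ω) (V k ω)⟫_ℝ ∂P| ≤ δ) :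
    ∀ n ≤ N, ∫ ω, ‖X n ω - xb n‖ ^ 2 ∂P ≤ momentConst L T * (d ^ 2 + δ + Δ * v ^ 2) := by
  have hT0 : 0 < T := by rw [← hT]; positivity
  have hΔT : Δ ≤ T := by
    rw [← hT]; exact le_mul_of_one_le_left hΔ.le (by exact_mod_cast hN)
  have hL := hF.nonneg
  set G : ℕ → Ω → H := fun k ω => fluctuation F ν (X k ω) (V k ω) with hG
  set D : ℕ → Ω → H := fun k ω => X k ω - xb k with hD
  have hD2 : ∀ n, MemLp (D n) 2 P := fun n => (hX2 n).sub (memLp_const _)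
  have hDi : ∀ n, Integrable (fun ω => ‖D n ω‖ ^ 2) P := fun n =>
    (hD2 n).integrable_norm_pow (by norm_num)
  have hGb : ∀ n, LpBd P 2 (G n) (L * v) := fun n => lpBd_fluctuation hF hν (hX2 n).1 (hVm n) (hV n)
  have hGi := fun n => (hGb n).integral_sq_le (by positivity)
  have hDG : ∀ n, Integrable (fun ω => ⟪D n ω, G n ω⟫_ℝ) P := fun n =>
    integrable_inner (hD2 n) (hGb n).memLp
  have hstep : ∀ n, ∫ ω, ‖D (n + 1) ω‖ ^ 2 ∂P ≤ (∫ ω, ‖D n ω‖ ^ 2 ∂P)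
      + Δ * (2 * L + 2 * T * L ^ 2) * (∫ ω, ‖D n ω‖ ^ 2 ∂P)
      + 2 * Δ * (∫ ω, ⟪D n ω, G n ω⟫_ℝ ∂P) + 2 * Δ ^ 2 * (L * v) ^ 2 := by
    intro n
    have hpt : ∀ ω : Ω, ‖D (n + 1) ω‖ ^ 2 ≤ (1 + Δ * (2 * L + 2 * T * L ^ 2)) * ‖D n ω‖ ^ 2
        + 2 * Δ * ⟪D n ω, G n ω⟫_ℝ + 2 * Δ ^ 2 * ‖G n ω‖ ^ 2 := by
      intro ω
      set f := average F ν (X n ω) - average F ν (xb n) with hf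
      have hfL : ‖f‖ ≤ L * ‖D n ω‖ := hF.average_lip hν _ _
      have e1 : D (n + 1) ω = A (D n ω + Δ • (f + G n ω)) := by
        simp only [hD, hG, hf, hX, hxb, fluctuation, ← map_sub]
        congr 1
        rw [add_sub_add_comm, ← smul_sub]
        congr 2
        abel
      have e2 : ‖D (n + 1) ω‖ ^ 2 ≤ ‖D n ω + Δ • (f + G n ω)‖ ^ 2 := by
        rw [e1]
        refine pow_le_pow_left₀ (norm_nonneg _) ?_ 2
        simpa using A.le_of_opNorm_le hA (D n ω + Δ • (f + G n ω))
      have e3 : ‖D n ω + Δ • (f + G n ω)‖ ^ 2 = ‖D n ω‖ ^ 2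
          + 2 * Δ * ⟪D n ω, f⟫_ℝ + 2 * Δ * ⟪D n ω, G n ω⟫_ℝ + Δ ^ 2 * ‖f + G n ω‖ ^ 2 := by
        rw [norm_add_sq_real, norm_smul, inner_smul_right, inner_add_right,
          Real.norm_of_nonneg hΔ.le]
        ring
      have e4 : ⟪D n ω, f⟫_ℝ ≤ L * ‖D n ω‖ ^ 2 :=
        (real_inner_le_norm _ _).trans (by nlinarith [norm_nonneg (D n ω)])
      have e5 : ‖f + G n ω‖ ^ 2 ≤ 2 * (L * ‖D n ω‖) ^ 2 + 2 * ‖G n ω‖ ^ 2 := by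
        have h2 := norm_add_le f (G n ω)
        have h3 : ‖f + G n ω‖ ≤ L * ‖D n ω‖ + ‖G n ω‖ := by linarith
        have h4 := pow_le_pow_left₀ (norm_nonneg _) h3 2
        nlinarith [sq_nonneg (L * ‖D n ω‖ - ‖G n ω‖)]
      -- One of the two factors `Δ` is bounded by `T`, so that the term joins the Gronwall
      -- coefficient.
      have e6 : Δ ^ 2 * (2 * (L * ‖D n ω‖) ^ 2) ≤ Δ * (2 * T * L ^ 2) * ‖D n ω‖ ^ 2 := by
        have : Δ ^ 2 * (2 * (L * ‖D n ω‖) ^ 2) = Δ * Δ * (2 * L ^ 2 * ‖D n ω‖ ^ 2) := by ring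
        rw [this]
        have h2 : Δ * Δ * (2 * L ^ 2 * ‖D n ω‖ ^ 2) ≤ Δ * T * (2 * L ^ 2 * ‖D n ω‖ ^ 2) := by
          gcongr
        linarith
      have e7 : Δ ^ 2 * ‖f + G n ω‖ ^ 2
          ≤ Δ ^ 2 * (2 * (L * ‖D n ω‖) ^ 2 + 2 * ‖G n ω‖ ^ 2) := by gcongr
      have e8 : 2 * Δ * ⟪D n ω, f⟫_ℝ ≤ 2 * Δ * (L * ‖D n ω‖ ^ 2) := by gcongr
      linarith
    have i1 : Integrable (fun ω => (1 + Δ * (2 * L + 2 * T * L ^ 2)) * ‖D n ω‖ ^ 2) P :=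
      (hDi n).const_mul _
    have i2 : Integrable (fun ω => 2 * Δ * ⟪D n ω, G n ω⟫_ℝ) P := (hDG n).const_mul _
    have i3 : Integrable (fun ω => 2 * Δ ^ 2 * ‖G n ω‖ ^ 2) P := (hGi n).1.const_mul _
    have i12 : Integrable (fun ω => (1 + Δ * (2 * L + 2 * T * L ^ 2)) * ‖D n ω‖ ^ 2
      + 2 * Δ * ⟪D n ω, G n ω⟫_ℝ) P := i1.add i2
    have h2 := integral_mono (hDi (n + 1)) (i12.add i3) hpt
    simp only [Pi.add_apply] at h2
    rw [integral_add i12 i3, integral_add i1 i2, integral_const_mul, integral_const_mul,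
      integral_const_mul] at h2
    have h3 := mul_le_mul_of_nonneg_left (hGi n).2 (by positivity : 0 ≤ 2 * Δ ^ 2)
    linarith
  have hsum : ∀ n, ∫ ω, ‖D n ω‖ ^ 2 ∂P ≤ d ^ 2
      + 2 * (Δ * ∑ k ∈ Finset.range n, ∫ ω, ⟪D k ω, G k ω⟫_ℝ ∂P) + n * (2 * Δ ^ 2 * (L * v) ^ 2)
      + Δ * (2 * L + 2 * T * L ^ 2) * ∑ k ∈ Finset.range n, ∫ ω, ‖D k ω‖ ^ 2 ∂P := by
    intro n
    induction n with
    | zero => simp [hD, hX0]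
    | succ n ih =>
      rw [Finset.sum_range_succ, Finset.sum_range_succ]
      have := hstep n
      push_cast
      linarith
  have hb : ∀ n ≤ N, ∫ ω, ‖D n ω‖ ^ 2 ∂P ≤ (2 + 2 * T * L ^ 2) * (d ^ 2 + δ + Δ * v ^ 2)
      + Δ * (2 * L + 2 * T * L ^ 2) * ∑ k ∈ Finset.range n, ∫ ω, ‖D k ω‖ ^ 2 ∂P := by
    intro n hn
    refine (hsum n).trans (add_le_add_left ?_ _)
    have h2 := (mul_le_mul_of_nonneg_left (le_abs_self _) hΔ.le).trans (h1 n hn)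
    have h3 : (n : ℝ) * (2 * Δ ^ 2 * (L * v) ^ 2) ≤ 2 * T * L ^ 2 * (Δ * v ^ 2) := by
      have : (n : ℝ) * Δ ≤ T := by
        rw [← hT]; gcongr
      calc (n : ℝ) * (2 * Δ ^ 2 * (L * v) ^ 2) = (n * Δ) * (2 * L ^ 2 * (Δ * v ^ 2)) := by ring
        _ ≤ T * (2 * L ^ 2 * (Δ * v ^ 2)) := by gcongr
        _ = _ := by ring
    have h4 : 0 ≤ 2 * T * L ^ 2 * (d ^ 2 + δ) := by positivity
    have h5 : 0 ≤ Δ * v ^ 2 := by positivity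
    nlinarith [sq_nonneg d]
  intro n hn
  refine (discrete_gronwall_sum (by positivity) (by positivity) hb n hn).trans ?_
  rw [momentConst]
  have : Δ * (2 * L + 2 * T * L ^ 2) * n ≤ (2 * L + 2 * T * L ^ 2) * T := by
    rw [← hT]
    calc Δ * (2 * L + 2 * (N * Δ) * L ^ 2) * n ≤ Δ * (2 * L + 2 * (N * Δ) * L ^ 2) * N := by gcongr
      _ = _ := by ring
  have h2 := Real.exp_le_exp.2 this
  calc (2 + 2 * T * L ^ 2) * (d ^ 2 + δ + Δ * v ^ 2)
        * Real.exp (Δ * (2 * L + 2 * T * L ^ 2) * n)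
      ≤ (2 + 2 * T * L ^ 2) * (d ^ 2 + δ + Δ * v ^ 2)
        * Real.exp ((2 * L + 2 * T * L ^ 2) * T) := by gcongr
    _ = _ := by ring

/-- The mean of the deviation obeys a linearised recursion. The Taylor remainder costs only the
second moment `S`, and the fluctuations enter only through their expectations. The mean is thus of
the order of `S`, not of its square root. -/
theorem norm_integral_deviation_le (hF : IsCoefficient F L) (hν : Integrable (fun y => y) ν)
    (hA : ‖A‖ ≤ 1) (hΔ : 0 < Δ) (hT : N * Δ = T) {d S : ℝ} (hS : 0 ≤ S)
    (hX0 : ∀ ω, ‖X 0 ω - xb 0‖ = d)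
    (hX : ∀ n ω, X (n + 1) ω = A (X n ω + Δ • F (X n ω) (V n ω)))
    (hxb : ∀ n, xb (n + 1) = A (xb n + Δ • average F ν (xb n)))
    (hX2 : ∀ n, MemLp (X n) 2 P) (hVm : ∀ n, AEStronglyMeasurable (V n) P)
    (hV : ∀ n, LpBd P 2 (fun ω => ‖V n ω‖ + ∫ z, ‖z‖ ∂ν) v) (hδ : 0 ≤ δ)
    (h2 : ∀ n ≤ N, ∀ h : H, Δ * |∑ k ∈ Finset.range n,
      ∫ ω, ⟪ContinuousLinearMap.adjoint (A ^ (n - k)) h,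
        fluctuation F ν (X k ω) (V k ω)⟫_ℝ ∂P| ≤ δ * ‖h‖)
    (hSb : ∀ n ≤ N, ∫ ω, ‖X n ω - xb n‖ ^ 2 ∂P ≤ S) :
    ∀ n ≤ N, ‖∫ ω, (X n ω - xb n) ∂P‖ ≤ (d + δ + T * L * S) * Real.exp (L * T) := by
  have hL := hF.nonneg
  have hd : 0 ≤ d := by
    obtain ⟨ω⟩ : Nonempty Ω := nonempty_of_isProbabilityMeasure P
    rw [← hX0 ω]; exact norm_nonneg _
  have hT0 : 0 ≤ T := by rw [← hT]; positivity
  set G : ℕ → Ω → H := fun k ω => fluctuation F ν (X k ω) (V k ω) with hG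
  set D : ℕ → Ω → H := fun k ω => X k ω - xb k with hD
  have hD2 : ∀ n, MemLp (D n) 2 P := fun n => (hX2 n).sub (memLp_const _)
  have hD1 : ∀ n, Integrable (D n) P := fun n => (hD2 n).integrable one_le_two_ennreal
  have hDi : ∀ n, Integrable (fun ω => ‖D n ω‖ ^ 2) P := fun n =>
    (hD2 n).integrable_norm_pow (by norm_num)
  have hG1 : ∀ n, Integrable (G n) P := fun n =>
    (lpBd_fluctuation hF hν (hX2 n).1 (hVm n) (hV n)).memLp.integrable one_le_two_ennreal
  set f : ℕ → Ω → H := fun k ω => average F ν (X k ω) - average F ν (xb k) with hf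
  have hf1 : ∀ n, Integrable (f n) P := fun n => by
    refine Integrable.mono' ((hD1 n).norm.const_mul L) ?_ (ae_of_all _ fun ω => ?_)
    · exact (((hF.continuous_average hν).comp_aestronglyMeasurable (hX2 n).1).sub
        aestronglyMeasurable_const)
    · exact hF.average_lip hν _ _
  have hfn : ∀ n ≤ N, ‖∫ ω, f n ω ∂P‖ ≤ L * ‖∫ ω, D n ω ∂P‖ + L * S := by
    intro n hn
    obtain ⟨Db, hDb, ht⟩ := hF.average_taylor hν
    have e1 : ∫ ω, f n ω ∂P = Db (xb n) (∫ ω, D n ω ∂P)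
        + ∫ ω, (f n ω - Db (xb n) (D n ω)) ∂P := by
      rw [integral_sub (hf1 n) ((Db (xb n)).integrable_comp (hD1 n)),
        ContinuousLinearMap.integral_comp_comm _ (hD1 n)]
      abel
    have e2 : ‖∫ ω, (f n ω - Db (xb n) (D n ω)) ∂P‖ ≤ L * S := by
      refine (norm_integral_le_of_norm_le ((hDi n).const_mul L) (ae_of_all _ fun ω => ?_)).trans ?_
      · have := ht (xb n) (D n ω)
        simpa [hD, hf] using this
      · rw [integral_const_mul]
        exact mul_le_mul_of_nonneg_left (hSb n hn) hL
    rw [e1]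
    exact (norm_add_le _ _).trans (add_le_add ((Db (xb n)).le_of_opNorm_le (hDb _) _) e2)
  have hpow := norm_pow_apply_le hA
  have hdu : ∀ n, ∫ ω, D n ω ∂P = (A ^ n) (∫ ω, D 0 ω ∂P)
      + Δ • ∑ k ∈ Finset.range n, (A ^ (n - k)) ((∫ ω, f k ω ∂P) + ∫ ω, G k ω ∂P) := by
    refine duhamel (x := fun n => ∫ ω, D n ω ∂P)
      (f := fun k => (∫ ω, f k ω ∂P) + ∫ ω, G k ω ∂P) fun n => ?_
    have i1 : Integrable (fun ω => Δ • (f n ω + G n ω)) P := ((hf1 n).add (hG1 n)).smul Δ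
    have i2 : Integrable (fun ω => D n ω + Δ • (f n ω + G n ω)) P := (hD1 n).add i1
    rw [← integral_add (hf1 n) (hG1 n), ← integral_smul, ← integral_add (hD1 n) i1,
      ← ContinuousLinearMap.integral_comp_comm A i2]
    refine integral_congr_ae (ae_of_all _ fun ω => ?_)
    simp only [hD, hG, hf, hX, hxb, fluctuation, ← map_sub]
    congr 1
    rw [add_sub_add_comm, ← smul_sub]
    congr 2
    abel
  have hGs : ∀ n ≤ N, Δ * ‖∑ k ∈ Finset.range n, (A ^ (n - k)) (∫ ω, G k ω ∂P)‖ ≤ δ := by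
    intro n hn
    -- Duality: `w` is tested against itself, and the adjoints move the powers of `A` onto the test
    -- vector, where they become the deterministic weights of `h2`.
    set w := ∑ k ∈ Finset.range n, (A ^ (n - k)) (∫ ω, G k ω ∂P) with hw
    have e1 : ‖w‖ ^ 2 = ∑ k ∈ Finset.range n,
        ∫ ω, ⟪ContinuousLinearMap.adjoint (A ^ (n - k)) w, G k ω⟫_ℝ ∂P := by
      rw [← real_inner_self_eq_norm_sq]
      conv_lhs => rw [hw, inner_sum]
      refine Finset.sum_congr rfl fun k _ => ?_
      rw [integral_inner (hG1 k), ContinuousLinearMap.adjoint_inner_left, ← hw]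
    have e2 := h2 n hn w
    rw [← e1, abs_of_nonneg (sq_nonneg _)] at e2
    rcases (norm_nonneg w).eq_or_lt with h0 | h0
    · rw [← h0, mul_zero]; exact hδ
    · refine le_of_mul_le_mul_right ?_ h0
      linarith [pow_two ‖w‖, e2, mul_assoc Δ ‖w‖ ‖w‖]
  have hb : ∀ n ≤ N, ‖∫ ω, D n ω ∂P‖ ≤ (d + δ + T * L * S)
      + (Δ * L) * ∑ k ∈ Finset.range n, ‖∫ ω, D k ω ∂P‖ := by
    intro n hn
    rw [hdu n]
    simp only [map_add, Finset.sum_add_distrib, smul_add]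
    have e0 : ‖(A ^ n) (∫ ω, D 0 ω ∂P)‖ ≤ d := by
      refine (hpow _ _).trans ((norm_integral_le_integral_norm _).trans (le_of_eq ?_))
      simp [hD, hX0]
    have e1 : ‖Δ • ∑ k ∈ Finset.range n, (A ^ (n - k)) (∫ ω, f k ω ∂P)‖
        ≤ Δ * ∑ k ∈ Finset.range n, (L * ‖∫ ω, D k ω ∂P‖ + L * S) := by
      rw [norm_smul, Real.norm_of_nonneg hΔ.le]
      refine mul_le_mul_of_nonneg_left ((norm_sum_le _ _).trans
        (Finset.sum_le_sum fun k hk => (hpow _ _).trans (hfn k ?_))) hΔ.le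
      have := Finset.mem_range.1 hk
      omega
    have e2 : ‖Δ • ∑ k ∈ Finset.range n, (A ^ (n - k)) (∫ ω, G k ω ∂P)‖ ≤ δ := by
      rw [norm_smul, Real.norm_of_nonneg hΔ.le]
      exact hGs n hn
    have e3 : Δ * ∑ k ∈ Finset.range n, (L * ‖∫ ω, D k ω ∂P‖ + L * S)
        = Δ * L * ∑ k ∈ Finset.range n, ‖∫ ω, D k ω ∂P‖ + n * Δ * (L * S) := by
      rw [Finset.sum_add_distrib, ← Finset.mul_sum]
      simp
      ring
    have e4 : (n : ℝ) * Δ * (L * S) ≤ T * (L * S) := by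
      rw [← hT]; gcongr
    have e5 := norm_add_le ((A ^ n) (∫ ω, D 0 ω ∂P))
      (Δ • ∑ k ∈ Finset.range n, (A ^ (n - k)) (∫ ω, f k ω ∂P)
        + Δ • ∑ k ∈ Finset.range n, (A ^ (n - k)) (∫ ω, G k ω ∂P))
    have e6 := norm_add_le (Δ • ∑ k ∈ Finset.range n, (A ^ (n - k)) (∫ ω, f k ω ∂P))
      (Δ • ∑ k ∈ Finset.range n, (A ^ (n - k)) (∫ ω, G k ω ∂P))
    linarith
  intro n hn
  refine (discrete_gronwall_sum (by positivity) (by positivity) hb n hn).trans ?_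
  have : Δ * L * n ≤ L * T := by
    rw [← hT]
    calc Δ * L * n ≤ Δ * L * N := by gcongr
      _ = _ := by ring
  gcongr

/-- Expansion of `φ` at the deterministic point `xb N`: the first-order term sees only the mean of
the deviation, the remainder its second moment. -/
theorem weak_error_of_averaging (hF : IsCoefficient F L) (hν : Integrable (fun y => y) ν)
    (hA : ‖A‖ ≤ 1) (hΔ : 0 < Δ) (hN : 1 ≤ N) (hT : N * Δ = T) {d : ℝ}
    (hX0 : ∀ ω, ‖X 0 ω - xb 0‖ = d)
    (hX : ∀ n ω, X (n + 1) ω = A (X n ω + Δ • F (X n ω) (V n ω)))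
    (hxb : ∀ n, xb (n + 1) = A (xb n + Δ • average F ν (xb n)))
    (hX2 : ∀ n, MemLp (X n) 2 P) (hVm : ∀ n, AEStronglyMeasurable (V n) P) (hv : 0 ≤ v)
    (hV : ∀ n, LpBd P 2 (fun ω => ‖V n ω‖ + ∫ z, ‖z‖ ∂ν) v) (hδ : 0 ≤ δ)
    (h1 : ∀ n ≤ N, Δ * |∑ k ∈ Finset.range n,
      ∫ ω, ⟪X k ω - xb k, fluctuation F ν (X k ω) (V k ω)⟫_ℝ ∂P| ≤ δ)
    (h2 : ∀ n ≤ N, ∀ h : H, Δ * |∑ k ∈ Finset.range n,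
      ∫ ω, ⟪ContinuousLinearMap.adjoint (A ^ (n - k)) h,
        fluctuation F ν (X k ω) (V k ω)⟫_ℝ ∂P| ≤ δ * ‖h‖)
    {φ : H → ℝ} {K : ℝ} (hφ : IsTestFunction φ K) :
    |(∫ ω, φ (X N ω) ∂P) - φ (xb N)|
      ≤ K * (weakConst L T * (d + d ^ 2 + δ + Δ * v ^ 2)) := by
  have hL := hF.nonneg
  have hT0 : 0 ≤ T := by rw [← hT]; positivity
  have hd : 0 ≤ d := by
    obtain ⟨ω⟩ : Nonempty Ω := nonempty_of_isProbabilityMeasure P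
    rw [← hX0 ω]; exact norm_nonneg _
  have hM := momentConst_nonneg (L := L) hT0
  set S := momentConst L T * (d ^ 2 + δ + Δ * v ^ 2) with hS
  have hS0 : 0 ≤ S := by positivity
  have hSb := integral_sq_deviation_le hF hν hA hΔ hN hT hX0 hX hxb hX2 hVm hv hV hδ h1
  have hm := norm_integral_deviation_le hF hν hA hΔ hT hS0 hX0 hX hxb hX2 hVm hV hδ h2 hSb N le_rfl
  have hD2 : MemLp (fun ω => X N ω - xb N) 2 P := (hX2 N).sub (memLp_const _)
  have hD1 := hD2.integrable one_le_two_ennreal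
  have hφi := hφ.integrable ((hX2 N).integrable one_le_two_ennreal)
  obtain ⟨Dφ, hDφ, ht⟩ := hφ.taylor
  have e1 : (∫ ω, φ (X N ω) ∂P) - φ (xb N) = Dφ (xb N) (∫ ω, (X N ω - xb N) ∂P)
      + ∫ ω, (φ (X N ω) - φ (xb N) - Dφ (xb N) (X N ω - xb N)) ∂P := by
    have i1 : Integrable (fun ω => φ (X N ω) - φ (xb N)) P := hφi.sub (integrable_const _)
    rw [integral_sub i1 ((Dφ (xb N)).integrable_comp hD1),
      integral_sub hφi (integrable_const _), ContinuousLinearMap.integral_comp_comm _ hD1]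
    simp
  have e2 : ‖∫ ω, (φ (X N ω) - φ (xb N) - Dφ (xb N) (X N ω - xb N)) ∂P‖ ≤ K * S := by
    refine (norm_integral_le_of_norm_le ((hD2.integrable_norm_pow (by norm_num)).const_mul K)
      (ae_of_all _ fun ω => ?_)).trans ?_
    · have := ht (xb N) (X N ω - xb N)
      rw [add_sub_cancel] at this
      exact this
    · rw [integral_const_mul]
      exact mul_le_mul_of_nonneg_left (hSb N le_rfl) hφ.nonneg
  have e3 : ‖Dφ (xb N) (∫ ω, (X N ω - xb N) ∂P)‖
      ≤ K * ((d + δ + T * L * S) * Real.exp (L * T)) :=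
    ((Dφ (xb N)).le_of_opNorm_le (hDφ _) _).trans (mul_le_mul_of_nonneg_left hm hφ.nonneg)
  rw [e1, ← Real.norm_eq_abs]
  refine (norm_add_le _ _).trans ((add_le_add e3 e2).trans ?_)
  rw [← mul_add]
  refine mul_le_mul_of_nonneg_left ?_ hφ.nonneg
  set Q := d + d ^ 2 + δ + Δ * v ^ 2 with hQ
  have hv2 : 0 ≤ Δ * v ^ 2 := by positivity
  have hQ1 : d + δ ≤ Q := by nlinarith [sq_nonneg d]
  have hQ2 : S ≤ momentConst L T * Q := mul_le_mul_of_nonneg_left (by linarith) hM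
  calc (d + δ + T * L * S) * Real.exp (L * T) + S
      ≤ (Q + T * L * (momentConst L T * Q)) * Real.exp (L * T) + momentConst L T * Q := by gcongr
    _ = weakConst L T * Q := by rw [weakConst]; ring

end

end WeakError

/-! ### Moments of the fast chain, bounds on schemes, and the limiting scheme. -/

section AbstractSchemes

variable {H : Type*} [NormedAddCommGroup H] [InnerProductSpace ℝ H] [CompleteSpace H]
  [MeasurableSpace H] [BorelSpace H] [SecondCountableTopology H]
  {F : H → H → H} {L : ℝ} {ν : Measure H} [IsProbabilityMeasure ν]
  {Ω : Type*} {m0 : MeasurableSpace Ω} {P : Measure Ω} [IsProbabilityMeasure P]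
  {ℱ : ℕ → MeasurableSpace Ω}

theorem LpBd.of_law {V : Ω → H} {p : ENNReal} {M : ℝ} (hV : AEStronglyMeasurable V P)
    (hlaw : P.map V = ν) (hν : LpBd ν p (fun y => y) M) : LpBd P p V M := by
  refine ⟨hV, ?_⟩
  have h := eLpNorm_map_measure (p := p) (g := fun y : H => y) (by fun_prop) hV.aemeasurable
  rw [hlaw] at h
  exact h.symm.trans_le hν.2

theorem LpBd.integral_norm_id_le {M : ℝ} (hM : 0 ≤ M) {p : ENNReal} (hp : 1 ≤ p)
    (hν : LpBd ν p (fun y => y) M) : ∫ z, ‖z‖ ∂ν ≤ M :=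
  (hν.of_le hp).integral_norm_le hM

theorem LpBd.norm_add_const {V : Ω → H} {p : ENNReal} (hp : 1 ≤ p) {c m : ℝ} (hc : 0 ≤ c)
    (hm : 0 ≤ m) (hV : LpBd P p V c) : LpBd P p (fun ω => ‖V ω‖ + m) (c + m) := by
  have h := LpBd.const (P := P) (p := p) m (by positivity)
  rw [Real.norm_of_nonneg hm] at h
  exact hV.norm.add h hp hc hm

section Autoregressive

variable {B : H →L[ℝ] H} {q : Measure H} {b : ℝ} {N : ℕ → Ω → H}

theorem autoregressive_adapted (hN : IsNoise P ℱ N q) {Y : ℕ → Ω → H} {y₀ : H}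
    (hY0 : ∀ ω, Y 0 ω = y₀) (hY : ∀ n ω, Y (n + 1) ω = B (Y n ω) + N n ω) (n : ℕ) :
    AEStronglyMeasurable[ℱ n] (Y n) P := by
  induction n with
  | zero =>
    rw [show Y 0 = fun _ => y₀ from funext hY0]
    exact aestronglyMeasurable_const
  | succ n ih =>
    rw [show Y (n + 1) = fun ω => B (Y n ω) + N n ω from funext (hY n)]
    exact (B.continuous.comp_aestronglyMeasurable
      (ih.mono (hN.mono (Nat.le_succ n)))).add (hN.adapted n)

/-- Iterating the invariance exhibits the law of the chain started from 0 as a convolution factor of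
`ν`, so its moments are bounded uniformly in `n` and in the step. -/
theorem autoregressive_conv (hN : IsNoise P ℱ N q) (hinv : ν.map B ∗ q = ν) {W : ℕ → Ω → H}
    (hW0 : ∀ ω, W 0 ω = 0) (hW : ∀ n ω, W (n + 1) ω = B (W n ω) + N n ω) (n : ℕ) :
    ν.map (B ^ n : H →L[ℝ] H) ∗ P.map (W n) = ν := by
  have := hN.isProbabilityMeasure
  induction n with
  | zero =>
    rw [show W 0 = fun _ => 0 from funext hW0, Measure.map_const]
    simp
  | succ n ih =>
    have hWa := autoregressive_adapted hN hW0 hW n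
    have hWm : AEMeasurable (W n) P := (hWa.mono (hN.le n)).aemeasurable
    have hBW : AEStronglyMeasurable[ℱ n] (fun ω => B (W n ω)) P :=
      B.continuous.comp_aestronglyMeasurable hWa
    have hlaw : P.map (W (n + 1)) = (P.map (W n)).map B ∗ q := by
      rw [show W (n + 1) = (fun ω => B (W n ω)) + N n from funext (hW n),
        IndepFun.map_add_eq_map_conv_map₀ (hBW.mono (hN.le n)).aemeasurable
        (hN.aestronglyMeasurable n).aemeasurable (hN.indepFun hBW), hN.law]
      congr 1
      exact (AEMeasurable.map_map_of_aemeasurable (by fun_prop) hWm).symm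
    have := Measure.isProbabilityMeasure_map hWm
    have hpow : ν.map (B ^ (n + 1) : H →L[ℝ] H) = (ν.map (B ^ n : H →L[ℝ] H)).map B := by
      rw [Measure.map_map (by fun_prop) (by fun_prop), pow_succ']
      rfl
    rw [hlaw, hpow, ← Measure.conv_assoc, ← Measure.map_conv_continuousLinearMap, ih, hinv]

/-- The chain splits as `(B ^ n) y₀` plus the chain started from 0. The decay `b ^ n` of the initial
layer is retained: summed over time, it contributes only order `ε`. -/
theorem autoregressive_lpBd (hN : IsNoise P ℱ N q) (hinv : ν.map B ∗ q = ν) (hB : ‖B‖ ≤ b)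
    (hb1 : b ≤ 1) {p : ENNReal} (hp : 1 ≤ p) {M : ℝ} (hM : 0 ≤ M) (hν : LpBd ν p (fun y => y) M)
    {Y : ℕ → Ω → H} {y₀ : H} (hY0 : ∀ ω, Y 0 ω = y₀)
    (hY : ∀ n ω, Y (n + 1) ω = B (Y n ω) + N n ω) (n : ℕ) :
    LpBd P p (Y n) (b ^ n * ‖y₀‖ + 2 * M) := by
  have hb : 0 ≤ b := (norm_nonneg _).trans hB
  let W : ℕ → Ω → H := fun n => Nat.rec (fun _ => 0) (fun n w ω => B (w ω) + N n ω) n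
  have hW0 : ∀ ω, W 0 ω = 0 := fun _ => rfl
  have hW : ∀ n ω, W (n + 1) ω = B (W n ω) + N n ω := fun _ _ => rfl
  have hWm : AEStronglyMeasurable (W n) P :=
    (autoregressive_adapted hN hW0 hW n).mono (hN.le n)
  have := Measure.isProbabilityMeasure_map hWm.aemeasurable
  have hpow : ‖B ^ n‖ ≤ 1 := (B ^ n).opNorm_le_bound zero_le_one fun x => by
    simpa using norm_pow_apply_le (hB.trans hb1) n x
  have h1 := LpBd.of_law hWm rfl (lpBd_of_conv_eq hpow (autoregressive_conv hN hinv hW0 hW n)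
    hp hM hν)
  have hYW : ∀ n ω, Y n ω = (B ^ n) y₀ + W n ω := by
    intro n ω
    induction n with
    | zero => simp [hY0, hW0]
    | succ n ih => rw [hY, ih, hW, pow_succ', map_add, add_assoc]; rfl
  have hc : ∀ n, ‖(B ^ n) y₀‖ ≤ b ^ n * ‖y₀‖ := by
    intro n
    induction n with
    | zero => simp
    | succ n ih =>
      rw [pow_succ', pow_succ', mul_assoc]
      exact (B.le_of_opNorm_le hB _).trans (mul_le_mul_of_nonneg_left ih hb)
  rw [show Y n = fun ω => (B ^ n) y₀ + W n ω from funext (hYW n)]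
  exact ((LpBd.const _ (by positivity)).mono (hc n)).add h1 hp (by positivity) (by positivity)

end Autoregressive

section Scheme

variable {A : H →L[ℝ] H} {Δ T : ℝ} {N : ℕ}

theorem scheme_lpBd (hL : 0 ≤ L) (hA : ‖A‖ ≤ 1) (hΔ : 0 ≤ Δ) (hT : N * Δ = T) {p : ENNReal}
    (hp : 1 ≤ p) {X f : ℕ → Ω → H} {g : ℕ → Ω → ℝ} {x₀ : H} {χ γ : ℝ} (hγ : 0 ≤ γ)
    (hX0 : ∀ ω, X 0 ω = x₀) (hχ : ‖x₀‖ ≤ χ) (hXm : ∀ n, AEStronglyMeasurable (X n) P)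
    (hX : ∀ n ω, X (n + 1) ω = A (X n ω + Δ • f n ω))
    (hf : ∀ n ω, ‖f n ω‖ ≤ L * ‖X n ω‖ + g n ω) (hg : ∀ n, LpBd P p (g n) γ) {n : ℕ}
    (hn : n ≤ N) : LpBd P p (X n) (Real.exp (L * T) * (χ + T * γ)) := by
  have hT0 : 0 ≤ T := by rw [← hT]; positivity
  have hχ0 : 0 ≤ χ := (norm_nonneg _).trans hχ
  have hX0b : LpBd P p (X 0) χ := by
    rw [show X 0 = fun _ => x₀ from funext hX0]
    exact (LpBd.const _ (by positivity)).mono hχ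
  refine (LpBd.gronwall (c := fun _ => Δ * γ) (a := Δ * L) hp (by positivity) hχ0
    (fun _ => by positivity) hXm hX0b (fun n => (hg n).const_mul hΔ) (fun n ω => ?_) n).mono ?_
  · rw [hX]
    refine (A.le_of_opNorm_le hA _).trans ?_
    rw [one_mul]
    refine (norm_add_le _ _).trans ?_
    rw [norm_smul, Real.norm_of_nonneg hΔ]
    have := mul_le_mul_of_nonneg_left (hf n ω) hΔ
    linarith
  · have h1 : (n : ℝ) * Δ ≤ T := by rw [← hT]; gcongr
    have h2 : Δ * L * n ≤ L * T := by
      calc Δ * L * n = L * (n * Δ) := by ring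
        _ ≤ _ := by gcongr
    rw [Finset.sum_const, Finset.card_range, nsmul_eq_mul, ← mul_assoc]
    gcongr

theorem scheme_increment_lpBd (hL : 0 ≤ L) (hA : ‖A‖ ≤ 1)
    (hA' : ∀ n : ℕ, ‖A ^ n * (1 - A)‖ ≤ ((n : ℝ) + 1)⁻¹) (hΔ : 0 ≤ Δ) (hT : N * Δ = T)
    {p : ENNReal} (hp : 1 ≤ p) {X f : ℕ → Ω → H} {g : ℕ → Ω → ℝ} {x₀ : H} {χ γ : ℝ} (hγ : 0 ≤ γ)
    (hX0 : ∀ ω, X 0 ω = x₀) (hχ : ‖x₀‖ ≤ χ) (hXm : ∀ n, AEStronglyMeasurable (X n) P)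
    (hX : ∀ n ω, X (n + 1) ω = A (X n ω + Δ • f n ω))
    (hfm : ∀ n, AEStronglyMeasurable (f n) P)
    (hf : ∀ n ω, ‖f n ω‖ ≤ L * ‖X n ω‖ + g n ω) (hg : ∀ n, LpBd P p (g n) γ) {n : ℕ}
    (hn : n < N) : LpBd P p (fun ω => X (n + 1) ω - X n ω)
      (((n : ℝ) + 1)⁻¹ * χ + Δ * (L * (Real.exp (L * T) * (χ + T * γ)) + γ) * harm N) := by
  have hT0 : 0 ≤ T := by rw [← hT]; positivity
  have hχ0 : 0 ≤ χ := (norm_nonneg _).trans hχ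
  refine (LpBd.increment (c := L * (Real.exp (L * T) * (χ + T * γ)) + γ) hΔ hA hA' hp hX0 hX hXm
    (by positivity) n fun k hk => ?_).mono ?_
  · exact (((scheme_lpBd hL hA hΔ hT hp hγ hX0 hχ hXm hX hf hg
      (hk.trans hn.le)).norm.const_mul hL).add (hg k) hp (by positivity) hγ).mono_real (hfm k) (hf k)
  · have := harm_mono hn
    gcongr

/-- The terms `1 / (k + 1)` from the initial value add up to `harm N`, and the `n ≤ N` forcing
terms, of total weight `n * Δ ≤ T`, cost one further `harm N`: one logarithm in all. -/
theorem sum_increment_le {χ Φ : ℝ} (hΦ : 0 ≤ Φ) (hΔ : 0 ≤ Δ) (hT : N * Δ = T)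
    (hχ : 0 ≤ χ) {n : ℕ} (hn : n ≤ N) :
    ∑ k ∈ Finset.range n, (((k : ℝ) + 1)⁻¹ * χ + Δ * Φ * harm N) ≤ (χ + T * Φ) * harm N := by
  rw [Finset.sum_add_distrib, ← Finset.sum_mul, Finset.sum_const, Finset.card_range, nsmul_eq_mul]
  have h1 : (∑ k ∈ Finset.range n, ((k : ℝ) + 1)⁻¹) ≤ harm N := harm_mono hn
  have h2 : (n : ℝ) * Δ ≤ T := by rw [← hT]; gcongr
  have h3 := harm_nonneg N
  calc (∑ k ∈ Finset.range n, ((k : ℝ) + 1)⁻¹) * χ + n * (Δ * Φ * harm N)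
      ≤ harm N * χ + T * (Φ * harm N) := by
        refine add_le_add (by gcongr) ?_
        calc (n : ℝ) * (Δ * Φ * harm N) = (n * Δ) * (Φ * harm N) := by ring
          _ ≤ _ := by gcongr
    _ = _ := by ring

end Scheme

section Limit

variable {A : H →L[ℝ] H} {Δ T : ℝ} {N : ℕ}

/-- The noise has law exactly `ν`, so freezing the past leaves the integral of a centred function.
-/
theorem integral_inner_fluctuation_eq_zero (hF : IsCoefficient F L)
    (hν : Integrable (fun y => y) ν) {V : ℕ → Ω → H} (hV : IsNoise P ℱ V ν) {n : ℕ}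
    {X Z : Ω → H} (hX : AEStronglyMeasurable[ℱ n] X P) (hZ : AEStronglyMeasurable[ℱ n] Z P)
    (hZ2 : MemLp Z 2 P) (hV2 : MemLp (V n) 2 P) :
    ∫ ω, ⟪Z ω, fluctuation F ν (X ω) (V n ω)⟫_ℝ ∂P = 0 := by
  have hg : Continuous fun p : (H × H) × H => ⟪p.1.1, fluctuation F ν p.1.2 p.2⟫_ℝ :=
    (by fun_prop : Continuous fun p : (H × H) × H => p.1.1).inner
      ((hF.continuous_fluctuation hν).comp
        (by fun_prop : Continuous fun p : (H × H) × H => (p.1.2, p.2)))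
  have hV1 := (MemLp.lpBd hV2).norm_add_const one_le_two_ennreal ENNReal.toReal_nonneg
    (integral_nonneg (μ := ν) fun z => norm_nonneg z)
  have hint : Integrable (fun ω => ⟪Z ω, fluctuation F ν (X ω) (V n ω)⟫_ℝ) P :=
    integrable_inner hZ2 (lpBd_fluctuation hF hν (hX.mono (hV.le n)) hV2.1 hV1).memLp
  have h := hV.integral_comp (hZ.prodMk hX) hg hint
  refine h.trans ?_
  have h0 : ∀ ω, ∫ w, ⟪Z ω, fluctuation F ν (X ω) w⟫_ℝ ∂ν = 0 := fun ω => by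
    rw [integral_inner (integrable_of_lip hν (hF.isCenteredLip hν (X ω)).lip),
      (hF.isCenteredLip hν (X ω)).centered, inner_zero_right]
  simp [h0]

/-- Both fluctuation sums vanish and the initial values agree, hence `d = δ = 0`; only the variance
term `Δ * v ^ 2`, with `v = 2 * M`, remains. -/
theorem limiting_weak_error (hF : IsCoefficient F L) {M : ℝ} (hM : 0 ≤ M)
    (hν : LpBd ν 4 (fun y => y) M) (hA : ‖A‖ ≤ 1) (hΔ : 0 < Δ) (hN : 1 ≤ N) (hT : N * Δ = T)
    {X V : ℕ → Ω → H} {xb : ℕ → H} (hV : IsNoise P ℱ V ν) (hX0 : ∀ ω, X 0 ω = xb 0)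
    (hX : ∀ n ω, X (n + 1) ω = A (X n ω + Δ • F (X n ω) (V n ω)))
    (hxb : ∀ n, xb (n + 1) = A (xb n + Δ • average F ν (xb n)))
    {φ : H → ℝ} {K : ℝ} (hφ : IsTestFunction φ K) :
    Integrable (fun ω => φ (X N ω)) P ∧
      |(∫ ω, φ (X N ω) ∂P) - φ (xb N)| ≤ K * (weakConst L T * (Δ * (2 * M) ^ 2)) := by
  have hν1 : Integrable (fun y => y) ν := (hν.of_le one_le_four_ennreal).integrable
  have hVm := hV.aestronglyMeasurable
  have hV2 : ∀ n, LpBd P 2 (V n) M := fun n =>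
    (LpBd.of_law (hVm n) (hV.law n) hν).of_le two_le_four_ennreal
  have hm0 : 0 ≤ ∫ z, ‖z‖ ∂ν := integral_nonneg fun z => norm_nonneg z
  have hm := LpBd.integral_norm_id_le hM one_le_four_ennreal hν
  have hVb : ∀ n, LpBd P 2 (fun ω => ‖V n ω‖ + ∫ z, ‖z‖ ∂ν) (2 * M) := fun n =>
    ((hV2 n).norm_add_const one_le_two_ennreal hM hm0).mono (by linarith)
  have hXa : ∀ n, AEStronglyMeasurable[ℱ n] (X n) P := by
    intro n
    induction n with
    | zero =>
      rw [show X 0 = fun _ => xb 0 from funext hX0]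
      exact aestronglyMeasurable_const
    | succ n ih =>
      have ih' := ih.mono (hV.mono (Nat.le_succ n))
      rw [show X (n + 1) = _ from funext (hX n)]
      exact A.continuous.comp_aestronglyMeasurable (ih'.add
        ((hF.continuous_uncurry.comp_aestronglyMeasurable
          (ih'.prodMk (hV.adapted n))).const_smul Δ))
  have hXm : ∀ n, AEStronglyMeasurable (X n) P := fun n => (hXa n).mono (hV.le n)
  have hX2 : ∀ n, MemLp (X n) 2 P := fun n => by
    -- Square integrability is wanted for every `n`, so the horizon is taken to be `n * Δ`.
    refine (scheme_lpBd (N := n) (T := n * Δ) (f := fun n ω => F (X n ω) (V n ω))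
      (g := fun n ω => L * (‖V n ω‖) + ‖F 0 0‖) (γ := L * M + ‖F 0 0‖)
      hF.nonneg hA hΔ.le rfl one_le_two_ennreal
      (add_nonneg (mul_nonneg hF.nonneg hM) (norm_nonneg _)) hX0 le_rfl hXm hX
      (fun n ω => ?_) (fun n => ?_) le_rfl).memLp
    · have := hF.norm_le (X n ω) (V n ω)
      linarith
    · have h := LpBd.const (P := P) (p := 2) ‖F 0 0‖ (by norm_num)
      rw [norm_norm] at h
      exact ((hV2 n).norm.const_mul hF.nonneg).add h one_le_two_ennreal
        (mul_nonneg hF.nonneg hM) (norm_nonneg _)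
  have hD : ∀ n, ∀ z : ℕ → H, ∫ ω, ⟪X n ω - z n, fluctuation F ν (X n ω) (V n ω)⟫_ℝ ∂P = 0 :=
    fun n z => integral_inner_fluctuation_eq_zero hF hν1 hV (hXa n)
      ((hXa n).sub aestronglyMeasurable_const) ((hX2 n).sub (memLp_const _)) (hV2 n).memLp
  have hC : ∀ n, ∀ z : H, ∫ ω, ⟪z, fluctuation F ν (X n ω) (V n ω)⟫_ℝ ∂P = 0 :=
    fun n z => integral_inner_fluctuation_eq_zero hF hν1 hV (hXa n)
      aestronglyMeasurable_const (memLp_const _) (hV2 n).memLp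
  refine ⟨hφ.integrable ((hX2 N).integrable one_le_two_ennreal), ?_⟩
  have h := weak_error_of_averaging (d := 0) (δ := 0) hF hν1 hA hΔ hN hT (by simp [hX0]) hX hxb hX2
    hVm (by positivity) hVb le_rfl (fun n _ => by simp [hD]) (fun n _ h => by simp [hC]) hφ
  simpa using h

end Limit

end AbstractSchemes

/-! ### Weak error of the slow component. -/

section SlowAbstract

variable {H : Type*} [NormedAddCommGroup H] [InnerProductSpace ℝ H] [CompleteSpace H]
  [MeasurableSpace H] [BorelSpace H] [SecondCountableTopology H]
  {F : H → H → H} {L : ℝ} {ν : Measure H} [IsProbabilityMeasure ν]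
  {Ω : Type*} {m0 : MeasurableSpace Ω} {P : Measure Ω} [IsProbabilityMeasure P]
  {ℱ : ℕ → MeasurableSpace Ω}

theorem norm_adjoint_apply_le {A : H →L[ℝ] H} {a : ℝ} (hA : ‖A‖ ≤ a) (x : H) :
    ‖ContinuousLinearMap.adjoint A x‖ ≤ a * ‖x‖ :=
  (ContinuousLinearMap.adjoint A).le_of_opNorm_le
    (by rwa [LinearIsometryEquiv.norm_map]) x

theorem norm_pow_le_one {A : H →L[ℝ] H} (hA : ‖A‖ ≤ 1) (n : ℕ) : ‖A ^ n‖ ≤ 1 :=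
  (A ^ n).opNorm_le_bound zero_le_one fun x => by simpa using norm_pow_apply_le hA n x

variable {B : H →L[ℝ] H} {q : Measure H} {b : ℝ} {A : H →L[ℝ] H} {Δ : ℝ}

/-- The averaging estimate with deterministic weights `(A ^ (n - k))* h`. Their increments are
bounded by `‖h‖ / (n - k)`, again by smoothing, whence the term `harm n`. -/
theorem abs_sum_integral_adjoint_fluctuation_le (hF : IsCoefficient F L)
    (hν : Integrable (fun y => y) ν) (hq : Integrable (fun y => y) q) (hinv : ν.map B ∗ q = ν)
    (hB : ‖B‖ ≤ b) (hb1 : b < 1) {W : ℕ → Ω → H} (hW : IsNoise P ℱ W q) {X Y : ℕ → Ω → H}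
    (hY : ∀ n ω, Y (n + 1) ω = B (Y n ω) + W n ω)
    (hXm : ∀ n, AEStronglyMeasurable[ℱ n] (X n) P) (hYm : ∀ n, AEStronglyMeasurable[ℱ n] (Y n) P)
    (hA : ‖A‖ ≤ 1) (hA' : ∀ n : ℕ, ‖A ^ n * (1 - A)‖ ≤ ((n : ℝ) + 1)⁻¹)
    {n : ℕ} {y : ℝ} {β : ℕ → ℝ} (hy : 0 ≤ y) (hβ : ∀ k, 0 ≤ β k)
    (hX' : ∀ k < n, LpBd P 2 (fun ω => X (k + 1) ω - X k ω) (β k))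
    (hYb : ∀ k, LpBd P 4 (fun ω => ‖Y k ω‖ + ∫ z, ‖z‖ ∂ν) y) (h : H) :
    |∑ k ∈ Finset.range n, ∫ ω, ⟪ContinuousLinearMap.adjoint (A ^ (n - k)) h,
        fluctuation F ν (X k ω) (Y (k + 1) ω)⟫_ℝ ∂P|
      ≤ L * (1 - b)⁻¹ * ((2 + harm n + ∑ k ∈ Finset.range n, β k) * y * ‖h‖) := by
  have := hW.isProbabilityMeasure
  refine (abs_sum_integral_inner_fluctuation_le (n := n) (ζ := ‖h‖)
    (Z := fun k _ => ContinuousLinearMap.adjoint (A ^ (n - k)) h)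
    (η := fun k => (((n - (k + 1) : ℕ) : ℝ) + 1)⁻¹ * ‖h‖) hF hν hq hinv hB hb1 hW hY hXm hYm
    (fun _ => aestronglyMeasurable_const) (norm_nonneg _) hy (fun k => by positivity) hβ
    (fun k _ => ?_) (fun k hk => ?_) hX' hYb).trans (le_of_eq ?_)
  · refine (LpBd.const _ (by norm_num)).mono ?_
    simpa using norm_adjoint_apply_le (norm_pow_le_one hA (n - k)) h
  · refine (LpBd.const _ (by norm_num)).mono ?_
    refine le_of_eq_of_le (congrArg _ ?_) (norm_adjoint_apply_le (hA' (n - (k + 1))) h)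
    rw [mul_sub, mul_one, ← pow_succ, show n - (k + 1) + 1 = n - k by omega, map_sub]
    rfl
  · congr 1
    rw [harm_eq_sum_reflect, ← Finset.sum_mul, Finset.sum_add_distrib, ← Finset.sum_mul,
      ← Finset.mul_sum]
    ring

/-- Bound for the increments of the schemes. -/
noncomputable def incrementConst (L T M c f₀ : ℝ) : ℝ :=
  c + T * (L * (Real.exp (L * T) * (c + T * (L * (c + 3 * M) + f₀))) + (L * (c + 3 * M) + f₀))

/-- Bound for the fourth moments of the deviation. -/
noncomputable def deviationConst (L T M c : ℝ) : ℝ :=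
  Real.exp (L * T) * (c + L * (c ^ 2 + 3 * M * T))

/-- The constant in the bounds for the sums of fluctuations. -/
noncomputable def averagingConst (L T M c f₀ : ℝ) : ℝ :=
  L * c * ((c + 3 * M) * (4 * deviationConst L T M c + 3
    + (2 + 2 * deviationConst L T M c) * incrementConst L T M c f₀))

/-- The constant of the weak error estimate for the slow component. -/
noncomputable def slowConst (L T M c f₀ : ℝ) : ℝ :=
  2 * deviationConst L T M c
    + weakConst L T * (c + c ^ 3 + averagingConst L T M c f₀ + (c + 3 * M) ^ 2)

-- The size of the initial data enters through `ρ`, and growth no faster than `ρ ^ 2` is required.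
-- Moments of `Y` and increments of `X` each cost one factor `ρ`, so the deviation used as a weight
-- must be bounded independently of `ρ`. This holds when `ε * ρ ≤ 1`; otherwise the crude Lipschitz
-- bound is already of the right order.
set_option maxHeartbeats 1000000 in
theorem slow_weak_error (hF : IsCoefficient F L) {M : ℝ} (hM : 0 ≤ M)
    (hν : LpBd ν 4 (fun y => y) M) {W : ℕ → Ω → H} (hW : IsNoise P ℱ W q)
    (hinv : ν.map B ∗ q = ν) (hB : ‖B‖ ≤ b) (hb1 : b < 1) (hA : ‖A‖ ≤ 1)
    (hA' : ∀ n : ℕ, ‖A ^ n * (1 - A)‖ ≤ ((n : ℝ) + 1)⁻¹) (hΔ : 0 < Δ) {N : ℕ} {T : ℝ}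
    (hN : 1 ≤ N) (hT : N * Δ = T) {X Y : ℕ → Ω → H} {xb : ℕ → H} {x₀ y₀ : H}
    (hX0 : ∀ ω, X 0 ω = x₀) (hY0 : ∀ ω, Y 0 ω = y₀)
    (hY : ∀ n ω, Y (n + 1) ω = B (Y n ω) + W n ω)
    (hX : ∀ n ω, X (n + 1) ω = A (X n ω + Δ • F (X n ω) (Y (n + 1) ω)))
    (hxb : ∀ n, xb (n + 1) = A (xb n + Δ • average F ν (xb n)))
    {c ρ ε : ℝ} (hc : 1 ≤ c) (hρ : 1 ≤ ρ) (hε : 0 < ε) (hεc : ε ≤ c)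
    (hx₀ : ‖x₀‖ ≤ c * ρ) (hy₀ : ‖y₀‖ ≤ c * ρ) (hxb0 : ‖xb 0‖ ≤ c * ρ)
    (hd : ‖x₀ - xb 0‖ ≤ c * ε * ρ) (hbΔ : Δ * (1 - b)⁻¹ ≤ c * (Δ + ε))
    (hbε : Δ * (b * (1 - b)⁻¹) ≤ c * ε) {φ : H → ℝ} {K : ℝ} (hφ : IsTestFunction φ K) :
    Integrable (fun ω => φ (X N ω)) P ∧
      |(∫ ω, φ (X N ω) ∂P) - φ (xb N)|
        ≤ K * (slowConst L T M c ‖F 0 0‖ * ((Δ + ε) * harm N * ρ ^ 2)) := by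
  have hL := hF.nonneg
  have hb0 : 0 ≤ b := (norm_nonneg _).trans hB
  have hT0 : 0 ≤ T := by rw [← hT]; positivity
  have hν1 : Integrable (fun y => y) ν := (hν.of_le one_le_four_ennreal).integrable
  have := hW.isProbabilityMeasure
  have hq4 : LpBd q 4 (fun y => y) (2 * M) :=
    lpBd_of_conv_eq (hB.trans hb1.le) hinv one_le_four_ennreal hM hν
  have hq : Integrable (fun y => y) q := (hq4.of_le one_le_four_ennreal).integrable
  have hm0 : 0 ≤ ∫ z, ‖z‖ ∂ν := integral_nonneg fun z => norm_nonneg z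
  have hm := LpBd.integral_norm_id_le hM one_le_four_ennreal hν
  set f₀ := ‖F 0 0‖ with hf₀
  have hf₀0 : 0 ≤ f₀ := norm_nonneg _
  -- the fast component
  have hYa := autoregressive_adapted hW hY0 hY
  have hYm : ∀ n, AEStronglyMeasurable (Y n) P := fun n => (hYa n).mono (hW.le n)
  have hYr : ∀ n, LpBd P 4 (fun ω => ‖Y n ω‖ + ∫ z, ‖z‖ ∂ν) (b ^ n * ‖y₀‖ + 3 * M) := fun n =>
    ((autoregressive_lpBd hW hinv hB hb1.le one_le_four_ennreal hM hν hY0 hY n).norm_add_const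
      one_le_four_ennreal (by positivity) hm0).mono (by linarith)
  set y := (c + 3 * M) * ρ with hy
  have hy0 : 0 ≤ y := by positivity
  have hYb : ∀ n, LpBd P 4 (fun ω => ‖Y n ω‖ + ∫ z, ‖z‖ ∂ν) y := fun n => by
    refine (hYr n).mono ?_
    have h1 : b ^ n * ‖y₀‖ ≤ 1 * (c * ρ) := by
      gcongr
      exact pow_le_one₀ hb0 hb1.le
    have h2 : 3 * M ≤ 3 * M * ρ := le_mul_of_one_le_right (by positivity) hρ
    rw [hy]
    linarith
  -- the slow component
  have hXa : ∀ n, AEStronglyMeasurable[ℱ n] (X n) P := by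
    intro n
    induction n with
    | zero =>
      rw [show X 0 = fun _ => x₀ from funext hX0]
      exact aestronglyMeasurable_const
    | succ n ih =>
      have ih' := ih.mono (hW.mono (Nat.le_succ n))
      rw [show X (n + 1) = _ from funext (hX n)]
      exact A.continuous.comp_aestronglyMeasurable (ih'.add
        ((hF.continuous_uncurry.comp_aestronglyMeasurable
          (ih'.prodMk (hYa (n + 1)))).const_smul Δ))
  have hXm : ∀ n, AEStronglyMeasurable (X n) P := fun n => (hXa n).mono (hW.le n)
  set γ := (L * (c + 3 * M) + f₀) * ρ with hγ
  have hγ0 : 0 ≤ γ := by positivity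
  have hgen : ∀ (V : ℕ → Ω → H), (∀ n, LpBd P 4 (fun ω => ‖V n ω‖ + ∫ z, ‖z‖ ∂ν) y) →
      ∀ n, LpBd P 4 (fun ω => L * (‖V n ω‖ + ∫ z, ‖z‖ ∂ν) + f₀) γ := fun V hV n => by
    have h := LpBd.const (P := P) (p := 4) ‖F 0 0‖ (by norm_num)
    rw [norm_norm] at h
    refine (((hV n).const_mul hL).add h one_le_four_ennreal (by positivity) hf₀0).mono ?_
    have h1 : f₀ ≤ f₀ * ρ := le_mul_of_one_le_right hf₀0 hρ
    rw [hγ, hy]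
    linarith
  have hFb : ∀ n ω, ‖F (X n ω) (Y (n + 1) ω)‖
      ≤ L * ‖X n ω‖ + (L * (‖Y (n + 1) ω‖ + ∫ z, ‖z‖ ∂ν) + f₀) := fun n ω => by
    have h1 := hF.norm_le (X n ω) (Y (n + 1) ω)
    have h2 := mul_nonneg hL hm0
    linarith
  have hFm : ∀ n, AEStronglyMeasurable (fun ω => F (X n ω) (Y (n + 1) ω)) P := fun n =>
    hF.continuous_uncurry.comp_aestronglyMeasurable ((hXm n).prodMk (hYm (n + 1)))
  have hg1 := hgen (fun n => Y (n + 1)) fun n => hYb (n + 1)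
  have hXn : ∀ n, MemLp (X n) 4 P := fun n =>
    (scheme_lpBd (N := n) (T := n * Δ) hL hA hΔ.le rfl one_le_four_ennreal hγ0 hX0 le_rfl hXm hX hFb
      hg1 le_rfl).memLp
  have hX2 : ∀ n, MemLp (X n) 2 P := fun n => (hXn n).mono_exponent two_le_four_ennreal
  refine ⟨hφ.integrable ((hX2 N).integrable one_le_two_ennreal), ?_⟩
  set χ := c * ρ with hχ
  set Φ := L * (Real.exp (L * T) * (χ + T * γ)) + γ with hΦ
  have hχ0 : 0 ≤ χ := by positivity
  have hΦ0 : 0 ≤ Φ := by positivity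
  set β : ℕ → ℝ := fun k => ((k : ℝ) + 1)⁻¹ * χ + Δ * Φ * harm N with hβ
  have hβ0 : ∀ k, 0 ≤ β k := fun k => by have := harm_nonneg N; positivity
  have hXinc : ∀ n < N, LpBd P 2 (fun ω => X (n + 1) ω - X n ω) (β n) := fun n hn =>
    (scheme_increment_lpBd hL hA hA' hΔ.le hT one_le_four_ennreal hγ0 hX0 hx₀ hXm hX hFm hFb hg1
      hn).of_le two_le_four_ennreal
  have hxinc : ∀ n < N, LpBd P 2 (fun _ : Ω => xb (n + 1) - xb n) (β n) := fun n hn => by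
    refine (scheme_increment_lpBd (X := fun n _ => xb n) (f := fun n _ => average F ν (xb n))
      (g := fun _ _ => γ) hL hA hA' hΔ.le hT one_le_four_ennreal hγ0
      (fun _ => rfl) hxb0 (fun _ => aestronglyMeasurable_const) (fun n _ => hxb n)
      (fun _ => aestronglyMeasurable_const) (fun n _ => ?_) (fun _ => ?_) hn).of_le
      two_le_four_ennreal
    · have h1 : ‖average F ν (xb n)‖ ≤ ∫ z, (L * ‖xb n‖ + f₀ + L * ‖z‖) ∂ν :=
        norm_integral_le_of_norm_le ((integrable_const _).add (hν1.norm.const_mul L))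
          (ae_of_all _ fun z => by have := hF.norm_le (xb n) z; linarith)
      rw [integral_add (integrable_const _) (hν1.norm.const_mul L), integral_const_mul] at h1
      simp only [integral_const, probReal_univ, one_smul] at h1
      have h2 : L * ∫ z, ‖z‖ ∂ν ≤ L * M := by gcongr
      have h3 : (L * M + f₀) * 1 ≤ (L * (c + 3 * M) + f₀) * ρ := by
        gcongr
        linarith
      linarith
    · have h := LpBd.const (P := P) (p := 4) γ (by norm_num)
      rwa [Real.norm_of_nonneg hγ0] at h
  have hχΦ : χ + T * Φ = incrementConst L T M c f₀ * ρ := by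
    rw [hΦ, hχ, hγ, incrementConst]; ring
  have hI0 : 0 ≤ incrementConst L T M c f₀ := by unfold incrementConst; positivity
  set I := incrementConst L T M c f₀ with hI
  set h_N := harm N with hh
  have hh1 : 1 ≤ h_N := one_le_harm hN
  have hβs : ∀ n ≤ N, ∑ k ∈ Finset.range n, β k ≤ I * ρ * h_N := fun n hn => by
    rw [← hχΦ]; exact sum_increment_le hΦ0 hΔ.le hT hχ0 hn
  -- the deviation
  set D : ℕ → Ω → H := fun n ω => X n ω - xb n with hD
  have hDa : ∀ n, AEStronglyMeasurable[ℱ n] (D n) P := fun n =>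
    (hXa n).sub aestronglyMeasurable_const
  have hDm : ∀ n, AEStronglyMeasurable (D n) P := fun n => (hDa n).mono (hW.le n)
  set Z := deviationConst L T M c with hZ
  have hZ0 : 0 ≤ Z := by rw [hZ, deviationConst]; positivity
  -- The data enter the deviation only through `ε * ρ`: the initial gap is at most `c * ε * ρ`, and
  -- the initial layer of `Y` sums to `Δ * ∑ b ^ (k + 1) * ‖y₀‖ ≤ c ^ 2 * ε * ρ`. The stationary
  -- part is bounded independently of `ρ`.
  have hD4 : ∀ n ≤ N, LpBd P 4 (D n) (Z * (1 + ε * ρ)) := by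
    intro n hn
    have hD0 : LpBd P 4 (D 0) (c * ε * ρ) := by
      rw [show D 0 = fun _ => x₀ - xb 0 from funext fun ω => by simp [hD, hX0]]
      exact (LpBd.const _ (by norm_num)).mono hd
    have hstep : ∀ n ω, ‖D (n + 1) ω‖ ≤ (1 + Δ * L) * ‖D n ω‖
        + Δ * L * (‖Y (n + 1) ω‖ + ∫ z, ‖z‖ ∂ν) := fun n ω => by
      have e1 : D (n + 1) ω = A (D n ω + Δ • ((average F ν (X n ω) - average F ν (xb n))
          + fluctuation F ν (X n ω) (Y (n + 1) ω))) := by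
        simp only [hD, hX, hxb, fluctuation, ← map_sub]
        congr 1
        rw [add_sub_add_comm, ← smul_sub]
        congr 2
        abel
      rw [e1]
      refine (A.le_of_opNorm_le hA _).trans ?_
      rw [one_mul]
      refine (norm_add_le _ _).trans ?_
      rw [norm_smul, Real.norm_of_nonneg hΔ.le]
      have h1 := (norm_add_le (average F ν (X n ω) - average F ν (xb n))
        (fluctuation F ν (X n ω) (Y (n + 1) ω))).trans (add_le_add (hF.average_lip hν1 _ _)
          (hF.norm_fluctuation_le hν1 _ _))
      have h2 := mul_le_mul_of_nonneg_left h1 hΔ.le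
      simp only [hD] at h2 ⊢
      linarith
    refine (LpBd.gronwall (a := Δ * L) one_le_four_ennreal (by positivity) (by positivity)
      (fun n => by positivity) hDm hD0 (fun n => (hYr (n + 1)).const_mul (a := Δ * L)
        (by positivity)) hstep n).mono ?_
    have h1 : (n : ℝ) * Δ ≤ T := by rw [← hT]; gcongr
    have h2 : Δ * L * n ≤ L * T := by
      calc Δ * L * n = L * (n * Δ) := by ring
        _ ≤ _ := by gcongr
    have h3 : ∑ k ∈ Finset.range n, b ^ (k + 1) ≤ b * (1 - b)⁻¹ := by
      simp only [pow_succ', ← Finset.mul_sum]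
      refine mul_le_mul_of_nonneg_left ?_ hb0
      rw [← tsum_geometric_of_lt_one hb0 hb1]
      exact (summable_geometric_of_lt_one hb0 hb1).sum_le_tsum _ fun _ _ => by positivity
    have h4 : ∑ k ∈ Finset.range n, Δ * L * (b ^ (k + 1) * ‖y₀‖ + 3 * M)
        ≤ L * (c ^ 2 * (ε * ρ) + 3 * M * T) := by
      rw [← Finset.mul_sum, Finset.sum_add_distrib, ← Finset.sum_mul, Finset.sum_const,
        Finset.card_range, nsmul_eq_mul]
      have h5 : Δ * (∑ k ∈ Finset.range n, b ^ (k + 1)) * ‖y₀‖ ≤ c * ε * (c * ρ) := by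
        refine mul_le_mul ((mul_le_mul_of_nonneg_left h3 hΔ.le).trans hbε) hy₀ (norm_nonneg _)
          (by positivity)
      have h6 : (n : ℝ) * Δ * (3 * M) ≤ T * (3 * M) := by gcongr
      calc Δ * L * ((∑ k ∈ Finset.range n, b ^ (k + 1)) * ‖y₀‖ + n * (3 * M))
          = L * (Δ * (∑ k ∈ Finset.range n, b ^ (k + 1)) * ‖y₀‖ + n * Δ * (3 * M)) := by ring
        _ ≤ L * (c * ε * (c * ρ) + T * (3 * M)) := by gcongr
        _ = _ := by ring
    calc Real.exp (Δ * L * n) * (c * ε * ρ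
          + ∑ k ∈ Finset.range n, Δ * L * (b ^ (k + 1) * ‖y₀‖ + 3 * M))
        ≤ Real.exp (L * T) * (c * ε * ρ + L * (c ^ 2 * (ε * ρ) + 3 * M * T)) := by gcongr
      -- The added nonnegative terms are those missing from the product `Z * (1 + ε * ρ)`.
      _ ≤ Real.exp (L * T) * (c * ε * ρ + L * (c ^ 2 * (ε * ρ) + 3 * M * T)
          + (c + L * 3 * M * T * (ε * ρ) + L * c ^ 2)) :=
        mul_le_mul_of_nonneg_left (le_add_of_nonneg_right (by positivity)) (Real.exp_pos _).le
      _ = Z * (1 + ε * ρ) := by rw [hZ, deviationConst]; ring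
  have hwc : 0 ≤ weakConst L T := by
    have := momentConst_nonneg (L := L) hT0
    unfold weakConst; positivity
  set a := averagingConst L T M c f₀ with ha
  have ha0 : 0 ≤ a := by rw [ha, averagingConst, ← hZ, ← hI]; positivity
  set E := (Δ + ε) * h_N * ρ ^ 2 with hE
  have hερ : ε * ρ ≤ E := by
    rw [hE]
    calc ε * ρ = ε * 1 * (ρ * 1) := by ring
      _ ≤ (Δ + ε) * h_N * (ρ * ρ) := by gcongr; linarith
      _ = _ := by ring
  have hE0 : 0 ≤ E := by positivity
  -- For `ε * ρ > 1` one has `1 + ε * ρ ≤ 2 * ε * ρ ≤ 2 * E`, and no averaging is needed. For `ε * ρ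
  -- ≤ 1` the deviation is at most `2 * Z` in `L^4`.
  rcases le_or_gt (ε * ρ) 1 with hcase | hcase
  swap
  · refine (hφ.abs_integral_sub_le_of_lpBd (by positivity)
      ((hD4 N le_rfl).of_le one_le_four_ennreal)).trans
      (mul_le_mul_of_nonneg_left ?_ hφ.nonneg)
    calc Z * (1 + ε * ρ) ≤ Z * (2 * E) := by gcongr; linarith
      _ ≤ slowConst L T M c f₀ * E := by
        rw [slowConst, ← hZ, ← ha, add_mul]
        have : 0 ≤ weakConst L T * (c + c ^ 3 + a + (c + 3 * M) ^ 2) * E := by positivity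
        linarith
  · have hD4' : ∀ n ≤ N, LpBd P 4 (D n) (2 * Z) := fun n hn =>
      (hD4 n hn).mono (by linarith [mul_le_mul_of_nonneg_left hcase hZ0])
    have hcΔ : 0 ≤ Δ * (L * (1 - b)⁻¹) := by
      have : 0 ≤ (1 - b)⁻¹ := by rw [inv_nonneg]; linarith
      positivity
    have hcΔ' : Δ * (L * (1 - b)⁻¹) ≤ L * c * (Δ + ε) := by
      have := mul_le_mul_of_nonneg_left hbΔ hL
      linarith
    have hρh : 1 ≤ ρ * h_N := one_le_mul_of_one_le_of_one_le hρ hh1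
    have hh0 : 0 ≤ h_N := by linarith
    have hH1 : ∀ n ≤ N, Δ * |∑ k ∈ Finset.range n,
        ∫ ω, ⟪X k ω - xb k, fluctuation F ν (X k ω) (Y (k + 1) ω)⟫_ℝ ∂P| ≤ a * E := by
      intro n hn
      have h1 := abs_sum_integral_inner_fluctuation_le (Z := D) (ζ := 2 * Z) (n := n)
        (η := fun k => β k + β k) hF hν1 hq hinv hB hb1 hW hY hXa hYa hDa (by positivity) hy0
        (fun k => add_nonneg (hβ0 k) (hβ0 k)) hβ0 (fun k hk => hD4' k (hk.trans hn))
        (fun k hk => by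
          have hk' := hk.trans_le hn
          have h2 := (hXinc k hk').norm.add (hxinc k hk').norm one_le_two_ennreal (hβ0 k) (hβ0 k)
          refine h2.mono_real ((hDm _).sub (hDm _)) fun ω => ?_
          refine le_of_eq_of_le (congrArg _ ?_) (norm_sub_le (X (k + 1) ω - X k ω)
            (xb (k + 1) - xb k))
          simp only [hD]
          abel) (fun k hk => hXinc k (hk.trans_le hn)) hYb
      have h2 : ∑ k ∈ Finset.range n, (β k + β k + 2 * Z * β k) * y
          = (2 + 2 * Z) * y * ∑ k ∈ Finset.range n, β k := by
        rw [Finset.mul_sum]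
        exact Finset.sum_congr rfl fun k _ => by ring
      rw [h2] at h1
      refine (mul_le_mul_of_nonneg_left h1 hΔ.le).trans ?_
      rw [← mul_assoc]
      have h3 : 2 * (2 * Z) * y + (2 + 2 * Z) * y * ∑ k ∈ Finset.range n, β k
          ≤ (c + 3 * M) * (4 * Z + 3 + (2 + 2 * Z) * I) * (h_N * ρ ^ 2) := by
        calc 2 * (2 * Z) * y + (2 + 2 * Z) * y * ∑ k ∈ Finset.range n, β k
            ≤ 2 * (2 * Z) * y * (ρ * h_N) + (2 + 2 * Z) * y * (I * ρ * h_N) := by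
              refine add_le_add (le_mul_of_one_le_right (by positivity) hρh) ?_
              exact mul_le_mul_of_nonneg_left (hβs n hn) (by positivity)
          _ = (c + 3 * M) * (4 * Z + (2 + 2 * Z) * I) * (h_N * ρ ^ 2) := by rw [hy]; ring
          _ ≤ _ := by gcongr; linarith
      refine (mul_le_mul hcΔ' h3 (by positivity) (by positivity)).trans (le_of_eq ?_)
      rw [ha, averagingConst, ← hZ, ← hI, hE]
      ring
    have hH2 : ∀ n ≤ N, ∀ h : H, Δ * |∑ k ∈ Finset.range n,
        ∫ ω, ⟪ContinuousLinearMap.adjoint (A ^ (n - k)) h,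
          fluctuation F ν (X k ω) (Y (k + 1) ω)⟫_ℝ ∂P| ≤ a * E * ‖h‖ := by
      intro n hn h
      have h1 := abs_sum_integral_adjoint_fluctuation_le hF hν1 hq hinv hB hb1 hW hY hXa hYa hA hA'
        hy0 hβ0 (fun k hk => hXinc k (hk.trans_le hn)) hYb h
      refine (mul_le_mul_of_nonneg_left h1 hΔ.le).trans ?_
      rw [← mul_assoc]
      have hs := Finset.sum_nonneg fun k (_ : k ∈ Finset.range n) => hβ0 k
      have hhn := harm_nonneg n
      have h3 : (2 + harm n + ∑ k ∈ Finset.range n, β k) * y * ‖h‖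
          ≤ (c + 3 * M) * (4 * Z + 3 + (2 + 2 * Z) * I) * (h_N * ρ ^ 2) * ‖h‖ := by
        refine mul_le_mul_of_nonneg_right ?_ (norm_nonneg _)
        calc (2 + harm n + ∑ k ∈ Finset.range n, β k) * y
            ≤ (2 * (ρ * h_N) + ρ * h_N + I * ρ * h_N) * y := by
              gcongr
              · linarith
              · exact (harm_mono hn).trans (le_mul_of_one_le_left hh0 hρ)
              · exact hβs n hn
          _ = (c + 3 * M) * (3 + I) * (h_N * ρ ^ 2) := by rw [hy]; ring
          _ ≤ _ := by
            gcongr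
            · linarith
            · linarith [mul_nonneg hZ0 hI0]
      refine (mul_le_mul hcΔ' h3 (by positivity) (by positivity)).trans (le_of_eq ?_)
      rw [ha, averagingConst, ← hZ, ← hI, hE]
      ring
    refine (weak_error_of_averaging (V := fun n => Y (n + 1)) (v := y) (δ := a * E)
      (d := ‖x₀ - xb 0‖) hF hν1 hA hΔ hN hT (fun ω => by rw [hX0]) hX hxb hX2
      (fun n => hYm (n + 1)) hy0 (fun n => (hYb (n + 1)).of_le two_le_four_ennreal) (by positivity)
      hH1 hH2 hφ).trans (mul_le_mul_of_nonneg_left ?_ hφ.nonneg)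
    have e1 : ‖x₀ - xb 0‖ ≤ c * E := hd.trans (by
      rw [mul_assoc]; exact mul_le_mul_of_nonneg_left hερ (by linarith))
    have e2 : ‖x₀ - xb 0‖ ^ 2 ≤ c ^ 3 * E := by
      calc ‖x₀ - xb 0‖ ^ 2 ≤ (c * ε * ρ) ^ 2 := pow_le_pow_left₀ (norm_nonneg _) hd 2
        _ = c ^ 2 * ε * (ε * ρ ^ 2) := by ring
        _ ≤ c ^ 2 * c * ((Δ + ε) * h_N * ρ ^ 2) := by
          gcongr
          calc ε = ε * 1 := by ring
            _ ≤ (Δ + ε) * h_N := by gcongr; linarith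
        _ = _ := by rw [hE]; ring
    have e3 : Δ * y ^ 2 ≤ (c + 3 * M) ^ 2 * E := by
      calc Δ * y ^ 2 = (c + 3 * M) ^ 2 * (Δ * 1 * ρ ^ 2) := by rw [hy]; ring
        _ ≤ (c + 3 * M) ^ 2 * ((Δ + ε) * h_N * ρ ^ 2) := by gcongr; linarith
    calc weakConst L T * (‖x₀ - xb 0‖ + ‖x₀ - xb 0‖ ^ 2 + a * E + Δ * y ^ 2)
        ≤ weakConst L T * (c * E + c ^ 3 * E + a * E + (c + 3 * M) ^ 2 * E) := by gcongr
      _ ≤ slowConst L T M c f₀ * E := by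
        rw [slowConst, ← hZ, ← ha, add_mul]
        have : 0 ≤ 2 * Z * E := by positivity
        linarith

end SlowAbstract

/-! ### Cylindrical Gaussian noise: measurability, characteristic functions, invariance. -/

section CylindricalNoise

variable {H : Type*} [NormedAddCommGroup H] [InnerProductSpace ℝ H] [CompleteSpace H]
  {Ω : Type*} {m0 : MeasurableSpace Ω} {P : Measure Ω} [IsProbabilityMeasure P]
  {ι : Type*} {γ : ι → ℕ → Ω → ℝ}

/-- The σ-algebra generated by the coordinates `γ i j` with `i ∈ S`. -/
abbrev coordSigma (γ : ι → ℕ → Ω → ℝ) (S : Set ι) : MeasurableSpace Ω :=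
  ⨆ p ∈ {p : ι × ℕ | p.1 ∈ S}, MeasurableSpace.comap (γ p.1 p.2) Real.measurableSpace

theorem coordSigma_le (hγ : IsCylindricalGaussianFamily P γ) (S : Set ι) : coordSigma γ S ≤ m0 :=
  iSup₂_le fun p _ => (hγ.measurable p.1 p.2).comap_le

theorem coordSigma_mono {S T : Set ι} (h : S ⊆ T) : coordSigma γ S ≤ coordSigma γ T :=
  biSup_mono fun _ hp => h hp

theorem measurable_coord {S : Set ι} {i : ι} (hi : i ∈ S) (j : ℕ) :
    Measurable[coordSigma γ S] (γ i j) :=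
  Measurable.mono (comap_measurable (γ i j)) (le_iSup₂_of_le
    (f := fun (p : ι × ℕ) (_ : p ∈ {p : ι × ℕ | p.1 ∈ S}) =>
      MeasurableSpace.comap (γ p.1 p.2) Real.measurableSpace) (i, j) hi le_rfl) le_rfl

theorem indep_coordSigma (hγ : IsCylindricalGaussianFamily P γ) {S T : Set ι}
    (h : Disjoint S T) : Indep (coordSigma γ S) (coordSigma γ T) P :=
  indep_iSup_of_disjoint
    (m := fun p : ι × ℕ => MeasurableSpace.comap (γ p.1 p.2) Real.measurableSpace)
    (fun p => (hγ.measurable p.1 p.2).comap_le)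
    ((iIndepFun_iff_iIndep (fun _ => Real.measurableSpace) _ _).1 hγ.indep)
    (Set.disjoint_left.2 fun _ h1 h2 => Set.disjoint_left.1 h h1 h2)

variable {e : HilbertBasis ℕ ℝ H} {B : H →L[ℝ] H} {i : ι} {Z : Ω → H}

/-- Almost sure convergence along a subsequence gives both measurability with respect to the
coordinates and the limit of the characteristic functions. -/
theorem IsMeanSquareSum.exists_subseq (hγ : IsCylindricalGaussianFamily P γ)
    (hZ : IsMeanSquareSum P e B (γ i) Z) : ∃ ns : ℕ → ℕ, StrictMono ns ∧ ∀ᵐ ω ∂P,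
      Tendsto (fun k => ∑ j ∈ Finset.range (ns k), γ i j ω • B (e j)) atTop (𝓝 (Z ω)) := by
  have hm : ∀ n, AEStronglyMeasurable (fun ω => ∑ j ∈ Finset.range n, γ i j ω • B (e j)) P :=
    fun n => Finset.aestronglyMeasurable_fun_sum _ fun j _ =>
      (hγ.measurable i j).aestronglyMeasurable.smul_const _
  refine (tendstoInMeasure_of_tendsto_eLpNorm (p := 2) (by norm_num) hm hZ.1.1
    (hZ.2.congr fun n => ?_)).exists_seq_tendsto_ae
  rw [← eLpNorm_sub_comm]
  rfl

theorem aestronglyMeasurable_of_tendsto_ae_of_le {m : MeasurableSpace Ω} {E : Type*}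
    [NormedAddCommGroup E] [CompleteSpace E] {f : ℕ → Ω → E} {g : Ω → E}
    (hf : ∀ k, StronglyMeasurable[m] (f k))
    (h : ∀ᵐ ω ∂P, Tendsto (fun k => f k ω) atTop (𝓝 (g ω))) : AEStronglyMeasurable[m] g P := by
  have h' : StronglyMeasurable[m] fun ω => limUnder atTop (fun k => f k ω) :=
    @StronglyMeasurable.limUnder _ _ _ m _ _ _ _ _ _ _ hf
  exact ⟨_, h', by filter_upwards [h] with ω hω using hω.limUnder_eq.symm⟩

theorem IsMeanSquareSum.aestronglyMeasurable (hγ : IsCylindricalGaussianFamily P γ)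
    (hZ : IsMeanSquareSum P e B (γ i) Z) {S : Set ι} (hi : i ∈ S) :
    AEStronglyMeasurable[coordSigma γ S] Z P := by
  obtain ⟨ns, -, h⟩ := hZ.exists_subseq hγ
  have hm : ∀ k, StronglyMeasurable[coordSigma γ S]
      (fun ω => ∑ j ∈ Finset.range (ns k), γ i j ω • B (e j)) := fun k =>
    Finset.stronglyMeasurable_fun_sum _ fun j _ =>
      (continuous_id.smul continuous_const : Continuous fun r : ℝ => r • B (e j)).comp_stronglyMeasurable
        (measurable_coord hi j).stronglyMeasurable
  exact aestronglyMeasurable_of_tendsto_ae_of_le hm h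

theorem hasSum_inner_sq (e : HilbertBasis ℕ ℝ H) (x : H) :
    HasSum (fun j => ⟪e j, x⟫_ℝ ^ 2) (‖x‖ ^ 2) := by
  have h := e.hasSum_inner_mul_inner x x
  rw [real_inner_self_eq_norm_sq] at h
  refine h.congr_fun fun j => ?_
  rw [real_inner_comm, pow_two]

variable [MeasurableSpace H] [BorelSpace H] [SecondCountableTopology H]

theorem charFun_map_coord (hγ : IsCylindricalGaussianFamily P γ) (i : ι) (j : ℕ) (v t : H) :
    charFun (P.map fun ω => γ i j ω • v) t = Complex.exp ((-(⟪v, t⟫_ℝ ^ 2 / 2) : ℝ)) := by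
  have hm := hγ.measurable i j
  have h : charFun (P.map (γ i j)) ⟪v, t⟫_ℝ = Complex.exp ((-(⟪v, t⟫_ℝ ^ 2 / 2) : ℝ)) := by
    rw [hγ.law, charFun_gaussianReal]
    congr 1
    push_cast
    ring
  rw [← h, charFun_apply, charFun_apply_real, integral_map (by fun_prop) (by fun_prop),
    integral_map (by fun_prop) (by fun_prop)]
  refine integral_congr_ae (ae_of_all _ fun ω => ?_)
  simp only [inner_smul_left]
  congr 2
  push_cast
  simp [mul_comm]

/-- Independence makes the partial sums Gaussian with quadratic form `∑ ⟨e j, B* t⟩ ^ 2`, which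
tends to `‖B* t‖ ^ 2` by Parseval. The law thus depends on `B` only, and not on the index or the
noise family. -/
theorem IsMeanSquareSum.charFun_eq (hγ : IsCylindricalGaussianFamily P γ)
    (hZ : IsMeanSquareSum P e B (γ i) Z) (t : H) :
    charFun (P.map Z) t
      = Complex.exp ((-(‖ContinuousLinearMap.adjoint B t‖ ^ 2 / 2) : ℝ)) := by
  have hcm : ∀ j, AEMeasurable (fun ω => γ i j ω • B (e j)) P := fun j => by
    have := hγ.measurable i j
    fun_prop
  have hpart : ∀ n : ℕ, charFun (P.map fun ω => ∑ j ∈ Finset.range n, γ i j ω • B (e j)) t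
      = Complex.exp ((-((∑ j ∈ Finset.range n,
        ⟪e j, ContinuousLinearMap.adjoint B t⟫_ℝ ^ 2) / 2) : ℝ)) := by
    intro n
    have h1 : iIndepFun (fun j : ℕ => γ i j) P :=
      hγ.indep.precomp (g := fun j : ℕ => (i, j)) fun j k h => by simpa using h
    have h2 : iIndepFun (fun j : ℕ => fun ω => γ i j ω • B (e j)) P :=
      h1.comp (fun j x => x • B (e j)) fun j => by fun_prop
    have h3 := iIndepFun.charFun_map_fun_finsetSum_eq_prod (s := Finset.range n)
      (X := fun j ω => γ i j ω • B (e j)) (fun j _ => hcm j)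
      (h2.precomp (g := fun j : Finset.range n => (j : ℕ)) Subtype.val_injective)
    rw [h3, Finset.prod_apply]
    simp_rw [charFun_map_coord hγ]
    rw [← Complex.exp_sum]
    congr 1
    push_cast
    rw [Finset.sum_neg_distrib, Finset.sum_div]
    simp_rw [ContinuousLinearMap.adjoint_inner_right]
  obtain ⟨ns, hns, h⟩ := hZ.exists_subseq hγ
  have hlim1 : Tendsto (fun k => charFun
      (P.map fun ω => ∑ j ∈ Finset.range (ns k), γ i j ω • B (e j)) t) atTop
      (𝓝 (charFun (P.map Z) t)) := by
    have hsm : ∀ n, AEMeasurable (fun ω => ∑ j ∈ Finset.range n, γ i j ω • B (e j)) P := fun n =>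
      Finset.aemeasurable_fun_sum _ fun j _ => hcm j
    simp_rw [charFun_apply]
    rw [integral_map hZ.1.aemeasurable (by fun_prop)]
    have : ∀ k, ∫ x, Complex.exp (⟪x, t⟫_ℝ * Complex.I)
        ∂(P.map fun ω => ∑ j ∈ Finset.range (ns k), γ i j ω • B (e j))
        = ∫ ω, Complex.exp (⟪∑ j ∈ Finset.range (ns k), γ i j ω • B (e j), t⟫_ℝ * Complex.I) ∂P :=
      fun k => integral_map (hsm _) (by fun_prop)
    simp_rw [this]
    refine tendsto_integral_of_dominated_convergence (fun _ => 1) (fun k => ?_)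
      (integrable_const _) (fun k => ae_of_all _ fun ω => ?_) ?_
    · have hc : Continuous fun x : H => Complex.exp (⟪x, t⟫_ℝ * Complex.I) := by fun_prop
      exact hc.comp_aestronglyMeasurable (hsm _).aestronglyMeasurable
    · rw [Complex.norm_exp_ofReal_mul_I]
    · filter_upwards [h] with ω hω
      have hc : Continuous fun x : H => Complex.exp (⟪x, t⟫_ℝ * Complex.I) := by fun_prop
      exact (hc.tendsto _).comp hω
  have hlim2 : Tendsto (fun k => charFun
      (P.map fun ω => ∑ j ∈ Finset.range (ns k), γ i j ω • B (e j)) t) atTop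
      (𝓝 (Complex.exp ((-(‖ContinuousLinearMap.adjoint B t‖ ^ 2 / 2) : ℝ)))) := by
    simp_rw [hpart]
    have h1 := ((hasSum_inner_sq e (ContinuousLinearMap.adjoint B t)).tendsto_sum_nat.comp
      hns.tendsto_atTop)
    have hc : Continuous fun s : ℝ => Complex.exp ((-(s / 2) : ℝ)) := by fun_prop
    exact (hc.tendsto _).comp h1
  exact tendsto_nhds_unique hlim1 hlim2

/-- Gaussianity is wanted for the finiteness of the fourth moment. -/
theorem isGaussian_of_charFun {μ : Measure H} [IsProbabilityMeasure μ] {B : H →L[ℝ] H}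
    (h : ∀ t, charFun μ t = Complex.exp ((-(‖B t‖ ^ 2 / 2) : ℝ))) : IsGaussian μ := by
  refine isGaussian_of_map_eq_gaussianReal fun l => ⟨0, (‖B ((InnerProductSpace.toDual ℝ H).symm l)‖₊) ^ 2, ?_⟩
  set t := (InnerProductSpace.toDual ℝ H).symm l with ht
  have hl : ∀ x, l x = ⟪t, x⟫_ℝ := fun x => by
    rw [ht, InnerProductSpace.toDual_symm_apply]
  have := Measure.isProbabilityMeasure_map (μ := μ) (f := l) (by fun_prop)
  refine Measure.ext_of_charFun (funext fun s => ?_)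
  rw [charFun_gaussianReal, charFun_apply_real, integral_map (by fun_prop) (by fun_prop)]
  have h1 := h (s • t)
  rw [charFun_apply] at h1
  rw [show ∫ x, Complex.exp (s * (l x : ℝ) * Complex.I) ∂μ
    = ∫ x, Complex.exp ((⟪x, s • t⟫_ℝ : ℝ) * Complex.I) ∂μ from
      integral_congr_ae (ae_of_all _ fun x => by
        simp only [hl, inner_smul_right, real_inner_comm x t]; push_cast; rfl), h1]
  congr 1
  rw [map_smul, norm_smul, mul_pow, Real.norm_eq_abs, sq_abs]
  push_cast
  simp
  ring

theorem cylApply_isMeanSquareSum (hγ : IsCylindricalGaussianFamily P γ)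
    (hB : Summable fun j => ‖B (e j)‖ ^ 2) (i : ι) :
    IsMeanSquareSum P e B (γ i) (cylApply P e B (γ i)) := by
  have h := exists_isMeanSquareSum P e B hγ i hB
  rw [cylApply, dif_pos h]
  exact h.choose_spec

/-- The strict inequality in the filtration makes the `n`-th noise visible only from time `n + 1`
on. -/
theorem isNoise_single {γ : ℕ → ℕ → Ω → ℝ} (hγ : IsCylindricalGaussianFamily P γ)
    (hB : Summable fun j => ‖B (e j)‖ ^ 2) :
    IsNoise P (fun n => coordSigma γ {i | i < n}) (fun n => cylApply P e B (γ n))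
      (P.map (cylApply P e B (γ 0))) := by
  have hZ := cylApply_isMeanSquareSum hγ hB
  have hp : ∀ n, IsProbabilityMeasure (P.map (cylApply P e B (γ n))) := fun n =>
    Measure.isProbabilityMeasure_map (hZ n).1.aemeasurable
  refine ⟨fun n => coordSigma_le hγ _, fun m n h => coordSigma_mono fun i hi => ?_, fun n => ?_,
    fun n => ?_, fun n => ⟨coordSigma γ {n}, ?_, indep_coordSigma hγ ?_⟩⟩
  · exact lt_of_lt_of_le hi h
  · exact (hZ n).aestronglyMeasurable hγ (Nat.lt_succ_self n)
  · exact Measure.ext_of_charFun (funext fun t => by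
      rw [(hZ n).charFun_eq hγ, (hZ 0).charFun_eq hγ])
  · exact (hZ n).aestronglyMeasurable hγ rfl
  · simp

section Pair

variable {γ : ℕ × Fin 2 → ℕ → Ω → ℝ} {B₁ B₂ : H →L[ℝ] H} {r : ℝ}

theorem charFun_pair (hγ : IsCylindricalGaussianFamily P γ)
    (h₁ : Summable fun j => ‖B₁ (e j)‖ ^ 2) (h₂ : Summable fun j => ‖B₂ (e j)‖ ^ 2) (n : ℕ)
    (t : H) :
    charFun (P.map fun ω => r • cylApply P e B₁ (γ (n, 0)) ω
        + r • cylApply P e B₂ (γ (n, 1)) ω) t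
      = Complex.exp ((-(r ^ 2 * (‖ContinuousLinearMap.adjoint B₁ t‖ ^ 2
        + ‖ContinuousLinearMap.adjoint B₂ t‖ ^ 2) / 2) : ℝ)) := by
  have hZ₁ := cylApply_isMeanSquareSum hγ h₁ (n, 0)
  have hZ₂ := cylApply_isMeanSquareSum hγ h₂ (n, 1)
  have hind : IndepFun (fun ω => r • cylApply P e B₁ (γ (n, 0)) ω)
      (fun ω => r • cylApply P e B₂ (γ (n, 1)) ω) P :=
    indepFun_of_indep (indep_coordSigma hγ (S := {(n, 0)}) (T := {(n, 1)}) (by simp))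
      ((hZ₁.aestronglyMeasurable hγ (Set.mem_singleton _)).const_smul r)
      ((hZ₂.aestronglyMeasurable hγ (Set.mem_singleton _)).const_smul r)
  have h := hind.charFun_map_add_eq_mul (hZ₁.1.1.const_smul r).aemeasurable
    (hZ₂.1.1.const_smul r).aemeasurable
  have e₁ : charFun (P.map (r • cylApply P e B₁ (γ (n, 0)))) t = _ :=
    charFun_map_smul_comp hZ₁.1.aemeasurable r t
  have e₂ : charFun (P.map (r • cylApply P e B₂ (γ (n, 1)))) t = _ :=
    charFun_map_smul_comp hZ₂.1.aemeasurable r t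
  refine (congrFun h t).trans ?_
  rw [Pi.mul_apply, e₁, e₂, hZ₁.charFun_eq hγ, hZ₂.charFun_eq hγ,
    ← Complex.exp_add]
  congr 1
  rw [map_smul, map_smul, norm_smul, norm_smul, mul_pow, mul_pow, Real.norm_eq_abs, sq_abs]
  push_cast
  ring

theorem isNoise_pair (hγ : IsCylindricalGaussianFamily P γ)
    (h₁ : Summable fun j => ‖B₁ (e j)‖ ^ 2) (h₂ : Summable fun j => ‖B₂ (e j)‖ ^ 2) :
    IsNoise P (fun n => coordSigma γ {i | i.1 < n})
      (fun n ω => r • cylApply P e B₁ (γ (n, 0)) ω + r • cylApply P e B₂ (γ (n, 1)) ω)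
      (P.map fun ω => r • cylApply P e B₁ (γ (0, 0)) ω + r • cylApply P e B₂ (γ (0, 1)) ω) := by
  have hZ₁ := fun n : ℕ => cylApply_isMeanSquareSum hγ h₁ (n, 0)
  have hZ₂ := fun n : ℕ => cylApply_isMeanSquareSum hγ h₂ (n, 1)
  have hm : ∀ n (S : Set (ℕ × Fin 2)), (∀ k, (n, k) ∈ S) → AEStronglyMeasurable[coordSigma γ S]
      (fun ω => r • cylApply P e B₁ (γ (n, 0)) ω + r • cylApply P e B₂ (γ (n, 1)) ω) P :=
    fun n S hS => (((hZ₁ n).aestronglyMeasurable hγ (hS 0)).const_smul r).add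
      (((hZ₂ n).aestronglyMeasurable hγ (hS 1)).const_smul r)
  have hp : ∀ n, IsProbabilityMeasure (P.map fun ω => r • cylApply P e B₁ (γ (n, 0)) ω
      + r • cylApply P e B₂ (γ (n, 1)) ω) := fun n =>
    Measure.isProbabilityMeasure_map
      ((hm n Set.univ (by simp)).mono (coordSigma_le hγ _)).aemeasurable
  refine ⟨fun n => coordSigma_le hγ _, fun m n h => coordSigma_mono fun i hi => ?_, fun n => ?_,
    fun n => ?_, fun n => ⟨coordSigma γ {i | i.1 = n}, ?_, indep_coordSigma hγ ?_⟩⟩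
  · exact lt_of_lt_of_le hi h
  · exact hm n _ fun k => Nat.lt_succ_self n
  · exact Measure.ext_of_charFun (funext fun t => by
      rw [charFun_pair hγ h₁ h₂, charFun_pair hγ h₁ h₂])
  · exact hm n _ fun k => rfl
  · exact Set.disjoint_left.2 fun i (h1 : i.1 < n) (h2 : i.1 = n) => h1.ne h2

/-- Centred Gaussian laws are determined by the quadratic form of their covariance, so invariance
reduces to the discrete Lyapunov equation `h`. -/
theorem map_conv_eq_of_norm_sq {ν : Measure H} [IsProbabilityMeasure ν] {A G : H →L[ℝ] H}
    (hν : ∀ t, charFun ν t = Complex.exp ((-(‖ContinuousLinearMap.adjoint G t‖ ^ 2 / 2) : ℝ)))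
    (hγ : IsCylindricalGaussianFamily P γ)
    (h₁ : Summable fun j => ‖B₁ (e j)‖ ^ 2) (h₂ : Summable fun j => ‖B₂ (e j)‖ ^ 2)
    (h : ∀ t, ‖ContinuousLinearMap.adjoint G (ContinuousLinearMap.adjoint A t)‖ ^ 2
      + r ^ 2 * (‖ContinuousLinearMap.adjoint B₁ t‖ ^ 2 + ‖ContinuousLinearMap.adjoint B₂ t‖ ^ 2)
        = ‖ContinuousLinearMap.adjoint G t‖ ^ 2) :
    ν.map A ∗ (P.map fun ω => r • cylApply P e B₁ (γ (0, 0)) ω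
      + r • cylApply P e B₂ (γ (0, 1)) ω) = ν := by
  have := (isNoise_pair (r := r) hγ h₁ h₂).isProbabilityMeasure
  have := Measure.isProbabilityMeasure_map (μ := ν) (f := A) (by fun_prop)
  refine Measure.ext_of_charFun (funext fun t => ?_)
  have hA : charFun (ν.map A) t = charFun ν (ContinuousLinearMap.adjoint A t) := by
    rw [charFun_apply, charFun_apply, integral_map (by fun_prop) (by fun_prop)]
    simp_rw [ContinuousLinearMap.adjoint_inner_right]
  rw [charFun_conv, charFun_pair hγ h₁ h₂, hA, hν, hν, ← Complex.exp_add, ← h t]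
  congr 1
  push_cast
  ring

end Pair

end CylindricalNoise

/-! ### Spectral estimates for the resolvent and the noise operators. -/

section DiagonalOperators

variable {H : Type*} [NormedAddCommGroup H] [InnerProductSpace ℝ H] [CompleteSpace H]
  {e : HilbertBasis ℕ ℝ H} {lam : ℕ → ℝ} {τ : ℝ}

theorem norm_le_of_abs_inner_le (e : HilbertBasis ℕ ℝ H) {M : ℝ} (hM : 0 ≤ M) {x y : H}
    (h : ∀ j, |⟪e j, y⟫_ℝ| ≤ M * |⟪e j, x⟫_ℝ|) : ‖y‖ ≤ M * ‖x‖ := by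
  refine (sq_le_sq₀ (norm_nonneg _) (by positivity)).1 ?_
  rw [mul_pow]
  refine hasSum_le (fun j => ?_) (hasSum_inner_sq e y) ((hasSum_inner_sq e x).mul_left (M ^ 2))
  rw [← sq_abs, ← sq_abs ⟪e j, x⟫_ℝ, ← mul_pow]
  exact pow_le_pow_left₀ (abs_nonneg _) (h j) 2

theorem diagonalOp_apply_basis (e : HilbertBasis ℕ ℝ H) {c : ℕ → ℝ} {M : ℝ}
    (hM : ∀ j, |c j| ≤ M) (j : ℕ) : diagonalOp e c (e j) = c j • e j := by
  refine ext_inner e fun k => ?_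
  rw [inner_diagonalOp e hM, inner_smul_right]
  rcases eq_or_ne k j with rfl | h
  · rfl
  · rw [e.orthonormal.2 h, mul_zero, mul_zero]

theorem adjoint_diagonalOp (e : HilbertBasis ℕ ℝ H) {c : ℕ → ℝ} {M : ℝ}
    (hM : ∀ j, |c j| ≤ M) :
    ContinuousLinearMap.adjoint (diagonalOp e c) = diagonalOp e c := by
  refine ((ContinuousLinearMap.eq_adjoint_iff _ _).2 fun x y => ?_).symm
  refine (e.hasSum_inner_mul_inner (diagonalOp e c x) y).unique
    ((e.hasSum_inner_mul_inner x (diagonalOp e c y)).congr_fun fun j => ?_)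
  rw [inner_diagonalOp e hM, real_inner_comm, real_inner_comm (e j) x, inner_diagonalOp e hM]
  ring

theorem resolvent_eigenvalue_pos (hlam : IsSpectrum lam) (hτ : 0 < τ) (j : ℕ) :
    0 < (1 + τ * lam j)⁻¹ := by
  have := mul_pos hτ (hlam.pos j)
  positivity

theorem resolvent_eigenvalue_le_inv_mul (hlam : IsSpectrum lam) (hτ : 0 < τ) (j : ℕ) :
    (1 + τ * lam j)⁻¹ ≤ τ⁻¹ * (lam j)⁻¹ := by
  rw [← mul_inv]
  exact inv_anti₀ (mul_pos hτ (hlam.pos j)) (by linarith)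

theorem norm_resolvent_le (e : HilbertBasis ℕ ℝ H) (hlam : IsSpectrum lam) (hτ : 0 < τ) :
    ‖resolvent e lam τ‖ ≤ (1 + τ * lam 0)⁻¹ := by
  have h0 := (resolvent_eigenvalue_pos hlam hτ 0).le
  refine ContinuousLinearMap.opNorm_le_bound _ h0 fun x => norm_le_of_abs_inner_le e h0 fun j => ?_
  rw [inner_resolvent e hlam hτ, abs_mul, abs_of_pos (resolvent_eigenvalue_pos hlam hτ j)]
  have h1 := mul_pos hτ (hlam.pos 0)
  have h2 := hlam.mono (Nat.zero_le j)
  gcongr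

/-- Since `a ^ n` is the smallest of `1, a, …, a ^ n`, one has `(n + 1) a ^ n (1 - a) ≤ (1 - a) ∑ a
^ k = 1 - a ^ (n + 1) ≤ 1`. -/
theorem pow_mul_one_sub_le {a : ℝ} (h0 : 0 ≤ a) (h1 : a ≤ 1) (n : ℕ) :
    a ^ n * (1 - a) ≤ ((n : ℝ) + 1)⁻¹ := by
  have h : ((n : ℝ) + 1) * a ^ n ≤ ∑ k ∈ Finset.range (n + 1), a ^ k := by
    have := Finset.card_nsmul_le_sum (Finset.range (n + 1)) (fun k => a ^ k) (a ^ n) fun k hk =>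
      pow_le_pow_of_le_one h0 h1 (Nat.lt_succ_iff.1 (Finset.mem_range.1 hk))
    simpa using this
  have h2 := geom_sum_mul_neg a (n + 1)
  have h3 : 0 ≤ a ^ (n + 1) := by positivity
  rw [← one_div, le_div_iff₀ (by positivity)]
  nlinarith [mul_le_mul_of_nonneg_right h (sub_nonneg.2 h1)]

theorem inner_resolvent_pow (e : HilbertBasis ℕ ℝ H) (hlam : IsSpectrum lam) (hτ : 0 < τ) (x : H)
    (j n : ℕ) : ⟪e j, (resolvent e lam τ ^ n) x⟫_ℝ = (1 + τ * lam j)⁻¹ ^ n * ⟪e j, x⟫_ℝ := by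
  induction n with
  | zero => simp
  | succ n ih =>
    rw [pow_succ', mul_apply_eq_comp, inner_resolvent e hlam hτ, ih]
    ring

theorem norm_resolvent_pow_mul_one_sub_le (e : HilbertBasis ℕ ℝ H) (hlam : IsSpectrum lam)
    (hτ : 0 < τ) (n : ℕ) :
    ‖resolvent e lam τ ^ n * (1 - resolvent e lam τ)‖ ≤ ((n : ℝ) + 1)⁻¹ := by
  have h0 : (0 : ℝ) ≤ ((n : ℝ) + 1)⁻¹ := by positivity
  refine ContinuousLinearMap.opNorm_le_bound _ h0 fun x => norm_le_of_abs_inner_le e h0 fun j => ?_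
  have ha := resolvent_eigenvalue_pos hlam hτ j
  have hb := (le_abs_self _).trans (abs_resolvent_le hlam hτ j)
  rw [mul_apply_eq_comp, inner_resolvent_pow e hlam hτ, sub_apply,
    one_apply_eq_self, inner_sub_right, inner_resolvent e hlam hτ, ← one_sub_mul,
    ← mul_assoc, abs_mul, abs_of_nonneg (mul_nonneg (pow_nonneg ha.le n) (sub_nonneg.2 hb))]
  gcongr
  exact pow_mul_one_sub_le ha.le hb n

theorem abs_invSqrt_le (hlam : IsSpectrum lam) (j : ℕ) :
    |lam j ^ (-(1 / 2) : ℝ)| ≤ lam 0 ^ (-(1 / 2) : ℝ) := by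
  rw [abs_of_pos (Real.rpow_pos_of_pos (hlam.pos j) _)]
  exact Real.rpow_le_rpow_of_nonpos (hlam.pos 0) (hlam.mono (Nat.zero_le j)) (by norm_num)

theorem invSqrt_sq (hlam : IsSpectrum lam) (j : ℕ) :
    (lam j ^ (-(1 / 2) : ℝ)) ^ 2 = (lam j)⁻¹ := by
  rw [← Real.rpow_natCast, ← Real.rpow_mul (hlam.pos j).le, ← Real.rpow_neg_one]
  norm_num

/-- Quadratic growth of the eigenvalues makes `Λ^{-1}` trace class; all Hilbert–Schmidt properties
below follow from it. -/
theorem summable_inv_spectrum (hlam : IsSpectrum lam) : Summable fun j => (lam j)⁻¹ := by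
  obtain ⟨c, hc, h⟩ := hlam.growth
  refine h.inv.summable_iff_nat.2 ?_
  have h1 : Summable fun j : ℕ => (((j : ℝ) + 1) ^ 2)⁻¹ := by
    have := (summable_nat_add_iff 1).2 (Real.summable_nat_pow_inv.2 one_lt_two)
    simpa using this
  refine (h1.mul_left c⁻¹).congr fun j => ?_
  rw [Pi.inv_apply, mul_inv]

theorem summable_norm_invSqrtOp_sq (e : HilbertBasis ℕ ℝ H) (hlam : IsSpectrum lam) :
    Summable fun j => ‖invSqrtOp e lam (e j)‖ ^ 2 := by
  refine (summable_inv_spectrum hlam).congr fun j => ?_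
  rw [invSqrtOp, diagonalOp_apply_basis e (abs_invSqrt_le hlam), norm_smul, e.orthonormal.1 j,
    mul_one, Real.norm_eq_abs, sq_abs, invSqrt_sq hlam]

theorem summable_norm_smul_resolvent_sq (e : HilbertBasis ℕ ℝ H) (hlam : IsSpectrum lam)
    (hτ : 0 < τ) (r : ℝ) : Summable fun j => ‖(r • resolvent e lam τ) (e j)‖ ^ 2 := by
  refine ((summable_inv_spectrum hlam).mul_left (r ^ 2 * τ⁻¹)).of_nonneg_of_le
    (fun j => by positivity) fun j => ?_
  have ha := resolvent_eigenvalue_pos hlam hτ j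
  have hb := (le_abs_self _).trans (abs_resolvent_le hlam hτ j)
  rw [smul_apply, resolvent, diagonalOp_apply_basis e (abs_resolvent_le hlam hτ),
    norm_smul, norm_smul, e.orthonormal.1 j, mul_one, Real.norm_eq_abs, Real.norm_eq_abs, mul_pow,
    sq_abs, sq_abs, mul_assoc]
  gcongr
  refine le_trans ?_ (resolvent_eigenvalue_le_inv_mul hlam hτ j)
  rw [pow_two]
  exact mul_le_of_le_one_left ha.le hb

/-- Both sums are the double sum of the squared matrix entries. The adjoint side is the accessible
one, since only `B B*` is prescribed for the second noise operator. -/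
theorem summable_norm_sq_of_adjoint (e : HilbertBasis ℕ ℝ H) {B : H →L[ℝ] H}
    (h : Summable fun k => ‖ContinuousLinearMap.adjoint B (e k)‖ ^ 2) :
    Summable fun j => ‖B (e j)‖ ^ 2 := by
  have hr : ∀ k, HasSum (fun j => ⟪e k, B (e j)⟫_ℝ ^ 2)
      (‖ContinuousLinearMap.adjoint B (e k)‖ ^ 2) := fun k =>
    (hasSum_inner_sq e _).congr_fun fun j => by
      rw [ContinuousLinearMap.adjoint_inner_right, real_inner_comm]
  have hp : Summable fun p : ℕ × ℕ => ⟪e p.1, B (e p.2)⟫_ℝ ^ 2 := by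
    refine (summable_prod_of_nonneg fun p => sq_nonneg _).2 ⟨fun k => (hr k).summable, ?_⟩
    exact h.congr fun k => (hr k).tsum_eq.symm
  have hq := ((summable_prod_of_nonneg (fun p => sq_nonneg _)).1 hp.prod_symm).2
  exact hq.congr fun j => (hasSum_inner_sq e (B (e j))).tsum_eq

section SecondNoise

variable {B : H →L[ℝ] H}

theorem norm_adjoint_sq_of_comp_adjoint
    (hB : B ∘L ContinuousLinearMap.adjoint B = (1 / 2 : ℝ) • resolvent e lam τ) (t : H) :
    ‖ContinuousLinearMap.adjoint B t‖ ^ 2 = 1 / 2 * ⟪resolvent e lam τ t, t⟫_ℝ := by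
  have h := congrArg (fun T : H →L[ℝ] H => ⟪T t, t⟫_ℝ) hB
  simp only [ContinuousLinearMap.comp_apply, smul_apply, inner_smul_left] at h
  rw [← real_inner_self_eq_norm_sq, ContinuousLinearMap.adjoint_inner_right]
  simpa using h

theorem summable_norm_sq_of_comp_adjoint (hlam : IsSpectrum lam) (hτ : 0 < τ)
    (hB : B ∘L ContinuousLinearMap.adjoint B = (1 / 2 : ℝ) • resolvent e lam τ) :
    Summable fun j => ‖B (e j)‖ ^ 2 := by
  refine summable_norm_sq_of_adjoint e ?_
  refine ((summable_inv_spectrum hlam).mul_left (1 / 2 * τ⁻¹)).of_nonneg_of_le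
    (fun j => by positivity) fun j => ?_
  rw [norm_adjoint_sq_of_comp_adjoint hB, resolvent,
    diagonalOp_apply_basis e (abs_resolvent_le hlam hτ), inner_smul_left,
    real_inner_self_eq_norm_sq, e.orthonormal.1 j, mul_assoc]
  have := resolvent_eigenvalue_le_inv_mul hlam hτ j
  simp only [one_pow, mul_one, conj_trivial]
  gcongr

/-- Mode by mode, with `a = 1 / (1 + τ λ)`, the identity is `a ^ 2 / λ + 2 τ (a ^ 2 / 2 + a / 2) = 1
/ λ`, that is, `a ^ 2 (1 + τ λ) + τ λ a = a (1 + τ λ) = 1`. -/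
theorem invariance_norm_sq (hlam : IsSpectrum lam) (hτ : 0 < τ)
    (hB : B ∘L ContinuousLinearMap.adjoint B = (1 / 2 : ℝ) • resolvent e lam τ) (t : H) :
    ‖ContinuousLinearMap.adjoint (invSqrtOp e lam)
        (ContinuousLinearMap.adjoint (resolvent e lam τ) t)‖ ^ 2
      + √(2 * τ) ^ 2 * (‖ContinuousLinearMap.adjoint ((1 / √2) • resolvent e lam τ) t‖ ^ 2
        + ‖ContinuousLinearMap.adjoint B t‖ ^ 2)
      = ‖ContinuousLinearMap.adjoint (invSqrtOp e lam) t‖ ^ 2 := by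
  have hA : ContinuousLinearMap.adjoint (resolvent e lam τ) = resolvent e lam τ :=
    adjoint_diagonalOp e (abs_resolvent_le hlam hτ)
  have hG : ContinuousLinearMap.adjoint (invSqrtOp e lam) = invSqrtOp e lam :=
    adjoint_diagonalOp e (abs_invSqrt_le hlam)
  have hGi : ∀ x j, ⟪e j, invSqrtOp e lam x⟫_ℝ ^ 2 = (lam j)⁻¹ * ⟪e j, x⟫_ℝ ^ 2 := fun x j => by
    rw [invSqrtOp, inner_diagonalOp e (abs_invSqrt_le hlam), mul_pow, invSqrt_sq hlam]
  have h2 : (1 / √2) ^ 2 = (1 / 2 : ℝ) := by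
    rw [div_pow, Real.sq_sqrt (by norm_num), one_pow]
  have hsmul : ContinuousLinearMap.adjoint ((1 / √2) • resolvent e lam τ)
      = (1 / √2) • resolvent e lam τ := by
    rw [map_smulₛₗ, hA]
    simp
  rw [norm_adjoint_sq_of_comp_adjoint hB, hsmul, smul_apply, norm_smul, mul_pow,
    Real.norm_eq_abs, sq_abs, h2, hG, hA, Real.sq_sqrt (by positivity)]
  have s1 := hasSum_inner_sq e (invSqrtOp e lam (resolvent e lam τ t))
  have s2 := hasSum_inner_sq e (resolvent e lam τ t)
  have s3 := e.hasSum_inner_mul_inner (resolvent e lam τ t) t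
  refine (s1.add (((s2.mul_left (1 / 2)).add (s3.mul_left (1 / 2))).mul_left (2 * τ))).unique
    ((hasSum_inner_sq e (invSqrtOp e lam t)).congr_fun fun j => ?_)
  rw [hGi, hGi, real_inner_comm (e j), inner_resolvent e hlam hτ]
  have hl := hlam.pos j
  have hp := mul_pos hτ hl
  have h1 : 1 + τ * lam j ≠ 0 := by linarith
  field_simp
  ring

end SecondNoise

theorem powNorm_zero (e : HilbertBasis ℕ ℝ H) (lam : ℕ → ℝ) (x : H) :
    powNorm e lam (0 / 2) x = ‖x‖ := by
  simp only [powNorm, zero_div, mul_zero, Real.rpow_zero, one_mul]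
  rw [(hasSum_inner_sq e x).tsum_eq, Real.sqrt_sq (norm_nonneg x)]

theorem secondCountableTopology_of_hilbertBasis (e : HilbertBasis ℕ ℝ H) :
    SecondCountableTopology H := by
  have h : TopologicalSpace.IsSeparable (Set.univ : Set H) := by
    have h1 := ((Set.countable_range e).isSeparable.span (R := ℝ)).closure
    have h2 := congrArg (fun S : Submodule ℝ H => (S : Set H)) e.dense_span
    simp only [Submodule.topologicalClosure_coe, Submodule.top_coe] at h2
    rwa [h2] at h1
  have := TopologicalSpace.isSeparable_univ_iff.1 h
  exact UniformSpace.secondCountable_of_separable H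

end DiagonalOperators

/-! ### Mean value and Taylor bounds. -/

section SmoothFunctions

variable {E G : Type*} [NormedAddCommGroup E] [NormedSpace ℝ E] [NormedAddCommGroup G]
  [NormedSpace ℝ G] {f : E → G} {C : ℝ}

theorem norm_sub_le_of_norm_fderiv_le (hf : Differentiable ℝ f) (h : ∀ x, ‖fderiv ℝ f x‖ ≤ C)
    (x x' : E) : ‖f x - f x'‖ ≤ C * ‖x - x'‖ :=
  convex_univ.norm_image_sub_le_of_norm_fderiv_le (fun z _ => hf z) (fun z _ => h z)
    (Set.mem_univ x') (Set.mem_univ x)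

theorem norm_fderiv_sub_le_of_norm_iteratedFDeriv_le (hf : ContDiff ℝ 2 f)
    (h : ∀ x, ‖iteratedFDeriv ℝ 2 f x‖ ≤ C) (x x' : E) :
    ‖fderiv ℝ f x - fderiv ℝ f x'‖ ≤ C * ‖x - x'‖ := by
  have hd : Differentiable ℝ (fderiv ℝ f) :=
    (hf.fderiv_right (m := 1) (by norm_num)).differentiable (by norm_num)
  refine norm_sub_le_of_norm_fderiv_le hd (fun z => ?_) x x'
  rw [← norm_iteratedFDeriv_one, norm_iteratedFDeriv_fderiv]
  exact h z

theorem norm_sub_sub_fderiv_le (hf : Differentiable ℝ f) (hC : 0 ≤ C)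
    (h : ∀ x x', ‖fderiv ℝ f x - fderiv ℝ f x'‖ ≤ C * ‖x - x'‖) (x d : E) :
    ‖f (x + d) - f x - fderiv ℝ f x d‖ ≤ C * ‖d‖ ^ 2 := by
  have := (convex_closedBall x ‖d‖).norm_image_sub_le_of_norm_fderiv_le' (f := f)
    (φ := fderiv ℝ f x) (C := C * ‖d‖) (x := x) (y := x + d) (fun z _ => hf z) (fun z hz => ?_)
    (by simp) (by simp)
  · simpa [pow_two, mul_assoc] using this
  · refine (h z x).trans ?_
    have : ‖z - x‖ ≤ ‖d‖ := by simpa [dist_eq_norm] using hz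
    gcongr

end SmoothFunctions

/-! ### From bounded derivatives to the quantitative hypotheses on `F` and `φ`. -/

section Hilbert

variable {H : Type*} [NormedAddCommGroup H] [InnerProductSpace ℝ H]

theorem IsCkBounded.isCoefficient {F : WithLp 2 (H × H) → H} (hF : IsCkBounded 3 F) :
    ∃ L, IsCoefficient (fun x y => F (WithLp.toLp 2 (x, y))) L := by
  obtain ⟨C₁, h₁⟩ := hF.2 1 le_rfl (by norm_num)
  obtain ⟨C₂, h₂⟩ := hF.2 2 (by norm_num) (by norm_num)
  have hc2 : ContDiff ℝ 2 F := hF.1.of_le (by norm_num)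
  have hd : Differentiable ℝ F := hc2.differentiable (by norm_num)
  have h₁' : ∀ z, ‖fderiv ℝ F z‖ ≤ C₁ := fun z => by
    rw [← norm_iteratedFDeriv_one]
    exact h₁ z
  have hC₁ : 0 ≤ C₁ := (norm_nonneg _).trans (h₁ 0)
  have hC₂ : 0 ≤ C₂ := (norm_nonneg _).trans (h₂ 0)
  have hlip := norm_fderiv_sub_le_of_norm_iteratedFDeriv_le hc2 h₂
  let inl : H →L[ℝ] WithLp 2 (H × H) :=
    (WithLp.prodContinuousLinearEquiv 2 ℝ H H).symm.toContinuousLinearMap ∘L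
      ContinuousLinearMap.inl ℝ H H
  have hinl : ∀ x, ‖inl x‖ = ‖x‖ := fun x => WithLp.norm_toLp_fst 2 H H x
  have hinl' : ‖inl‖ ≤ 1 :=
    ContinuousLinearMap.opNorm_le_bound _ zero_le_one fun x => by rw [hinl, one_mul]
  have hadd : ∀ x d y, WithLp.toLp 2 (x + d, y) = WithLp.toLp 2 (x, y) + inl d := fun x d y => by
    change _ = WithLp.toLp 2 (x, y) + WithLp.toLp 2 (d, (0 : H))
    rw [← WithLp.toLp_add, Prod.mk_add_mk, add_zero]
  have hsub : ∀ x y y' : H, ‖WithLp.toLp 2 (x, y) - WithLp.toLp 2 (x, y')‖ = ‖y - y'‖ :=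
    fun x y y' => by
      rw [← WithLp.toLp_sub, Prod.mk_sub_mk, sub_self]
      exact WithLp.norm_toLp_snd 2 H H _
  have hsub' : ∀ x x' y : H, ‖WithLp.toLp 2 (x, y) - WithLp.toLp 2 (x', y)‖ = ‖x - x'‖ :=
    fun x x' y => by
      rw [← WithLp.toLp_sub, Prod.mk_sub_mk, sub_self]
      exact WithLp.norm_toLp_fst 2 H H _
  have hder : ∀ x y, HasFDerivAt (fun x => F (WithLp.toLp 2 (x, y)))
      ((fderiv ℝ F (WithLp.toLp 2 (x, y))) ∘L inl) x := fun x y => by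
    refine (hd _).hasFDerivAt.comp x ?_
    have h := (inl.hasFDerivAt (x := x)).add_const (WithLp.toLp 2 ((0 : H), y))
    refine h.congr_of_eventuallyEq (Eventually.of_forall fun x => ?_)
    change _ = inl x + WithLp.toLp 2 ((0 : H), y)
    rw [add_comm, ← hadd, zero_add]
  have hcomp : ∀ T : WithLp 2 (H × H) →L[ℝ] H, ‖T ∘L inl‖ ≤ ‖T‖ := fun T =>
    (T.opNorm_comp_le inl).trans (mul_le_of_le_one_right (norm_nonneg _) hinl')
  refine ⟨C₁ + C₂, by positivity, fun x x' y y' => ?_, fun x x' y y' => ?_,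
    fun x y => (fderiv ℝ F (WithLp.toLp 2 (x, y))) ∘L inl, fun x => ?_, fun x y => ?_,
    fun x d y => ?_⟩
  · have h := norm_sub_le_of_norm_fderiv_le hd h₁' (WithLp.toLp 2 (x, y)) (WithLp.toLp 2 (x', y'))
    refine h.trans (mul_le_mul (by linarith) ?_ (norm_nonneg _) (by positivity))
    rw [← hsub' x x' y, ← hsub x' y y']
    exact norm_sub_le_norm_sub_add_norm_sub _ _ _
  -- Mean value inequality for `z ↦ F (z, y) - F (z, y')`: the second derivative bounds its
  -- derivative by `C₂ * ‖y - y'‖`.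
  · have h := convex_univ.norm_image_sub_le_of_norm_hasFDerivWithin_le (C := C₂ * ‖y - y'‖)
      (fun z _ => ((hder z y).sub (hder z y')).hasFDerivWithinAt) (fun z _ => ?_)
      (Set.mem_univ x') (Set.mem_univ x)
    · rw [sub_sub_sub_comm]
      refine h.trans ?_
      rw [mul_assoc, mul_assoc, mul_comm ‖y - y'‖]
      gcongr
      linarith
    · rw [← ContinuousLinearMap.sub_comp]
      refine (hcomp _).trans ((hlip _ _).trans ?_)
      rw [hsub]
  · have h1 : Continuous (fderiv ℝ F) := hc2.continuous_fderiv (by norm_num)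
    have h2 : Continuous fun y : H => WithLp.toLp 2 (x, y) := by fun_prop
    exact (h1.comp h2).clm_comp continuous_const
  · exact (hcomp _).trans ((h₁' _).trans (by linarith))
  · have h := norm_sub_sub_fderiv_le hd hC₂ hlip (WithLp.toLp 2 (x, y)) (inl d)
    simp only [hadd, ContinuousLinearMap.comp_apply]
    rw [hinl] at h
    refine h.trans ?_
    gcongr
    linarith

theorem IsCkBounded.isTestFunction {φ : H → ℝ} (hφ : IsCkBounded 2 φ) :
    IsTestFunction φ (tripleNorm₂ φ) := by
  obtain ⟨C₁, h₁⟩ := hφ.2 1 le_rfl (by norm_num)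
  obtain ⟨C₂, h₂⟩ := hφ.2 2 (by norm_num) (by norm_num)
  have hd : Differentiable ℝ φ := hφ.1.differentiable (by norm_num)
  have hC₂ : 0 ≤ C₂ := (norm_nonneg _).trans (h₂ 0)
  set S₂ := ⨆ p : H × H × H, |iteratedFDeriv ℝ 2 φ p.1 ![p.2.1, p.2.2]| / (‖p.2.1‖ * ‖p.2.2‖)
    with hS₂
  have hS₁0 : 0 ≤ tripleNorm₁ φ := Real.iSup_nonneg fun p => by positivity
  have hS₂0 : 0 ≤ S₂ := Real.iSup_nonneg fun p => by positivity
  have hK : tripleNorm₂ φ = tripleNorm₁ φ + S₂ := rfl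
  -- A real supremum over an unbounded family is 0 by default, so boundedness has to be known before
  -- the quotients can be compared with it.
  have hb₁ : BddAbove (Set.range fun p : H × H => |fderiv ℝ φ p.1 p.2| / ‖p.2‖) := by
    refine ⟨C₁, ?_⟩
    rintro _ ⟨p, rfl⟩
    refine (div_le_of_le_mul₀ (norm_nonneg _) (norm_nonneg _) ((fderiv ℝ φ p.1).le_opNorm p.2)).trans
      ?_
    rw [← norm_iteratedFDeriv_one]
    exact h₁ _
  have hb₂ : BddAbove (Set.range fun p : H × H × H =>
      |iteratedFDeriv ℝ 2 φ p.1 ![p.2.1, p.2.2]| / (‖p.2.1‖ * ‖p.2.2‖)) := by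
    refine ⟨C₂, ?_⟩
    rintro _ ⟨p, rfl⟩
    refine div_le_of_le_mul₀ (by positivity) hC₂ ?_
    have h := (iteratedFDeriv ℝ 2 φ p.1).le_opNorm ![p.2.1, p.2.2]
    rw [Fin.prod_univ_two] at h
    exact h.trans (mul_le_mul_of_nonneg_right (h₂ _) (by simp; positivity))
  have hD : ∀ x, ‖fderiv ℝ φ x‖ ≤ tripleNorm₁ φ := fun x =>
    ContinuousLinearMap.opNorm_le_bound _ hS₁0 fun h => by
      rcases eq_or_ne h 0 with rfl | hh
      · simp
      · exact (div_le_iff₀ (norm_pos_iff.2 hh)).1 (le_ciSup hb₁ (x, h))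
  have hD2 : ∀ x, ‖fderiv ℝ (fderiv ℝ φ) x‖ ≤ S₂ := fun x =>
    ContinuousLinearMap.opNorm_le_bound _ hS₂0 fun a =>
      ContinuousLinearMap.opNorm_le_bound _ (by positivity) fun b => by
        rcases eq_or_ne a 0 with rfl | ha
        · simp
        rcases eq_or_ne b 0 with rfl | hb
        · simp
        have h := (div_le_iff₀ (mul_pos (norm_pos_iff.2 ha) (norm_pos_iff.2 hb))).1
          (le_ciSup hb₂ (x, a, b))
        rw [iteratedFDeriv_two_apply] at h
        rw [mul_assoc]
        exact h
  have hd2 : Differentiable ℝ (fderiv ℝ φ) :=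
    (hφ.1.fderiv_right (m := 1) (by norm_num)).differentiable (by norm_num)
  refine ⟨by rw [hK]; positivity, fun x x' => ?_, fderiv ℝ φ, fun x => (hD x).trans (by linarith),
    fun x d => ?_⟩
  · refine (norm_sub_le_of_norm_fderiv_le hd hD x x').trans ?_
    gcongr
    linarith
  · refine (norm_sub_sub_fderiv_le hd hS₂0 (norm_sub_le_of_norm_fderiv_le hd2 hD2) x d).trans ?_
    gcongr
    linarith

end Hilbert

/-! ### Conversion of logarithms into powers of the step, and collection of constants. -/

theorem add_mul_harm_le {κ T Δ ε : ℝ} (hκ : 0 < κ) (hΔ : 0 < Δ) (hε : 0 ≤ ε) {N : ℕ} (hN : 1 ≤ N)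
    (hT : N * Δ = T) :
    (Δ + ε) * harm N ≤ (1 + 1 / κ) * T ^ κ * (ε / Δ ^ κ + Δ ^ (1 - κ)) := by
  have h1 : T ^ κ = (N : ℝ) ^ κ * Δ ^ κ := by
    rw [← hT, Real.mul_rpow (Nat.cast_nonneg N) hΔ.le]
  have h2 : Δ ^ (1 - κ) = Δ / Δ ^ κ := by rw [Real.rpow_sub hΔ, Real.rpow_one]
  have h3 : 0 < Δ ^ κ := Real.rpow_pos_of_pos hΔ κ
  calc (Δ + ε) * harm N ≤ (Δ + ε) * ((1 + 1 / κ) * (N : ℝ) ^ κ) := by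
        gcongr
        exact harm_le_rpow hκ hN
    _ = (1 + 1 / κ) * T ^ κ * (ε / Δ ^ κ + Δ ^ (1 - κ)) := by
        rw [h1, h2]
        field_simp
        ring

theorem combine_weak_errors {κ T Δ ε S W a b m K x : ℝ} (hκ : 0 < κ) (hΔ : 0 < Δ) (hε : 0 < ε)
    {N : ℕ} (hN : 1 ≤ N) (hT : N * Δ = T) (hK : 0 ≤ K) (hx : 0 ≤ x)
    (ha : |a - m| ≤ K * (S * ((Δ + ε) * harm N * (1 + x) ^ 2))) (hb : |b - m| ≤ K * (W * Δ)) :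
    |a - b| ≤ (2 * ((|S| + |W|) * ((1 + 1 / κ) * T ^ κ)) + 1) * (ε / Δ ^ κ + Δ ^ (1 - κ)) * K
      * (1 + x ^ 2) := by
  have hT0 : 0 < T := by
    rw [← hT]
    exact mul_pos (by exact_mod_cast hN) hΔ
  have hh := one_le_harm hN
  have hr := add_mul_harm_le hκ hΔ hε.le hN hT
  set E := (Δ + ε) * harm N with hE
  have hE0 : 0 ≤ E := by positivity
  have h1 : Δ ≤ E := by
    have : Δ * 1 ≤ (Δ + ε) * harm N := by gcongr; linarith
    linarith
  have h2 : (1 : ℝ) ≤ (1 + x) ^ 2 := one_le_pow₀ (by linarith)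
  have h3 : (1 + x) ^ 2 ≤ 2 * (1 + x ^ 2) := by nlinarith [sq_nonneg (x - 1)]
  have h4 : Δ ≤ E * (1 + x) ^ 2 := h1.trans (le_mul_of_one_le_right hE0 h2)
  have h5 : 0 ≤ ε / Δ ^ κ + Δ ^ (1 - κ) := by positivity
  have hr0 : 0 ≤ (1 + 1 / κ) * T ^ κ := by positivity
  calc |a - b| ≤ |a - m| + |b - m| := by
        rw [abs_sub_comm b m]
        exact abs_sub_le _ _ _
    _ ≤ K * (S * (E * (1 + x) ^ 2)) + K * (W * Δ) := add_le_add ha hb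
    _ ≤ K * (|S| * (E * (1 + x) ^ 2)) + K * (|W| * (E * (1 + x) ^ 2)) := by
        gcongr
        · exact le_abs_self S
        · exact le_abs_self W
    _ = K * ((|S| + |W|) * (E * (1 + x) ^ 2)) := by ring
    _ ≤ K * ((|S| + |W|) * ((1 + 1 / κ) * T ^ κ * (ε / Δ ^ κ + Δ ^ (1 - κ))
          * (2 * (1 + x ^ 2)))) := by gcongr
    _ = 2 * ((|S| + |W|) * ((1 + 1 / κ) * T ^ κ)) * (ε / Δ ^ κ + Δ ^ (1 - κ)) * K
          * (1 + x ^ 2) := by ring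
    _ ≤ _ := by
        gcongr
        linarith

/-! ### The concrete schemes as instances of the abstract estimates. -/

section Schemes

variable {H : Type*} [NormedAddCommGroup H] [InnerProductSpace ℝ H]
  {e : HilbertBasis ℕ ℝ H} {lam : ℕ → ℝ}

/-- The deterministic scheme driven by an averaged coefficient. -/
noncomputable def averagedScheme (A : H →L[ℝ] H) (f : H → H) (Δ : ℝ) (x₀ : H) : ℕ → H
  | 0 => x₀
  | n + 1 => A (averagedScheme A f Δ x₀ n + Δ • f (averagedScheme A f Δ x₀ n))

variable [CompleteSpace H] {Ω : Type*} [MeasurableSpace Ω] {P : Measure Ω} [IsProbabilityMeasure P]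

theorem norm_initial_le {ε₀ κ₀ R : ℝ} {K : ℝ → ℝ} {x₀ : H} {x₀ε y₀ε : ℝ → H} (hκ₀ : 0 ≤ κ₀)
    (h : IsInitialData e lam ε₀ κ₀ R K x₀ x₀ε y₀ε) {ε : ℝ} (hε : ε ∈ Set.Ioo 0 ε₀) :
    ‖x₀ε ε‖ + ‖y₀ε ε‖ ≤ K 0 * (1 + ‖x₀‖) := by
  simpa only [powNorm_zero] using h.bound 0 ⟨le_rfl, hκ₀⟩ ε hε

variable [MeasurableSpace H] [BorelSpace H] [SecondCountableTopology H]

theorem exists_lpBd_four_of_charFun {ν : Measure H} [IsProbabilityMeasure ν] {B : H →L[ℝ] H}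
    (h : ∀ t, charFun ν t = Complex.exp ((-(‖B t‖ ^ 2 / 2) : ℝ))) :
    ∃ M : ℝ, 0 ≤ M ∧ LpBd ν 4 (fun y => y) M := by
  have := isGaussian_of_charFun h
  exact ⟨_, ENNReal.toReal_nonneg, MemLp.lpBd (IsGaussian.memLp_id ν 4 (by norm_num))⟩

theorem exists_weak_error_bound (hlam : IsSpectrum lam)
    {F : WithLp 2 (H × H) → H} (hF : IsCkBounded 3 F) {B₂ : ℝ → H →L[ℝ] H}
    (hB₂ : ∀ τ : ℝ, 0 < τ →
      B₂ τ ∘L ContinuousLinearMap.adjoint (B₂ τ) = (1 / 2 : ℝ) • resolvent e lam τ)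
    {γ : ℕ × Fin 2 → ℕ → Ω → ℝ} (hγ : IsCylindricalGaussianFamily P γ)
    {γlim : ℕ → ℕ → Ω → ℝ} (hγlim : IsCylindricalGaussianFamily P γlim)
    {ε₀ κ₀ : ℝ} (hε₀ : 0 < ε₀) (hκ₀ : 0 ≤ κ₀) (R : ℝ) (K : ℝ → ℝ) {κ : ℝ} (hκ : 0 < κ) {T : ℝ}
    (hT : 0 < T) :
    ∃ C : ℝ, 0 < C ∧ ∀ (x₀ : H) (x₀ε y₀ε : ℝ → H), IsInitialData e lam ε₀ κ₀ R K x₀ x₀ε y₀ε →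
      ∀ φ : H → ℝ, IsCkBounded 2 φ → ∀ N : ℕ, 1 ≤ N → ∀ Δt : ℝ, Δt = T / N → ∀ ε ∈ Set.Ioo 0 ε₀,
        Integrable (fun ω => φ (slowScheme P e lam B₂ F γ ε Δt (x₀ε ε) (y₀ε ε) N ω)) P ∧
        Integrable (fun ω => φ (limitingScheme P e lam F γlim Δt x₀ N ω)) P ∧
        |(∫ ω, φ (slowScheme P e lam B₂ F γ ε Δt (x₀ε ε) (y₀ε ε) N ω) ∂P)
            - ∫ ω, φ (limitingScheme P e lam F γlim Δt x₀ N ω) ∂P|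
          ≤ C * (ε / Δt ^ κ + Δt ^ (1 - κ)) * tripleNorm₂ φ * (1 + ‖x₀‖ ^ 2) := by
  obtain ⟨L, hG⟩ := hF.isCoefficient
  set G : H → H → H := fun x y => F (WithLp.toLp 2 (x, y)) with hGdef
  have hV := isNoise_single hγlim (summable_norm_invSqrtOp_sq e hlam)
  have hZ := cylApply_isMeanSquareSum hγlim (summable_norm_invSqrtOp_sq e hlam) 0
  -- This law is built from the limiting noise, but its characteristic function involves only
  -- `Λ^{-1/2}`, so it is also the invariant law of the fast chain driven by `γ`.
  set ν := P.map (cylApply P e (invSqrtOp e lam) (γlim 0)) with hνdef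
  have hνp : IsProbabilityMeasure ν := Measure.isProbabilityMeasure_map hZ.1.aemeasurable
  have hchar := hZ.charFun_eq hγlim
  obtain ⟨M, hM, hν⟩ := exists_lpBd_four_of_charFun hchar
  have hl0 := hlam.pos 0
  -- One constant dominates the rate `R`, the bound `K 0` in `H`, the range of `ε` and the inverse
  -- spectral gap.
  set c := 1 + |R| + |K 0| + ε₀ + (lam 0)⁻¹ with hc
  have hli : 0 < (lam 0)⁻¹ := inv_pos.2 hl0
  have hR := abs_nonneg R
  have hK := abs_nonneg (K 0)
  refine ⟨2 * ((|slowConst L T M c ‖G 0 0‖| + |weakConst L T * (2 * M) ^ 2|)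
    * ((1 + 1 / κ) * T ^ κ)) + 1, by positivity, ?_⟩
  intro x₀ x₀ε y₀ε hinit φ hφ N hN Δ hΔ' ε hε
  have hN0 : (0 : ℝ) < N := by exact_mod_cast hN
  have hΔ : 0 < Δ := by rw [hΔ']; positivity
  have hNΔ : N * Δ = T := by rw [hΔ']; field_simp
  have hτ : 0 < Δ / ε := div_pos hΔ hε.1
  have hφ' := hφ.isTestFunction
  set xb := averagedScheme (resolvent e lam Δ) (average G ν) Δ x₀ with hxbdef
  have hA : ‖resolvent e lam Δ‖ ≤ 1 := (norm_resolvent_le e hlam hΔ).trans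
    ((le_abs_self _).trans (abs_resolvent_le hlam hΔ 0))
  have hs := norm_initial_le hκ₀ hinit hε
  have hrate := hinit.rate ε hε
  have hx := norm_nonneg x₀
  have hKρ : K 0 * (1 + ‖x₀‖) ≤ c * (1 + ‖x₀‖) := by
    gcongr
    linarith [le_abs_self (K 0)]
  have h1 := summable_norm_smul_resolvent_sq e hlam hτ (1 / √2)
  have h2 := summable_norm_sq_of_comp_adjoint (e := e) hlam hτ (hB₂ _ hτ)
  have hpos : 0 < 1 + Δ / ε * lam 0 := by positivity
  -- Hence `Δ / (1 - b) = Δ + ε / lam 0` and `Δ b / (1 - b) = ε / lam 0`: the mixing time of the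
  -- fast chain, in slow time, is of order `Δ + ε`.
  have hb : 1 - (1 + Δ / ε * lam 0)⁻¹ = (Δ * lam 0) * (ε + Δ * lam 0)⁻¹ := by
    have := hε.1
    field_simp
    ring
  have hb' : 0 < (Δ * lam 0) * (ε + Δ * lam 0)⁻¹ := by
    have := hε.1
    positivity
  obtain ⟨hi₁, he₁⟩ := slow_weak_error hG hM hν (isNoise_pair (r := √(2 * (Δ / ε))) hγ h1 h2)
    (map_conv_eq_of_norm_sq hchar hγ h1 h2 (invariance_norm_sq hlam hτ (hB₂ _ hτ)))
    (norm_resolvent_le e hlam hτ) (by linarith) hA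
    (norm_resolvent_pow_mul_one_sub_le e hlam hΔ) hΔ hN hNΔ
    (X := slowScheme P e lam B₂ F γ ε Δ (x₀ε ε) (y₀ε ε))
    (Y := fastScheme P e lam B₂ γ (Δ / ε) (y₀ε ε)) (xb := xb)
    (x₀ := x₀ε ε) (y₀ := y₀ε ε) (c := c) (ρ := 1 + ‖x₀‖) (ε := ε)
    (fun ω => rfl) (fun ω => rfl) (fun n ω => add_assoc _ _ _) (fun n ω => rfl) (fun n => rfl)
    (by linarith) (by linarith) hε.1 (by linarith [hε.2]) (by linarith [norm_nonneg (y₀ε ε)])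
    (by linarith [norm_nonneg (x₀ε ε)])
    (show ‖x₀‖ ≤ c * (1 + ‖x₀‖) by nlinarith)
    (hrate.trans (by
      have := hε.1
      gcongr
      linarith [le_abs_self R]))
    (by
      have hε' := hε.1
      have : Δ * (1 - (1 + Δ / ε * lam 0)⁻¹)⁻¹ = Δ + ε * (lam 0)⁻¹ := by
        rw [hb]
        field_simp
        ring
      rw [this]
      nlinarith)
    (by
      have hε' := hε.1
      have : Δ * ((1 + Δ / ε * lam 0)⁻¹ * (1 - (1 + Δ / ε * lam 0)⁻¹)⁻¹) = (lam 0)⁻¹ * ε := by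
        rw [hb]
        field_simp
      rw [this]
      gcongr
      linarith)
    hφ'
  obtain ⟨hi₂, he₂⟩ := limiting_weak_error hG hM hν hA hΔ hN hNΔ
    (X := limitingScheme P e lam F γlim Δ x₀) (xb := xb) hV (fun ω => rfl)
    (fun n ω => by rw [map_add, map_smul]; rfl) (fun n => rfl) hφ'
  refine ⟨hi₁, hi₂, combine_weak_errors hκ hΔ hε.1 hN hNΔ hφ'.nonneg hx he₁ (he₂.trans_eq ?_)⟩
  ring

end Schemes

end SlowFast

/-! ### The theorem. -/

theorem mainTheorem3
    {H : Type*} [NormedAddCommGroup H] [InnerProductSpace ℝ H] [CompleteSpace H]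
    {Ω : Type*} [MeasurableSpace Ω] (P : Measure Ω) [IsProbabilityMeasure P]
    (e : HilbertBasis ℕ ℝ H) (lam : ℕ → ℝ) (hlam : SlowFast.IsSpectrum lam)
    (F : WithLp 2 (H × H) → H) (hF : SlowFast.IsCkBounded 3 F)
    (B₂ : ℝ → H →L[ℝ] H)
    (hB₂ : ∀ τ : ℝ, 0 < τ →
      B₂ τ ∘L ContinuousLinearMap.adjoint (B₂ τ) = (1 / 2 : ℝ) • SlowFast.resolvent e lam τ)
    (γ : ℕ × Fin 2 → ℕ → Ω → ℝ) (hγ : SlowFast.IsCylindricalGaussianFamily P γ)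
    (γlim : ℕ → ℕ → Ω → ℝ) (hγlim : SlowFast.IsCylindricalGaussianFamily P γlim)
    (ε₀ Δt₀ κ₀ : ℝ) (hε₀ : 0 < ε₀) (hΔt₀ : 0 < Δt₀) (hκ₀ : κ₀ ∈ Set.Ioo (0 : ℝ) 1)
    (R : ℝ) (K : ℝ → ℝ) :
    ∀ κ ∈ Set.Ioo 0 κ₀, ∀ T : ℝ, 0 < T →
      ∃ C : ℝ, 0 < C ∧
        ∀ (x₀ : H) (x₀ε y₀ε : ℝ → H), SlowFast.IsInitialData e lam ε₀ κ₀ R K x₀ x₀ε y₀ε →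
        ∀ φ : H → ℝ, SlowFast.IsCkBounded 2 φ →
        ∀ N : ℕ, 1 ≤ N → ∀ Δt : ℝ, Δt = T / N → Δt < Δt₀ →
        ∀ ε ∈ Set.Ioo 0 ε₀,
          Integrable (fun ω => φ (SlowFast.slowScheme P e lam B₂ F γ ε Δt (x₀ε ε) (y₀ε ε) N ω)) P ∧
          Integrable (fun ω => φ (SlowFast.limitingScheme P e lam F γlim Δt x₀ N ω)) P ∧
          |(∫ ω, φ (SlowFast.slowScheme P e lam B₂ F γ ε Δt (x₀ε ε) (y₀ε ε) N ω) ∂P)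
              - ∫ ω, φ (SlowFast.limitingScheme P e lam F γlim Δt x₀ N ω) ∂P|
            ≤ C * (ε / Δt ^ κ + Δt ^ (1 - κ)) * SlowFast.tripleNorm₂ φ * (1 + ‖x₀‖ ^ 2) := by
  intro κ hκ T hT
  -- The statement puts no σ-algebra on `H`; the Borel one is introduced to speak of laws.
  letI : MeasurableSpace H := borel H
  have : BorelSpace H := ⟨rfl⟩
  have := SlowFast.secondCountableTopology_of_hilbertBasis e
  obtain ⟨C, hC, h⟩ := SlowFast.exists_weak_error_bound hlam hF hB₂ hγ hγlim hε₀ hκ₀.1.le R K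
    hκ.1 hT
  exact ⟨C, hC, fun x₀ x₀ε y₀ε hinit φ hφ N hN Δt hΔt _ ε hε =>
    h x₀ x₀ε y₀ε hinit φ hφ N hN Δt hΔt ε hε⟩
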